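/- For $a=(a_1,\dots,a_8)\in(\mathbb C^*)^8$ consider the points of $\mathbb P^1\times\mathbb P^1$ (affine coordinates $(x,y)$) $$P_{1,2}=(0,a_{1,2}),\quad P_{3,4}=(\infty,a_{3,4}),\quad P_{5,6}=(a_{5,6},0),\quad P_{7,8}=(a_{7,8},\infty),$$ and call $a$ admissible if $a_1a_2a_3a_4=a_5a_6a_7a_8=1$ and the eight points are distinct. Let $X_a$ be the blow-up of $\mathbb P^1\times\mathbb P^1$ at these points, with Picard lattice $\mathrm{Pic}=\mathbb ZH_x\oplus\mathbb ZH_y\oplus\bigoplus_{i=1}^8\mathbb ZE_i$ ($H_x,H_y,E_i$ the classes of the total transforms of $x=\mathrm{const}$, $y=\mathrm{const}$, $P_i$), intersection form $H_x\cdot H_y=1$, $H_x^2=H_y^2=H_x\cdot E_i=H_y\cdot E_i=0$, $E_i\cdot E_j=-\delta_{ij}$, and $-K=2H_x+2H_y-\sum_iE_i$. Let $M:\mathrm{Pic}\to\mathrm{Pic}$ be the linear map $$H_x\mapsto 2H_x+H_y-E_5-E_6-E_7-E_8,\quad H_y\mapsto H_x,\quad E_1\mapsto H_x-E_7,\ E_2\mapsto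 H_x-E_8,\ E_3\mapsto H_x-E_5,\ E_4\mapsto H_x-E_6,$$ $$E_5\mapsto E_1,\ E_6\mapsto E_2,\ E_7\mapsto E_3,\ E_8\mapsto E_4.$$ **(1) The autonomous mapping.** Let $a\in\mathbb C$, $a\ne0$, $a^4\neq1$, and let $X$ be the surface $X_{(-a,-1/a,\,a,\,1/a,\,a,\,1/a,\,-a,\,-1/a)}$. The mapping $x_{n+1}=-x_{n-1}\frac{(x_n-a)(x_n-1/a)}{(x_n+a)(x_n+1/a)}$, i.e. $\phi(x,y)=\left(y,-x\frac{(y-a)(y-1/a)}{(y+a)(y+1/a)}\right)$, lifts to an automorphism of $X$, which acts on $\mathrm{Pic}$ by $\phi_*=M$. The anticanonical linear system $|-K|$ (the curves of bidegree $(2,2)$ through $P_1,\dots,P_8$) has dimension exactly $1$; it is the pencil $$k\,xy-\big((x^2+1)(y^2+1)+(a+1/a)(y-x)(xy+1)\big)=0,\qquad k\in\mathbb P^1 .$$ For all but finitely many $k$ its member is a smooth curve (hence elliptic). The parameter $k$ is a morphism $X\to\mathbb P^1$, and $\phi$ maps the fibre over $k$ to the fibre over $-k$. (So $\phi$ preserves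 an elliptic fibration of degree $(2,2)$ but exchanges its fibres: type ii-1.) **(2) The deautonomized mapping.** For admissible $a$ put $q=\dfrac{a_1a_2a_7a_8}{a_3a_4a_5a_6}$ and $\sqrt q=\dfrac{a_1a_2}{a_5a_6}$ (whose square is $q$), and $$\tilde\phi_a(x,y)=\left(y,\ -a_1a_2\,x\,\frac{(y-a_3)(y-a_4)}{(y-a_1)(y-a_2)}\right),\qquad \bar a=\left(-\tfrac1{\sqrt q\,a_6},-\tfrac1{\sqrt q\,a_5},-\tfrac{\sqrt q}{a_8},-\tfrac{\sqrt q}{a_7},a_3,a_4,a_1,a_2\right).$$ Then $\bar a$ is admissible. If $a_1,a_2\notin\{a_3,a_4\}$, then $\tilde\phi_a$ lifts to an isomorphism $X_a\to X_{\bar a}$, which acts on Picard lattices by $\tilde\phi_*=M$. The parameter $q$ of $\bar a$ is $1/q$, and the fourth iterate of $a\mapsto\bar a$ is the $q$-shift $$a\mapsto(qa_1,\,qa_2,\,a_3/q,\,a_4/q,\,qa_5,\,qa_6,\,a_7/q,\,a_8/q).$$ For the parameters of (1) one has $\bar a=a$, $q=1$ and $\tilde\phi_a=\phi$. **(3) The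 extended affine Weyl group.** Put $D_0=H_x-E_1-E_2$, $D_1=H_y-E_5-E_6$, $D_2=H_x-E_3-E_4$, $D_3=H_y-E_7-E_8$. Then $-K=D_0+D_1+D_2+D_3$, the matrix $(-D_i\cdot D_j)$ is the Cartan matrix of type $A_3^{(1)}$, and $M$ exchanges $D_0\leftrightarrow D_1$ and $D_2\leftrightarrow D_3$. The elements $$\alpha_0=E_1-E_2,\ \alpha_1=E_3-E_4,\ \alpha_2=H_y-E_1-E_3,\ \alpha_3=H_x-E_5-E_7,\ \alpha_4=E_5-E_6,\ \alpha_5=E_7-E_8$$ form a basis of the orthogonal complement $Q$ of $D_0,\dots,D_3$, the matrix $(-\alpha_i\cdot\alpha_j)$ is the Cartan matrix of type $D_5^{(1)}$, and $\delta:=\alpha_0+\alpha_1+2\alpha_2+2\alpha_3+\alpha_4+\alpha_5=-K$. Let $w_i(\alpha)=\alpha-\frac{2\,\alpha\cdot\alpha_i}{\alpha_i\cdot\alpha_i}\alpha_i$ be the simple reflections of $Q$, $\sigma_{10}$ the automorphism of $Q$ exchanging $\alpha_0$ and $\alpha_1$ and fixing the other $\alpha_i$, $\sigma_{tot}$ the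 one with $\alpha_i\mapsto\alpha_{5-i}$, and $\widetilde W(D_5^{(1)})=\langle w_0,\dots,w_5,\sigma_{10},\sigma_{tot}\rangle$. Then $M$ restricts to an automorphism $\tilde\phi_*$ of $Q$ that belongs to $\widetilde W(D_5^{(1)})$, namely $$\tilde\phi_*=\sigma_{10}\circ\sigma_{tot}\circ\sigma_{10}\circ w_2\circ w_1\circ w_0\circ w_2\circ w_1\circ w_0,$$ $$(\alpha_0,\dots,\alpha_5)\mapsto(-\alpha_5,-\alpha_4,-\alpha_3,\ \alpha_2+2\alpha_3+\alpha_4+\alpha_5,\ \alpha_0,\alpha_1),$$ and $\tilde\phi_*^4\in\widetilde W(D_5^{(1)})$ is a nontrivial translation, i.e. of the form $v\mapsto v+l(v)\delta$ with a linear $l:Q\to\mathbb Z$, $l\neq 0$, $l(\delta)=0$: it maps $\alpha_2\mapsto\alpha_2-2\delta$, $\alpha_3\mapsto\alpha_3+2\delta$ and fixes $\alpha_0,\alpha_1,\alpha_4,\alpha_5$. In this sense $\tilde\phi^4$ is a $q$-Painlevé equation $qP(A_3^{(1)})$ with the above $q$. -/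

import Mathlib

open MvPolynomial
open scoped LinearAlgebra.Projectivization

noncomputable section

namespace CaseIIOne

/-! ## Projective spaces and blow-ups of `P¹ × P¹` at eight points -/

/-- The complex projective line; the affine point `x` is `[x : 1]` and infinity is `[1 : 0]`. -/
abbrev Line : Type := ℙ ℂ (Fin 2 → ℂ)

/-- Projective three-space with homogeneous coordinates grouped in two pairs. -/
abbrev Space : Type := ℙ ℂ (Fin 2 ⊕ Fin 2 → ℂ)

/-- `v` is a vector of homogeneous coordinates of the point `z` of a projective space. -/
def HasCoords {κ : Type} (z : ℙ ℂ (κ → ℂ)) (v : κ → ℂ) : Prop :=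
  ∃ h : v ≠ 0, z = Projectivization.mk ℂ v h

/-- The ambient multiprojective space `(P¹)² × (P³)⁸`. -/
abbrev Ambient : Type := (Fin 2 → Line) × (Fin 8 → Space)

/-- The homogeneous coordinates of the ambient space: `Sum.inl (0, j)` are those of `x`,
`Sum.inl (1, j)` those of `y`, and `Sum.inr (i, j)` those of the `i`-th copy of `P³`. -/
abbrev Var : Type := (Fin 2 × Fin 2) ⊕ (Fin 8 × (Fin 2 ⊕ Fin 2))

/-- The blocks of coordinates, one for each projective factor of the ambient space. -/
abbrev Block : Type := Fin 2 ⊕ Fin 8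

/-- The block to which a coordinate belongs. -/
def blockOf : Var → Block := Sum.map Prod.fst Prod.fst

/-- The coordinates of `v` in the `b`-th factor `P¹`. -/
def baseCoords (v : Var → ℂ) (b : Fin 2) : Fin 2 → ℂ := fun j => v (Sum.inl (b, j))

/-- The coordinates of `v` in the `i`-th factor `P³`. -/
def excCoords (v : Var → ℂ) (i : Fin 8) : Fin 2 ⊕ Fin 2 → ℂ := fun j => v (Sum.inr (i, j))

/-- `v` is a system of multihomogeneous coordinates of the point `z`. -/
def Represents (v : Var → ℂ) (z : Ambient) : Prop :=
  (∀ b, HasCoords (z.1 b) (baseCoords v b)) ∧ (∀ i, HasCoords (z.2 i) (excCoords v i))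

/-- `F` is multihomogeneous, of degree `d k` in the coordinates of the block `k`. -/
def IsForm (d : Block → ℕ) (F : MvPolynomial Var ℂ) : Prop :=
  IsWeightedHomogeneous (fun c : Var => (Pi.single (blockOf c) 1 : Block → ℕ)) F d

/-- The linear form on `P¹` that vanishes exactly at the point with coordinates `p`. -/
def lin (p x : Fin 2 → ℂ) : ℂ := x 0 * p 1 - x 1 * p 0

/-- The blow-up of `P¹ × P¹` at the points `P i = (p, q)` with homogeneous coordinates
`p = P i 0` and `q = P i 1`, which have to be distinct. Near `P i` the two functions
`lin p x` and `lin q y` are local parameters, and the blow-up is given there by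
`s * lin q y = t * lin p x` with `[s : t]` in `P¹`. As `s` and `t` scale with the coordinates of
`x` and `y`, the pair is recorded through the point `[s y₀ : s y₁ : t x₀ : t x₁]` of `P³`: this is
the closure of the graph of the map given by the forms
`lin p x * y₀`, `lin p x * y₁`, `lin q y * x₀`, `lin q y * x₁` of bidegree `(1, 1)`, which generate
the ideal sheaf of `P i`. -/
def blowUp (P : Fin 8 → Fin 2 → Fin 2 → ℂ) : Set Ambient :=
  {z | ∃ v, Represents v z ∧ ∀ i, ∃ s t : ℂ,
    excCoords v i = Sum.elim (s • baseCoords v 1) (t • baseCoords v 0) ∧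
    s * lin (P i 1) (baseCoords v 1) = t * lin (P i 0) (baseCoords v 0)}

/-- `z` lies over the point of `P¹ × P¹` with affine coordinates `(x, y)`. -/
def Over (z : Ambient) (x y : ℂ) : Prop :=
  HasCoords (z.1 0) ![x, 1] ∧ HasCoords (z.1 1) ![y, 1]

/-! ## Morphisms and line bundles -/

/-- A map from a subvariety of the ambient space to a projective space is regular if around each
point it is given by forms of the same multidegree without common zero at that point. -/
def IsRegular {X : Set Ambient} {κ : Type} (f : X → ℙ ℂ (κ → ℂ)) : Prop :=
  ∀ z₀ : X, ∃ (d : Block → ℕ) (F : κ → MvPolynomial Var ℂ),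
    (∀ j, IsForm d (F j)) ∧
    (∃ v, Represents v z₀ ∧ (fun j => eval v (F j)) ≠ 0) ∧
    ∀ (z : X) (v : Var → ℂ), Represents v z → (fun j => eval v (F j)) ≠ 0 →
      HasCoords (f z) (fun j => eval v (F j))

/-- A map between subvarieties of the ambient space is regular if all its components are. -/
def IsRegularMap {X Y : Set Ambient} (f : X → Y) : Prop :=
  (∀ b, IsRegular fun z => (f z).1.1 b) ∧ (∀ i, IsRegular fun z => (f z).1.2 i)

/-- An isomorphism of varieties. -/
def IsIsomorphism {X Y : Set Ambient} (f : X ≃ Y) : Prop :=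
  IsRegularMap f ∧ IsRegularMap f.symm

/-- `s` is a section over `X` of the line bundle `O(d)`, where `d` is a multidegree: a function of
the homogeneous coordinates of the points of `X` that is locally a quotient of two forms whose
multidegrees have the difference `d`. -/
def IsSection (X : Set Ambient) (d : Block → ℤ) (s : (Var → ℂ) → ℂ) : Prop :=
  ∀ z₀ ∈ X, ∃ (n m : Block → ℕ) (F G : MvPolynomial Var ℂ),
    (∀ k, (n k : ℤ) - m k = d k) ∧ IsForm n F ∧ IsForm m G ∧
    (∃ v, Represents v z₀ ∧ eval v G ≠ 0) ∧
    ∀ z ∈ X, ∀ v, Represents v z → eval v G ≠ 0 → s v = eval v F / eval v G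

/-- The Picard lattice of the blow-up, with the basis `H_x, H_y, E_1, ..., E_8`: the classes of the
total transforms of the lines `x = const`, `y = const` and of the eight points. -/
abbrev Pic : Type := Fin 10 → ℤ

/-- The class `H_x`. -/
def Hx : Pic := Pi.single 0 1

/-- The class `H_y`. -/
def Hy : Pic := Pi.single 1 1

/-- The class `E_{i+1}`. -/
def E (i : Fin 8) : Pic := Pi.single (Fin.natAdd 2 i) 1

/-- The matrix of the intersection form: `H_x · H_y = 1`, `H_x² = H_y² = 0`,
`E_i · E_j = - δ_ij`, `H_x · E_i = H_y · E_i = 0`. -/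
def gram : Matrix (Fin 10) (Fin 10) ℤ := Matrix.of fun i j =>
  if i < 2 ∧ j < 2 then (if i = j then 0 else 1) else (if i = j then -1 else 0)

/-- The intersection form. -/
def inter : LinearMap.BilinForm ℤ Pic := Matrix.toBilin' gram

/-- The anticanonical class `-K = 2 H_x + 2 H_y - E_1 - ... - E_8`. -/
def antiK : Pic := 2 • Hx + 2 • Hy - ∑ i, E i

/-- The multidegree `d` such that `O(d)` restricted to the blow-up has the given class. The bundle
`O(1)` of the two factors `P¹` restricts to `H_x` and `H_y`, that of the `i`-th factor `P³` to
`H_x + H_y - E_i`, so these ten classes form another basis of the Picard lattice. -/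
def multidegree (D : Pic) : Block → ℤ :=
  Sum.elim ![D 0 + ∑ i : Fin 8, D (Fin.natAdd 2 i), D 1 + ∑ i : Fin 8, D (Fin.natAdd 2 i)]
    (fun i => - D (Fin.natAdd 2 i))

/-- For a morphism `f` from `X` to a projective space, the bundle `f^* O(1)` is isomorphic to the
line bundle of class `D`: `f` is given by sections of that bundle without common zero. -/
def PullsBackTo {X : Set Ambient} {κ : Type} (f : X → ℙ ℂ (κ → ℂ)) (D : Pic) : Prop :=
  ∃ s : κ → (Var → ℂ) → ℂ, (∀ j, IsSection X (multidegree D) (s j)) ∧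
    ∀ (z : X) (v : Var → ℂ), Represents v z → HasCoords (f z) (fun j => s j v)

/-- The linear map `g` is the action `f^*` of the morphism `f : X → Y` of blow-ups on Picard
lattices; it is enough to say this on the basis `H_x, H_y, H_x + H_y - E_i`. -/
def IsPullback {X Y : Set Ambient} (f : X → Y) (g : Pic →ₗ[ℤ] Pic) : Prop :=
  PullsBackTo (fun z => (f z).1.1 0) (g Hx) ∧ PullsBackTo (fun z => (f z).1.1 1) (g Hy) ∧
    ∀ i, PullsBackTo (fun z => (f z).1.2 i) (g (Hx + Hy - E i))

/-- The linear map `g` is the action `f_* = (f⁻¹)^*` of the isomorphism `f`. -/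
def IsPushforward {X Y : Set Ambient} (f : X ≃ Y) (g : Pic →ₗ[ℤ] Pic) : Prop :=
  IsPullback f.symm g

/-! ## Curves in `P¹ × P¹` -/

/-- Polynomials in the coordinates of `P¹ × P¹`; the variable `(0, j)` is the `j`-th homogeneous
coordinate of `x`, the variable `(1, j)` that of `y`. -/
abbrev BiPoly : Type := MvPolynomial (Fin 2 × Fin 2) ℂ

/-- The value at the point with homogeneous coordinates `p 0`, `p 1`. -/
def valueAt (p : Fin 2 → Fin 2 → ℂ) (F : BiPoly) : ℂ := eval (fun c => p c.1 c.2) F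

/-- The forms of bidegree `(2, 2)` that vanish at the eight points: the equations of the members of
the linear system `|-K|` of the blow-up. -/
def anticanonicalForms (P : Fin 8 → Fin 2 → Fin 2 → ℂ) : Submodule ℂ BiPoly :=
  weightedHomogeneousSubmodule ℂ
      (fun c : Fin 2 × Fin 2 => (Pi.single c.1 1 : Fin 2 → ℕ)) (fun _ => 2) ⊓
    ⨅ i, LinearMap.ker (aeval (fun c : Fin 2 × Fin 2 => P i c.1 c.2) : BiPoly →ₐ[ℂ] ℂ).toLinearMap

/-- The curve with the bihomogeneous equation `F = 0` in `P¹ × P¹` is smooth. -/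
def IsSmoothCurve (F : BiPoly) : Prop :=
  ∀ p : Fin 2 → Fin 2 → ℂ, p 0 ≠ 0 → p 1 ≠ 0 → valueAt p F = 0 →
    ∃ c, valueAt p (pderiv c F) ≠ 0

/-- The form `x y`, homogenized to bidegree `(2, 2)`. -/
def formOne : BiPoly := X (0, 0) * X (0, 1) * X (1, 0) * X (1, 1)

/-- The form `(x² + 1) (y² + 1) + (a + 1/a) (y - x) (x y + 1)`, homogenized to bidegree `(2, 2)`. -/
def formTwo (a : ℂ) : BiPoly :=
  (X (0, 0) ^ 2 + X (0, 1) ^ 2) * (X (1, 0) ^ 2 + X (1, 1) ^ 2) +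
    C (a + 1 / a) * (X (1, 0) * X (0, 1) - X (0, 0) * X (1, 1)) *
      (X (0, 0) * X (1, 0) + X (0, 1) * X (1, 1))

/-! ## The family of surfaces. The parameters `a_1, ..., a_8` are `a 0, ..., a 7`. -/

/-- The points `(0, a_1), (0, a_2), (∞, a_3), (∞, a_4), (a_5, 0), (a_6, 0), (a_7, ∞), (a_8, ∞)`. -/
def points (a : Fin 8 → ℂ) : Fin 8 → Fin 2 → Fin 2 → ℂ :=
  ![![![0, 1], ![a 0, 1]], ![![0, 1], ![a 1, 1]], ![![1, 0], ![a 2, 1]], ![![1, 0], ![a 3, 1]],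
    ![![a 4, 1], ![0, 1]], ![![a 5, 1], ![0, 1]], ![![a 6, 1], ![1, 0]], ![![a 7, 1], ![1, 0]]]

/-- The surface with the parameters `a`. -/
def surface (a : Fin 8 → ℂ) : Set Ambient := blowUp (points a)

/-- Admissible parameters: nonzero, normalized, with eight distinct points. -/
structure IsParam (a : Fin 8 → ℂ) : Prop where
  ne_zero : ∀ i, a i ≠ 0
  norm_left : a 0 * a 1 * a 2 * a 3 = 1
  norm_right : a 4 * a 5 * a 6 * a 7 = 1
  ne_one_two : a 0 ≠ a 1
  ne_three_four : a 2 ≠ a 3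
  ne_five_six : a 4 ≠ a 5
  ne_seven_eight : a 6 ≠ a 7

/-- The parameter `q`. -/
def qParam (a : Fin 8 → ℂ) : ℂ := (a 0 * a 1 * a 6 * a 7) / (a 2 * a 3 * a 4 * a 5)

/-- The square root of `q` for normalized parameters. -/
def sqrtQ (a : Fin 8 → ℂ) : ℂ := (a 0 * a 1) / (a 4 * a 5)

/-- The action of the deautonomized mapping on the parameters. -/
def nextParam (a : Fin 8 → ℂ) : Fin 8 → ℂ :=
  ![-1 / (sqrtQ a * a 5), -1 / (sqrtQ a * a 4), -sqrtQ a / a 7, -sqrtQ a / a 6,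
    a 2, a 3, a 0, a 1]

/-- The second component of the deautonomized mapping
`(x, y) ↦ (y, - a_1 a_2 x (y - a_3) (y - a_4) / ((y - a_1) (y - a_2)))`. -/
def nextY (a : Fin 8 → ℂ) (x y : ℂ) : ℂ :=
  -(a 0 * a 1) * x * ((y - a 2) * (y - a 3)) / ((y - a 0) * (y - a 1))

/-- The parameters of the autonomous mapping. -/
def autoParam (a : ℂ) : Fin 8 → ℂ := ![-a, -1 / a, a, 1 / a, a, 1 / a, -a, -1 / a]

/-- The action of the mapping on Picard lattices,
`(h_0, h_1, e_1, ..., e_8) ↦ (h_0, h_1, e_1, ..., e_8) M`. -/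
def phiPic : Pic →ₗ[ℤ] Pic := Matrix.vecMulLinear
  !![2, 1, 0, 0, 0, 0, -1, -1, -1, -1;
     1, 0, 0, 0, 0, 0, 0, 0, 0, 0;
     1, 0, 0, 0, 0, 0, 0, 0, -1, 0;
     1, 0, 0, 0, 0, 0, 0, 0, 0, -1;
     1, 0, 0, 0, 0, 0, -1, 0, 0, 0;
     1, 0, 0, 0, 0, 0, 0, -1, 0, 0;
     0, 0, 1, 0, 0, 0, 0, 0, 0, 0;
     0, 0, 0, 1, 0, 0, 0, 0, 0, 0;
     0, 0, 0, 0, 1, 0, 0, 0, 0, 0;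
     0, 0, 0, 0, 0, 1, 0, 0, 0, 0]

/-! ## The root lattice and the extended affine Weyl group -/

/-- The classes `D_0, ..., D_3` of the strict transforms of the lines
`x = 0`, `y = 0`, `x = ∞`, `y = ∞`. -/
def sides : Fin 4 → Pic :=
  ![Hx - E 0 - E 1, Hy - E 4 - E 5, Hx - E 2 - E 3, Hy - E 6 - E 7]

/-- The simple roots `α_0, ..., α_5`. -/
def root : Fin 6 → Pic :=
  ![E 0 - E 1, E 2 - E 3, Hy - E 0 - E 2, Hx - E 4 - E 6, E 4 - E 5, E 6 - E 7]

/-- The root lattice `Q`, the free abelian group on the simple roots. -/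
abbrev RootLattice : Type := Fin 6 → ℤ

/-- The `i`-th simple root as an element of `Q`. -/
def simple (i : Fin 6) : RootLattice := Pi.single i 1

/-- The map from `Q` to the Picard lattice. -/
def toPic : RootLattice →ₗ[ℤ] Pic := Fintype.linearCombination ℤ root

/-- The Cartan matrix of type `A_3^{(1)}`, whose Dynkin diagram is a cycle of length four. -/
def cartanA : Matrix (Fin 4) (Fin 4) ℤ :=
  !![2, -1, 0, -1; -1, 2, -1, 0; 0, -1, 2, -1; -1, 0, -1, 2]

/-- The Cartan matrix of type `D_5^{(1)}`: the nodes `0`, `1` are joined to `2`, which is joined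
to `3`, which is joined to `4`, `5`. -/
def cartanD : Matrix (Fin 6) (Fin 6) ℤ :=
  !![2, 0, -1, 0, 0, 0; 0, 2, -1, 0, 0, 0; -1, -1, 2, -1, 0, 0;
     0, 0, -1, 2, -1, -1; 0, 0, 0, -1, 2, 0; 0, 0, 0, -1, 0, 2]

/-- The coroot of `α_i`: since `α_i · α_i = -2`, the number `2 (α · α_i) / (α_i · α_i)` is
`- (α · α_i)`. -/
def coroot (i : Fin 6) : Module.Dual ℤ RootLattice := -((inter (root i)).comp toPic)

theorem coroot_simple (i : Fin 6) : coroot i (simple i) = 2 := by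
  have h : ∀ i : Fin 6, root i ⬝ᵥ Matrix.mulVec gram (root i) = -2 := by decide
  have e : toPic (simple i) = root i := by
    simp [toPic, simple, Fintype.linearCombination_apply_single]
  simp [coroot, e, inter, Matrix.toBilin'_apply', h]

/-- The elementary reflection `w_i`, `α ↦ α - (2 (α · α_i) / (α_i · α_i)) α_i`. -/
def w (i : Fin 6) : RootLattice ≃ₗ[ℤ] RootLattice := Module.reflection (coroot_simple i)

/-- The automorphism of `Q` that permutes the simple roots, `α_i ↦ α_{p i}`. -/
def permRoots (p : Equiv.Perm (Fin 6)) : RootLattice ≃ₗ[ℤ] RootLattice :=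
  (Pi.basisFun ℤ (Fin 6)).equiv (Pi.basisFun ℤ (Fin 6)) p

/-- The permutation `σ_{10}`, which exchanges `α_0` and `α_1`. -/
def sigma : RootLattice ≃ₗ[ℤ] RootLattice := permRoots (Equiv.swap 0 1)

/-- The permutation `σ_{tot}`, `α_i ↦ α_{5 - i}`. -/
def sigmaTot : RootLattice ≃ₗ[ℤ] RootLattice := permRoots Fin.revPerm

/-- The extended affine Weyl group generated by `w_0, ..., w_5`, `σ_{10}`, `σ_{tot}`; the product
is composition. -/
def extendedWeylGroup : Subgroup (RootLattice ≃ₗ[ℤ] RootLattice) :=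
  Subgroup.closure (Set.range w ∪ {sigma, sigmaTot})

/-- The null root `δ = α_0 + α_1 + 2 α_2 + 2 α_3 + α_4 + α_5`. -/
def delta : RootLattice := ![1, 1, 2, 2, 1, 1]

/-- A nontrivial translation: it moves each element of `Q` by a multiple of `δ` that depends
linearly on it, and fixes `δ`. -/
def IsTranslation (g : RootLattice ≃ₗ[ℤ] RootLattice) : Prop :=
  ∃ l : Module.Dual ℤ RootLattice, l ≠ 0 ∧ l delta = 0 ∧ ∀ v, g v = v + l v • delta

end CaseIIOne

end

/-!
The surfaces are handled through Cox coordinates. A point of the blow-up has homogeneous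
coordinates `x`, `y` of its image in `P¹ × P¹` and, for each of the eight points `P i`, the values
of the equation `e i` of the exceptional curve and of the equations `s i`, `t i` of the strict
transforms of the lines `x = const` and `y = const` through `P i`. They satisfy
`e i * s i = lin (P i 0) x` and `e i * t i = lin (P i 1) y`, and `s i`, `t i` are not both zero
(`Cox.IsOn`). These coordinates and the multihomogeneous coordinates of the ambient space
determine each other (`std_build`, `build_std`), and every component is a section of a line
bundle, of class `H_x`, `H_y`, `E_i`, `H_x - E_i` or `H_y - E_i` (`std_coxSec`). So a map of
blow-ups may be defined by formulas in Cox coordinates: if the components of the image are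
sections of bundles with the corresponding classes, the map is regular and its action on Picard
lattices can be read off (`CoxSec.exists_map`). The only way in which sections arise, apart from
sums and products, is as the common value of two fractions `n₁ / d₁` and `n₂ / d₂` whose
denominators have no common zero (`quot`, `Sec.quot`).

The deautonomized mapping is the exchange of `x` and `y`, followed by the elementary
transformation `(x, y) ↦ (x, κ y (x - a₇) (x - a₈) / ((x - a₅) (x - a₆)))`. The latter exchanges
the exceptional curves over the last four points with the strict transforms of the lines
`x = const` through them, and moves the first four points along the lines `x = 0` and `x = ∞`; in
Cox coordinates it is polynomial apart from quotients of the kind above (`Cox.rho`). The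
elementary transformation with `κ⁻¹` at the target is its inverse (`Cox.rho_rho`). This gives the
isomorphisms and their push-forwards (`exists_isomorphism`).

For the autonomous parameters, a form of bidegree `(2, 2)` through the eight points is determined
on the four lines `x = 0, ∞` and `y = 0, ∞` up to a common factor, so that only the coefficient of
`x y` remains free (`anticanonicalForms_eq`). Divided by the product of all `e i`, the two forms
of the pencil become sections `pencilZ` and `pencilW` without common zero, hence a morphism to the
projective line. The mapping preserves the first and changes the sign of the second, so it maps
the fibre over `k` to the fibre over `-k` (`exists_pencil_map`). A singular point of a member of
the pencil lies off the four lines and is a critical point of the parameter; there are at most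
five critical values (`critical_value`, `finite_singular`).

The statements on parameters are identities of monomials (`IsParam.nextParam_eq_mul`), and those
on lattices are computations with explicit coordinates (`weylElement_apply`, `toPic_apply`).
-/

noncomputable section

namespace CaseIIOne

section

/-! ### Homogeneous coordinates -/

theorem HasCoords.exists_smul {κ : Type} {z : ℙ ℂ (κ → ℂ)} {v w : κ → ℂ}
    (hv : HasCoords z v) (hw : HasCoords z w) : ∃ c : ℂ, c ≠ 0 ∧ w = c • v := by
  obtain ⟨h, rfl⟩ := hv
  obtain ⟨h', e⟩ := hw
  obtain ⟨c, hc⟩ := (Projectivization.mk_eq_mk_iff' ℂ w v h' h).1 e.symm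
  refine ⟨c, ?_, hc.symm⟩
  rintro rfl
  exact h' (by simpa using hc.symm)

theorem HasCoords.smul {κ : Type} {z : ℙ ℂ (κ → ℂ)} {v : κ → ℂ}
    (hv : HasCoords z v) {c : ℂ} (hc : c ≠ 0) : HasCoords z (c • v) := by
  obtain ⟨h, rfl⟩ := hv
  refine ⟨smul_ne_zero hc h, ?_⟩
  exact (Projectivization.mk_eq_mk_iff' ℂ _ _ _ _).2 ⟨c⁻¹, by simp [smul_smul, hc]⟩

theorem HasCoords.of_smul {κ : Type} {z : ℙ ℂ (κ → ℂ)} {v : κ → ℂ} {c : ℂ}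
    (hv : HasCoords z (c • v)) : HasCoords z v := by
  have hc : c ≠ 0 := by
    rintro rfl
    exact hv.1 (zero_smul _ _)
  simpa [smul_smul, hc] using hv.smul (inv_ne_zero hc)

theorem HasCoords.eq {κ : Type} {z z' : ℙ ℂ (κ → ℂ)} {v : κ → ℂ}
    (h : HasCoords z v) (h' : HasCoords z' v) : z = z' := by
  obtain ⟨_, rfl⟩ := h
  obtain ⟨_, rfl⟩ := h'
  rfl

theorem Represents.eq {v : Var → ℂ} {z z' : Ambient} (h : Represents v z)
    (h' : Represents v z') : z = z' :=
  Prod.ext (funext fun b => (h.1 b).eq (h'.1 b)) (funext fun i => (h.2 i).eq (h'.2 i))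

theorem exists_represents (z : Ambient) : ∃ v, Represents v z := by
  refine ⟨Sum.elim (fun c => (z.1 c.1).rep c.2) (fun c => (z.2 c.1).rep c.2), fun b => ?_,
    fun i => ?_⟩
  · exact ⟨(z.1 b).rep_nonzero, (z.1 b).mk_rep.symm⟩
  · exact ⟨(z.2 i).rep_nonzero, (z.2 i).mk_rep.symm⟩

/-- Two coordinate vectors of a point differ by one nonzero factor in each block. -/
theorem Represents.exists_scaling {v w : Var → ℂ} {z : Ambient} (hv : Represents v z)
    (hw : Represents w z) :
    ∃ r : Block → ℂ, (∀ k, r k ≠ 0) ∧ w = fun c => r (blockOf c) * v c := by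
  choose r hr hr' using fun b => (hv.1 b).exists_smul (hw.1 b)
  choose u hu hu' using fun i => (hv.2 i).exists_smul (hw.2 i)
  refine ⟨Sum.elim r u, by rintro (b | i) <;> simp [hr, hu], ?_⟩
  funext c
  rcases c with ⟨b, j⟩ | ⟨i, j⟩
  · exact congrFun (hr' b) j
  · exact congrFun (hu' i) j

/-- `v` is a system of multihomogeneous coordinates of some point of `X`. -/
def OnSet (X : Set Ambient) (v : Var → ℂ) : Prop := ∃ z ∈ X, Represents v z

/-! ### Forms and sections of line bundles -/

theorem IsForm.mul {m n : Block → ℕ} {F G : MvPolynomial Var ℂ} (hF : IsForm m F)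
    (hG : IsForm n G) : IsForm (m + n) (F * G) :=
  IsWeightedHomogeneous.mul hF hG

theorem isForm_C (c : ℂ) : IsForm 0 (C c) := isWeightedHomogeneous_C _ c

theorem isForm_X (c : Var) : IsForm (Pi.single (blockOf c) 1) (X c) :=
  isWeightedHomogeneous_X ℂ _ c

theorem IsForm.add {m : Block → ℕ} {F G : MvPolynomial Var ℂ} (hF : IsForm m F)
    (hG : IsForm m G) : IsForm m (F + G) :=
  (weightedHomogeneousSubmodule ℂ _ m).add_mem hF hG

theorem IsForm.prod {κ : Type} (s : Finset κ) {m : κ → Block → ℕ} {F : κ → MvPolynomial Var ℂ}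
    (hF : ∀ j ∈ s, IsForm (m j) (F j)) : IsForm (∑ j ∈ s, m j) (∏ j ∈ s, F j) :=
  IsWeightedHomogeneous.prod s F m hF

theorem IsForm.eval_scale {d : Block → ℕ} {F : MvPolynomial Var ℂ} (hF : IsForm d F)
    (r : Block → ℂ) (v : Var → ℂ) :
    eval (fun c => r (blockOf c) * v c) F = (∏ k, r k ^ d k) * eval v F := by
  rw [eval_eq', eval_eq', Finset.mul_sum]
  refine Finset.sum_congr rfl fun e he => ?_
  have h := hF (mem_support_iff.1 he)
  have h2 : ∏ c, r (blockOf c) ^ e c = ∏ k, r k ^ d k := by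
    rw [← h]
    have : ∀ k, r k ^ (Finsupp.weight (fun c : Var => (Pi.single (blockOf c) 1 : Block → ℕ)) e) k
        = ∏ c, (if blockOf c = k then r k ^ e c else 1) := by
      intro k
      rw [Finsupp.weight_apply, Finsupp.sum_fintype _ _ (by simp), Finset.sum_apply,
        ← Finset.prod_pow_eq_pow_sum]
      refine Finset.prod_congr rfl fun c _ => ?_
      by_cases hc : blockOf c = k
      · subst hc; simp
      · simp [hc, Ne.symm hc]
    simp_rw [this]
    rw [Finset.prod_comm]
    refine Finset.prod_congr rfl fun c _ => ?_
    simp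
  simp_rw [mul_pow]
  rw [Finset.prod_mul_distrib, h2]
  ring

/-- Around the point with coordinates `v₀`, the function `s` of the coordinates of the points
of `X` is a section of the line bundle of class `D`. -/
def SecAt (X : Set Ambient) (D : Pic) (s : (Var → ℂ) → ℂ) (v₀ : Var → ℂ) : Prop :=
  ∃ (n m : Block → ℕ) (F G : MvPolynomial Var ℂ),
    (∀ k, (n k : ℤ) - m k = multidegree D k) ∧ IsForm n F ∧ IsForm m G ∧ eval v₀ G ≠ 0 ∧
    ∀ v, OnSet X v → eval v G ≠ 0 → s v = eval v F / eval v G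

/-- The function `s` of the coordinates of the points of `X` is a section of the line bundle of
class `D`. -/
def Sec (X : Set Ambient) (D : Pic) (s : (Var → ℂ) → ℂ) : Prop :=
  ∀ v₀, OnSet X v₀ → SecAt X D s v₀

theorem multidegree_add (D D' : Pic) (k : Block) :
    multidegree (D + D') k = multidegree D k + multidegree D' k := by
  rcases k with b | i
  · fin_cases b <;> simp [multidegree, Finset.sum_add_distrib] <;> ring
  · simp [multidegree]; ring

theorem multidegree_neg (D : Pic) (k : Block) :
    multidegree (-D) k = -multidegree D k := by
  rcases k with b | i
  · fin_cases b <;> simp [multidegree] <;> ring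
  · simp [multidegree]

theorem multidegree_zero (k : Block) : multidegree 0 k = 0 := by
  rcases k with b | i
  · fin_cases b <;> simp [multidegree]
  · simp [multidegree]

variable {X : Set Ambient} {D D' D₁ D₂ : Pic} {r s s' : (Var → ℂ) → ℂ} {v₀ : Var → ℂ}

theorem SecAt.mul (hs : SecAt X D s v₀) (hr : SecAt X D' r v₀) :
    SecAt X (D + D') (fun v => s v * r v) v₀ := by
  obtain ⟨n, m, F, G, h, hF, hG, h0, e⟩ := hs
  obtain ⟨n', m', F', G', h', hF', hG', h0', e'⟩ := hr
  refine ⟨n + n', m + m', F * F', G * G', fun k => ?_, hF.mul hF', hG.mul hG', ?_, ?_⟩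
  · rw [multidegree_add, ← h, ← h']; push_cast [Pi.add_apply]; ring
  · rw [map_mul]; exact mul_ne_zero h0 h0'
  · intro v hv hne
    rw [map_mul, mul_ne_zero_iff] at hne
    beta_reduce
    rw [e v hv hne.1, e' v hv hne.2, map_mul, map_mul, div_mul_div_comm]

theorem SecAt.add (hs : SecAt X D s v₀) (hr : SecAt X D r v₀) :
    SecAt X D (fun v => s v + r v) v₀ := by
  obtain ⟨n, m, F, G, h, hF, hG, h0, e⟩ := hs
  obtain ⟨n', m', F', G', h', hF', hG', h0', e'⟩ := hr
  have hn : m + n' = n + m' := by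
    funext k
    have h1 := h k
    have h2 := h' k
    simp only [Pi.add_apply]
    omega
  refine ⟨n + m', m + m', F * G' + G * F', G * G', fun k => ?_,
    (hF.mul hG').add (hn ▸ hG.mul hF'), hG.mul hG', ?_, ?_⟩
  · rw [← h]; push_cast [Pi.add_apply]; ring
  · rw [map_mul]; exact mul_ne_zero h0 h0'
  · intro v hv hne
    rw [map_mul, mul_ne_zero_iff] at hne
    beta_reduce
    rw [e v hv hne.1, e' v hv hne.2, map_mul, map_add, map_mul, map_mul,
      div_add_div _ _ hne.1 hne.2]

/-- The quotient `G / F` is written as `G * G / (F * G)`, so that its denominator vanishes wherever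
the formula `F / G` for `s` is not available. -/
theorem SecAt.inv (hs : SecAt X D s v₀) (hv₀ : OnSet X v₀) (h : s v₀ ≠ 0) :
    SecAt X (-D) (fun v => (s v)⁻¹) v₀ := by
  obtain ⟨n, m, F, G, hd, hF, hG, h0, e⟩ := hs
  refine ⟨m + m, n + m, G * G, F * G, fun k => ?_, hG.mul hG, hF.mul hG, ?_, ?_⟩
  · rw [multidegree_neg, ← hd]; push_cast [Pi.add_apply]; ring
  · rw [map_mul]
    refine mul_ne_zero (fun h1 => h ?_) h0
    rw [e v₀ hv₀ h0, h1, zero_div]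
  · intro v hv hne
    rw [map_mul, mul_ne_zero_iff] at hne
    beta_reduce
    rw [e v hv hne.2, map_mul, map_mul, inv_div, mul_div_mul_right _ _ hne.2]

/-- To be a section around a point, it is enough to agree with one where some section that does
not vanish at the point is nonzero. -/
theorem SecAt.localize (hs : SecAt X D s v₀) (hr : SecAt X D' r v₀) (hv₀ : OnSet X v₀)
    (h : r v₀ ≠ 0) (hs' : ∀ v, OnSet X v → r v ≠ 0 → s' v = s v) : SecAt X D s' v₀ := by
  obtain ⟨n, m, F, G, hd, hF, hG, h0, e⟩ := hs
  obtain ⟨n', m', F', G', -, hF', hG', h0', e'⟩ := hr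
  refine ⟨n + (n' + m'), m + (n' + m'), F * (F' * G'), G * (F' * G'), fun k => ?_,
    hF.mul (hF'.mul hG'), hG.mul (hF'.mul hG'), ?_, ?_⟩
  · rw [← hd]; push_cast [Pi.add_apply]; ring
  · rw [map_mul, map_mul]
    refine mul_ne_zero h0 (mul_ne_zero (fun h1 => h ?_) h0')
    rw [e' v₀ hv₀ h0', h1, zero_div]
  · intro v hv hne
    rw [map_mul, map_mul, mul_ne_zero_iff, mul_ne_zero_iff] at hne
    rw [hs' v hv (by rw [e' v hv hne.2.2]; exact div_ne_zero hne.2.1 hne.2.2), e v hv hne.1,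
      map_mul, map_mul, map_mul, map_mul, mul_div_mul_right _ _ (mul_ne_zero hne.2.1 hne.2.2)]

theorem Sec.isSection (hs : Sec X D s) : IsSection X (multidegree D) s := by
  intro z hz
  obtain ⟨v, hv⟩ := exists_represents z
  obtain ⟨n, m, F, G, h, hF, hG, h0, e⟩ := hs v ⟨z, hz, hv⟩
  exact ⟨n, m, F, G, h, hF, hG, ⟨v, hv, h0⟩, fun z' hz' v' hv' => e v' ⟨z', hz', hv'⟩⟩

theorem Sec.mul (hs : Sec X D s) (hr : Sec X D' r) : Sec X (D + D') (fun v => s v * r v) :=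
  fun v hv => (hs v hv).mul (hr v hv)

theorem Sec.add (hs : Sec X D s) (hr : Sec X D r) : Sec X D (fun v => s v + r v) :=
  fun v hv => (hs v hv).add (hr v hv)

theorem sec_const (c : ℂ) : Sec X 0 (fun _ => c) := fun v _ =>
  ⟨0, 0, C c, C 1, fun k => by simp [multidegree_zero], isForm_C _, isForm_C _, by simp,
    fun _ _ _ => by simp⟩

theorem Sec.const_mul (c : ℂ) (hs : Sec X D s) : Sec X D (fun v => c * s v) := by
  simpa using (sec_const c).mul hs

theorem Sec.neg (hs : Sec X D s) : Sec X D (fun v => -s v) := by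
  simpa using hs.const_mul (-1)

theorem Sec.sub (hs : Sec X D s) (hr : Sec X D r) : Sec X D (fun v => s v - r v) := by
  simpa [sub_eq_add_neg] using hs.add hr.neg

/-- A section of one of the bundles `O(1)` of the factors of the ambient space. -/
theorem sec_coord (c : Var)
    (h : ∀ k, multidegree D k = Pi.single (M := fun _ => ℤ) (blockOf c) 1 k) :
    Sec X D (fun v => v c) := by
  refine fun v _ => ⟨Pi.single (blockOf c) 1, 0, MvPolynomial.X c, C 1, fun k => ?_,
    isForm_X _, isForm_C _, by simp, fun _ _ _ => by simp⟩
  rw [h]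
  by_cases hk : k = blockOf c
  · subst hk; simp
  · simp [hk]

/-! ### Common quotients -/

/-- The common value of the fractions `n₁ / d₁` and `n₂ / d₂`, one of whose denominators may be
zero. -/
def quot (n₁ d₁ n₂ d₂ : ℂ) : ℂ := if d₁ = 0 then n₂ / d₂ else n₁ / d₁

section quot

variable {n₁ d₁ n₂ d₂ : ℂ}

theorem quot_mul_left (h : d₁ ≠ 0 ∨ d₂ ≠ 0) (e : n₁ * d₂ = n₂ * d₁) :
    quot n₁ d₁ n₂ d₂ * d₁ = n₁ := by
  unfold quot
  split_ifs with h1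
  · have h2 := h.resolve_left (not_not.2 h1)
    rw [h1, mul_zero] at e ⊢
    exact ((mul_eq_zero.1 e).resolve_right h2).symm
  · field_simp

theorem quot_mul_right (h : d₁ ≠ 0 ∨ d₂ ≠ 0) (e : n₁ * d₂ = n₂ * d₁) :
    quot n₁ d₁ n₂ d₂ * d₂ = n₂ := by
  unfold quot
  split_ifs with h1
  · have h2 := h.resolve_left (not_not.2 h1)
    field_simp
  · rw [div_mul_eq_mul_div, e, mul_div_assoc, div_self h1, mul_one]

theorem quot_eq {q : ℂ} (h : d₁ ≠ 0 ∨ d₂ ≠ 0) (e₁ : q * d₁ = n₁) (e₂ : q * d₂ = n₂) :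
    quot n₁ d₁ n₂ d₂ = q := by
  unfold quot
  split_ifs with h1
  · have h2 := h.resolve_left (not_not.2 h1)
    rw [← e₂]; field_simp
  · rw [← e₁]; field_simp

end quot

/-- Two fractions of sections that agree, and one of which is always defined, glue to a section. -/
theorem Sec.quot {n₁ d₁ n₂ d₂ : (Var → ℂ) → ℂ} (hn₁ : Sec X (D + D₁) n₁) (hd₁ : Sec X D₁ d₁)
    (hn₂ : Sec X (D + D₂) n₂) (hd₂ : Sec X D₂ d₂)
    (h : ∀ v, OnSet X v → (d₁ v ≠ 0 ∨ d₂ v ≠ 0) ∧ n₁ v * d₂ v = n₂ v * d₁ v) :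
    Sec X D (fun v => quot (n₁ v) (d₁ v) (n₂ v) (d₂ v)) := by
  intro v₀ hv₀
  rcases (h v₀ hv₀).1 with h0 | h0
  · have := (hn₁ v₀ hv₀).mul ((hd₁ v₀ hv₀).inv hv₀ h0)
    rw [add_neg_cancel_right] at this
    refine this.localize (hd₁ v₀ hv₀) hv₀ h0 fun v hv hne => ?_
    rw [← div_eq_mul_inv, eq_div_iff hne, quot_mul_left (h v hv).1 (h v hv).2]
  · have := (hn₂ v₀ hv₀).mul ((hd₂ v₀ hv₀).inv hv₀ h0)
    rw [add_neg_cancel_right] at this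
    refine this.localize (hd₂ v₀ hv₀) hv₀ h0 fun v hv hne => ?_
    rw [← div_eq_mul_inv, eq_div_iff hne, quot_mul_right (h v hv).1 (h v hv).2]

/-! ### Morphisms given by sections -/

/-- A section of `O(d)` is homogeneous of multidegree `d`. -/
theorem Sec.eval_scale (hs : Sec X D s) {v w : Var → ℂ} {z : Ambient} (hz : z ∈ X)
    (hv : Represents v z) (hw : Represents w z) {u : Block → ℂ} (hu : ∀ k, u k ≠ 0)
    (e : w = fun c => u (blockOf c) * v c) : s w = (∏ k, u k ^ multidegree D k) * s v := by
  obtain ⟨n, m, F, G, h, hF, hG, h0, hs⟩ := hs v ⟨z, hz, hv⟩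
  have hp : ∏ k, u k ^ m k ≠ 0 := Finset.prod_ne_zero_iff.2 fun k _ => pow_ne_zero _ (hu k)
  have hG' : eval w G = (∏ k, u k ^ m k) * eval v G := by rw [e, hG.eval_scale]
  have hF' : eval w F = (∏ k, u k ^ n k) * eval v F := by rw [e, hF.eval_scale]
  have key : ∏ k, u k ^ multidegree D k = (∏ k, u k ^ n k) / ∏ k, u k ^ m k := by
    rw [← Finset.prod_div_distrib]
    refine Finset.prod_congr rfl fun k _ => ?_
    rw [← h, zpow_sub₀ (hu k), zpow_natCast, zpow_natCast]
  rw [hs w ⟨z, hz, hw⟩ (by rw [hG']; exact mul_ne_zero hp h0), hs v ⟨z, hz, hv⟩ h0, hG', hF', key,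
    mul_div_mul_comm]

/-- Sections of one line bundle without common zero define a map to a projective space. -/
theorem exists_map_of_sec {κ : Type} {f : κ → (Var → ℂ) → ℂ} (hf : ∀ j, Sec X D (f j))
    (h0 : ∀ v, OnSet X v → (fun j => f j v) ≠ 0) :
    ∃ φ : X → ℙ ℂ (κ → ℂ), ∀ (z : X) (v : Var → ℂ), Represents v z →
      HasCoords (φ z) (fun j => f j v) := by
  have : ∀ z : X, ∃ y : ℙ ℂ (κ → ℂ), ∀ v : Var → ℂ, Represents v z →
      HasCoords y (fun j => f j v) := by
    intro z
    obtain ⟨v, hv⟩ := exists_represents z.1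
    refine ⟨Projectivization.mk ℂ _ (h0 v ⟨z, z.2, hv⟩), fun w hw => ?_⟩
    obtain ⟨u, hu, e⟩ := hv.exists_scaling hw
    have : (fun j => f j w) = (∏ k, u k ^ multidegree D k) • fun j => f j v := by
      funext j
      exact (hf j).eval_scale z.2 hv hw hu e
    rw [this]
    refine HasCoords.smul ⟨_, rfl⟩ ?_
    exact Finset.prod_ne_zero_iff.2 fun k _ => zpow_ne_zero _ (hu k)
  choose φ hφ using this
  exact ⟨φ, hφ⟩

/-- A map given by sections of a line bundle is regular: around a point, clear the denominators
of the sections. The common denominator is kept as an additional factor, so that the resulting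
forms vanish together wherever it does. -/
theorem isRegular_of_sec {κ : Type} [Fintype κ] {f : κ → (Var → ℂ) → ℂ}
    (hf : ∀ j, Sec X D (f j)) {φ : X → ℙ ℂ (κ → ℂ)}
    (hφ : ∀ (z : X) (v : Var → ℂ), Represents v z → HasCoords (φ z) (fun j => f j v)) :
    IsRegular φ := by
  classical
  intro z₀
  obtain ⟨v₀, hv₀⟩ := exists_represents z₀.1
  choose n m F G hd hF hG h0 e using fun j => hf j v₀ ⟨z₀, z₀.2, hv₀⟩
  have hκ : Nonempty κ := by
    by_contra hκ
    rw [not_nonempty_iff] at hκ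
    exact (hφ z₀ v₀ hv₀).1 (Subsingleton.elim _ _)
  obtain ⟨j₀⟩ := hκ
  let M : Block → ℕ := ∑ j, m j
  have hH : IsForm M (∏ j, G j) := IsForm.prod _ fun j _ => hG j
  have hFj : ∀ j, IsForm (n j + ∑ l ∈ Finset.univ.erase j, m l)
      (F j * ∏ l ∈ Finset.univ.erase j, G l) :=
    fun j => (hF j).mul (IsForm.prod _ fun l _ => hG l)
  have hdeg : ∀ j, n j + ∑ l ∈ Finset.univ.erase j, m l
      = n j₀ + ∑ l ∈ Finset.univ.erase j₀, m l := by
    intro j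
    have h1 := Finset.add_sum_erase Finset.univ m (Finset.mem_univ j)
    have h2 := Finset.add_sum_erase Finset.univ m (Finset.mem_univ j₀)
    funext k
    have h1 := congrFun (h1.trans h2.symm) k
    have h3 := hd j k
    have h4 := hd j₀ k
    simp only [Pi.add_apply] at h1 ⊢
    omega
  have hval : ∀ v, OnSet X v → (∀ j, eval v (G j) ≠ 0) →
      (fun j => eval v ((F j * ∏ l ∈ Finset.univ.erase j, G l) * ∏ l, G l))
        = (eval v (∏ l, G l) * eval v (∏ l, G l)) • fun j => f j v := by
    intro v hv hne
    funext j
    have h1 := Finset.mul_prod_erase Finset.univ G (Finset.mem_univ j)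
    have h2 : eval v (G j) * eval v (∏ l ∈ Finset.univ.erase j, G l) = eval v (∏ l, G l) := by
      rw [← map_mul, h1]
    have h3 := hne j
    simp only [Pi.smul_apply, smul_eq_mul]
    rw [e j v hv h3, map_mul, map_mul]
    nth_rewrite 2 [← h2]
    field_simp
  refine ⟨n j₀ + ∑ l ∈ Finset.univ.erase j₀, m l + M,
    fun j => (F j * ∏ l ∈ Finset.univ.erase j, G l) * ∏ l, G l, fun j => ?_, ⟨v₀, hv₀, ?_⟩, ?_⟩
  · have := (hFj j).mul hH
    rwa [hdeg j] at this
  · rw [hval v₀ ⟨z₀, z₀.2, hv₀⟩ h0, map_prod]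
    have hp := Finset.prod_ne_zero_iff.2 fun j (_ : j ∈ Finset.univ) => h0 j
    exact smul_ne_zero (mul_ne_zero hp hp) (hφ z₀ v₀ hv₀).1
  · intro z v hv hne
    have hne' : ∀ j, eval v (G j) ≠ 0 := by
      intro j hj
      refine hne (funext fun l => ?_)
      rw [map_mul, map_prod (eval v) G, Finset.prod_eq_zero (Finset.mem_univ j) hj, mul_zero]
      rfl
    rw [hval v ⟨z, z.2, hv⟩ hne', map_prod]
    have hp := Finset.prod_ne_zero_iff.2 fun j (_ : j ∈ Finset.univ) => hne' j
    exact (hφ z v hv).smul (mul_ne_zero hp hp)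

end

section

/-! ### Cox coordinates on the blow-up -/

/-- Cox coordinates of a point of the blow-up: homogeneous coordinates `x`, `y` of its image in
`P¹ × P¹` and, for each of the eight points, the values of the equation `e i` of the exceptional
curve and of the equations `s i`, `t i` of the strict transforms of the two lines through the
point. -/
@[ext]
structure Cox where
  /-- homogeneous coordinates of the first factor -/
  x : Fin 2 → ℂ
  /-- homogeneous coordinates of the second factor -/
  y : Fin 2 → ℂ
  /-- the equations of the exceptional curves -/
  e : Fin 8 → ℂ
  /-- the equations of the strict transforms of the lines on which `x` is constant -/
  s : Fin 8 → ℂ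
  /-- the equations of the strict transforms of the lines on which `y` is constant -/
  t : Fin 8 → ℂ

/-- `c` is a system of Cox coordinates of a point of the blow-up at the points `P`. -/
structure Cox.IsOn (P : Fin 8 → Fin 2 → Fin 2 → ℂ) (c : Cox) : Prop where
  x_ne : c.x ≠ 0
  y_ne : c.y ≠ 0
  st_ne : ∀ i, c.s i ≠ 0 ∨ c.t i ≠ 0
  es : ∀ i, c.e i * c.s i = lin (P i 0) c.x
  et : ∀ i, c.e i * c.t i = lin (P i 1) c.y

/-- The multihomogeneous coordinates of the point with given Cox coordinates. -/
def Cox.build (c : Cox) : Var → ℂ :=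
  Sum.elim (fun k => ![c.x, c.y] k.1 k.2)
    (fun k => Sum.elim (c.s k.1 • c.y) (c.t k.1 • c.x) k.2)

@[simp] theorem Cox.build_base_zero (c : Cox) : baseCoords c.build 0 = c.x := rfl

@[simp] theorem Cox.build_base_one (c : Cox) : baseCoords c.build 1 = c.y := rfl

/-- The values of the equations `s i`, read off from `[s y₀ : s y₁ : t x₀ : t x₁]` by division by
a nonzero coordinate of `y`. -/
def stdS (v : Var → ℂ) (i : Fin 8) : ℂ :=
  quot (v (.inr (i, .inl 0))) (v (.inl (1, 0))) (v (.inr (i, .inl 1))) (v (.inl (1, 1)))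

/-- The values of the equations `t i`, read off from `[s y₀ : s y₁ : t x₀ : t x₁]` by division by
a nonzero coordinate of `x`. -/
def stdT (v : Var → ℂ) (i : Fin 8) : ℂ :=
  quot (v (.inr (i, .inr 0))) (v (.inl (0, 0))) (v (.inr (i, .inr 1))) (v (.inl (0, 1)))

/-- The Cox coordinates of the point of the blow-up at `P` with multihomogeneous coordinates
`v`. The equation of the exceptional curve is the common value of the two fractions `lin / s` and
`lin / t`. -/
def std (P : Fin 8 → Fin 2 → Fin 2 → ℂ) (v : Var → ℂ) : Cox where
  x := baseCoords v 0
  y := baseCoords v 1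
  e i := quot (lin (P i 0) (baseCoords v 0)) (stdS v i) (lin (P i 1) (baseCoords v 1)) (stdT v i)
  s := stdS v
  t := stdT v

theorem ne_zero_or {x : Fin 2 → ℂ} (h : x ≠ 0) : x 0 ≠ 0 ∨ x 1 ≠ 0 := by
  by_contra! h'
  exact h (by ext i; fin_cases i <;> simp [h'])

theorem lin_smul (p x : Fin 2 → ℂ) (c : ℂ) : lin p (c • x) = c * lin p x := by
  simp [lin]; ring

variable {P : Fin 8 → Fin 2 → Fin 2 → ℂ} {v : Var → ℂ} {c : Cox}

/-- Whether a point lies on the blow-up can be seen on any of its coordinate vectors. -/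
theorem exists_of_onSet (h : OnSet (blowUp P) v) :
    baseCoords v 0 ≠ 0 ∧ baseCoords v 1 ≠ 0 ∧ ∀ i, ∃ s t : ℂ, (s ≠ 0 ∨ t ≠ 0) ∧
      excCoords v i = Sum.elim (s • baseCoords v 1) (t • baseCoords v 0) ∧
      s * lin (P i 1) (baseCoords v 1) = t * lin (P i 0) (baseCoords v 0) := by
  obtain ⟨z, ⟨w, hw, h⟩, hv⟩ := h
  refine ⟨(hv.1 0).1, (hv.1 1).1, fun i => ?_⟩
  obtain ⟨r, hr, e⟩ := hw.exists_scaling hv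
  obtain ⟨s, t, h1, h2⟩ := h i
  have b0 : baseCoords v 0 = r (.inl 0) • baseCoords w 0 := by rw [e]; rfl
  have b1 : baseCoords v 1 = r (.inl 1) • baseCoords w 1 := by rw [e]; rfl
  have bi : excCoords v i = r (.inr i) • excCoords w i := by rw [e]; rfl
  have r0 := hr (.inl 0)
  have r1 := hr (.inl 1)
  have e1 : excCoords v i = Sum.elim ((r (.inr i) * s / r (.inl 1)) • baseCoords v 1)
      ((r (.inr i) * t / r (.inl 0)) • baseCoords v 0) := by
    rw [bi, h1, b0, b1, smul_smul, smul_smul, div_mul_cancel₀ _ r0, div_mul_cancel₀ _ r1]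
    ext (j | j) <;> simp [mul_assoc]
  refine ⟨r (.inr i) * s / r (.inl 1), r (.inr i) * t / r (.inl 0), ?_, e1, ?_⟩
  · by_contra! h0
    rw [h0.1, h0.2, zero_smul, zero_smul] at e1
    refine (hv.2 i).1 ?_
    rw [e1]
    ext (j | j) <;> rfl
  · rw [b0, b1, lin_smul, lin_smul, ← mul_assoc, ← mul_assoc, div_mul_cancel₀ _ r0,
      div_mul_cancel₀ _ r1, mul_assoc, h2, mul_assoc]

theorem stdS_eq {i : Fin 8} {s t : ℂ} (h1 : baseCoords v 1 ≠ 0)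
    (h : excCoords v i = Sum.elim (s • baseCoords v 1) (t • baseCoords v 0)) :
    stdS v i = s :=
  quot_eq (ne_zero_or h1) (congrFun h (.inl 0)).symm (congrFun h (.inl 1)).symm

theorem stdT_eq {i : Fin 8} {s t : ℂ} (h0 : baseCoords v 0 ≠ 0)
    (h : excCoords v i = Sum.elim (s • baseCoords v 1) (t • baseCoords v 0)) :
    stdT v i = t :=
  quot_eq (ne_zero_or h0) (congrFun h (.inr 0)).symm (congrFun h (.inr 1)).symm

theorem std_compat (h : OnSet (blowUp P) v) (i : Fin 8) :
    (stdS v i ≠ 0 ∨ stdT v i ≠ 0) ∧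
      excCoords v i = Sum.elim (stdS v i • baseCoords v 1) (stdT v i • baseCoords v 0) ∧
      lin (P i 0) (baseCoords v 0) * stdT v i = lin (P i 1) (baseCoords v 1) * stdS v i := by
  obtain ⟨h0, h1, h⟩ := exists_of_onSet h
  obtain ⟨s, t, hst, he, hl⟩ := h i
  rw [stdS_eq h1 he, stdT_eq h0 he]
  exact ⟨hst, he, by rw [mul_comm, ← hl, mul_comm]⟩

theorem std_isOn (h : OnSet (blowUp P) v) : (std P v).IsOn P where
  x_ne := (exists_of_onSet h).1
  y_ne := (exists_of_onSet h).2.1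
  st_ne i := (std_compat h i).1
  es i := quot_mul_left (std_compat h i).1 (std_compat h i).2.2
  et i := quot_mul_right (std_compat h i).1 (std_compat h i).2.2

theorem build_std (h : OnSet (blowUp P) v) : (std P v).build = v := by
  funext k
  rcases k with ⟨b, j⟩ | ⟨i, j⟩
  · fin_cases b <;> rfl
  · exact (congrFun (std_compat h i).2.1 j).symm

theorem std_build (h : c.IsOn P) : std P c.build = c := by
  have hs : ∀ i, stdS c.build i = c.s i := fun i => stdS_eq h.y_ne rfl
  have ht : ∀ i, stdT c.build i = c.t i := fun i => stdT_eq h.x_ne rfl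
  refine Cox.ext rfl rfl (funext fun i => ?_) (funext hs) (funext ht)
  simp only [std, hs, ht]
  exact quot_eq (h.st_ne i) (h.es i) (h.et i)

theorem Cox.IsOn.exists_represents (h : c.IsOn P) : ∃ z ∈ blowUp P, Represents c.build z := by
  have hx : ∀ b, baseCoords c.build b ≠ 0 := by
    intro b
    fin_cases b
    · exact h.x_ne
    · exact h.y_ne
  have he : ∀ i, excCoords c.build i ≠ 0 := by
    intro i hi
    rcases h.st_ne i with h1 | h1
    · refine smul_ne_zero h1 h.y_ne (funext fun j => congrFun hi (.inl j))
    · refine smul_ne_zero h1 h.x_ne (funext fun j => congrFun hi (.inr j))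
  have hr : Represents c.build
      (fun b => Projectivization.mk ℂ _ (hx b), fun i => Projectivization.mk ℂ _ (he i)) :=
    ⟨fun b => ⟨hx b, rfl⟩, fun i => ⟨he i, rfl⟩⟩
  refine ⟨_, ⟨c.build, hr, fun i => ⟨c.s i, c.t i, rfl, ?_⟩⟩, hr⟩
  rw [build_base_zero, build_base_one, ← h.es, ← h.et]
  ring

/-! ### Systems of Cox coordinates that depend on a point -/

variable {X : Set Ambient}

/-- The components of `c` are sections over `X` of line bundles; if `c` describes a morphism from
`X` to a blow-up, the classes `Dx`, `Dy`, `De i` are the pullbacks of `H_x`, `H_y`, `E_i`. -/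
structure CoxSec (X : Set Ambient) (Dx Dy : Pic) (De : Fin 8 → Pic) (c : (Var → ℂ) → Cox) :
    Prop where
  x : ∀ j, Sec X Dx (fun v => (c v).x j)
  y : ∀ j, Sec X Dy (fun v => (c v).y j)
  e : ∀ i, Sec X (De i) (fun v => (c v).e i)
  s : ∀ i, Sec X (Dx - De i) (fun v => (c v).s i)
  t : ∀ i, Sec X (Dy - De i) (fun v => (c v).t i)

theorem Sec.cast {D D' : Pic} {s : (Var → ℂ) → ℂ} (h : Sec X D s) (e : D = D') : Sec X D' s :=
  e ▸ h

theorem Sec.lin {D : Pic} {s : (Var → ℂ) → Fin 2 → ℂ} (h : ∀ j, Sec X D (fun v => s v j))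
    (p : Fin 2 → ℂ) : Sec X D (fun v => lin p (s v)) := by
  have := ((h 0).const_mul (p 1)).sub ((h 1).const_mul (p 0))
  convert this using 2 with v
  simp only [CaseIIOne.lin]
  ring

/-- The tautological Cox coordinates on the blow-up itself. -/
theorem std_coxSec (P : Fin 8 → Fin 2 → Fin 2 → ℂ) :
    CoxSec (blowUp P) Hx Hy E (std P) := by
  have hx : ∀ j, Sec (blowUp P) Hx (fun v => v (.inl (0, j))) :=
    fun j => sec_coord _ (by decide +revert)
  have hy : ∀ j, Sec (blowUp P) Hy (fun v => v (.inl (1, j))) :=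
    fun j => sec_coord _ (by decide +revert)
  have hE : ∀ (i : Fin 8) (k : Block), multidegree (Hx + Hy - E i) k =
      Pi.single (M := fun _ => ℤ) (.inr i) 1 k := by decide
  have he : ∀ i j, Sec (blowUp P) (Hx + Hy - E i) (fun v => v (.inr (i, j))) :=
    fun i j => sec_coord _ (hE i)
  have hs : ∀ i, Sec (blowUp P) (Hx - E i) (fun v => stdS v i) := fun i =>
    Sec.quot ((he i _).cast (by abel)) (hy 0) ((he i _).cast (by abel)) (hy 1) fun v hv => by
      refine ⟨ne_zero_or (exists_of_onSet hv).2.1, ?_⟩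
      have h := (std_compat hv i).2.1
      have h0 : v (.inr (i, .inl 0)) = stdS v i * v (.inl (1, 0)) := congrFun h (.inl 0)
      have h1 : v (.inr (i, .inl 1)) = stdS v i * v (.inl (1, 1)) := congrFun h (.inl 1)
      rw [h0, h1]; ring
  have ht : ∀ i, Sec (blowUp P) (Hy - E i) (fun v => stdT v i) := fun i =>
    Sec.quot ((he i _).cast (by abel)) (hx 0) ((he i _).cast (by abel)) (hx 1) fun v hv => by
      refine ⟨ne_zero_or (exists_of_onSet hv).1, ?_⟩
      have h := (std_compat hv i).2.1
      have h0 : v (.inr (i, .inr 0)) = stdT v i * v (.inl (0, 0)) := congrFun h (.inr 0)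
      have h1 : v (.inr (i, .inr 1)) = stdT v i * v (.inl (0, 1)) := congrFun h (.inr 1)
      rw [h0, h1]; ring
  refine ⟨hx, hy, fun i => ?_, hs, ht⟩
  exact Sec.quot ((Sec.lin hx _).cast (by abel)) (hs i) ((Sec.lin hy _).cast (by abel)) (ht i)
    fun v hv => ⟨(std_compat hv i).1, (std_compat hv i).2.2⟩

/-- Cox coordinates whose components are sections over `X` define a morphism from `X` to the
blow-up. -/
theorem CoxSec.exists_map {Dx Dy : Pic} {De : Fin 8 → Pic} {c : (Var → ℂ) → Cox}
    (hc : CoxSec X Dx Dy De c) (h : ∀ v, OnSet X v → (c v).IsOn P) :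
    ∃ f : X → blowUp P,
      (∀ (z : X) (v : Var → ℂ), Represents v z → Represents (c v).build (f z)) ∧
      IsRegularMap f ∧ PullsBackTo (fun z => (f z).1.1 0) Dx ∧
      PullsBackTo (fun z => (f z).1.1 1) Dy ∧
      ∀ i, PullsBackTo (fun z => (f z).1.2 i) (Dx + Dy - De i) := by
  have sx : ∀ j, Sec X Dx (fun v => baseCoords (c v).build 0 j) := hc.x
  have sy : ∀ j, Sec X Dy (fun v => baseCoords (c v).build 1 j) := hc.y
  have se : ∀ i j, Sec X (Dx + Dy - De i) (fun v => excCoords (c v).build i j) := by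
    rintro i (j | j)
    · exact ((hc.s i).mul (hc.y j)).cast (by abel)
    · exact ((hc.t i).mul (hc.x j)).cast (by abel)
  have hn : ∀ v, OnSet X v → (∀ b, baseCoords (c v).build b ≠ 0) ∧
      ∀ i, excCoords (c v).build i ≠ 0 := by
    intro v hv
    obtain ⟨z, -, hz⟩ := (h v hv).exists_represents
    exact ⟨fun b => (hz.1 b).1, fun i => (hz.2 i).1⟩
  obtain ⟨fx, hfx⟩ := exists_map_of_sec sx fun v hv => (hn v hv).1 0
  obtain ⟨fy, hfy⟩ := exists_map_of_sec sy fun v hv => (hn v hv).1 1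
  choose fe hfe using fun i => exists_map_of_sec (se i) fun v hv => (hn v hv).2 i
  have hrep : ∀ (z : X) (v : Var → ℂ), Represents v z →
      Represents (c v).build (![fx z, fy z], fun i => fe i z) := by
    intro z v hv
    refine ⟨fun b => ?_, fun i => hfe i z v hv⟩
    fin_cases b
    · exact hfx z v hv
    · exact hfy z v hv
  have hmem : ∀ z : X, ((![fx z, fy z], fun i => fe i z) : Ambient) ∈ blowUp P := by
    intro z
    obtain ⟨v, hv⟩ := CaseIIOne.exists_represents z.1
    obtain ⟨w, hw, hw'⟩ := (h v ⟨z, z.2, hv⟩).exists_represents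
    rwa [← hw'.eq (hrep z v hv)]
  refine ⟨fun z => ⟨_, hmem z⟩, hrep, ⟨fun b => ?_, fun i => ?_⟩, ?_, ?_, fun i => ?_⟩
  · fin_cases b
    · exact isRegular_of_sec sx hfx
    · exact isRegular_of_sec sy hfy
  · exact isRegular_of_sec (se i) (hfe i)
  · exact ⟨_, fun j => (sx j).isSection, hfx⟩
  · exact ⟨_, fun j => (sy j).isSection, hfy⟩
  · exact ⟨_, fun j => (se i j).isSection, hfe i⟩

end

/-! ### The exchange of the two factors -/

/-- The parameters of the surface obtained by exchanging `x` and `y`. -/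
def swapParam (a : Fin 8 → ℂ) : Fin 8 → ℂ := fun i => a (i + 4)

/-- The exchange of `x` and `y` in Cox coordinates. -/
def Cox.swap (c : Cox) : Cox :=
  ⟨c.y, c.x, fun i => c.e (i + 4), fun i => c.t (i + 4), fun i => c.s (i + 4)⟩

theorem add_four_add_four (i : Fin 8) : i + 4 + 4 = i := by decide +revert

theorem swapParam_swapParam (a : Fin 8 → ℂ) : swapParam (swapParam a) = a :=
  funext fun i => congrArg a (add_four_add_four i)

theorem Cox.swap_swap (c : Cox) : c.swap.swap = c := by
  ext i <;> simp [swap, add_four_add_four]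

theorem points_swapParam (a : Fin 8 → ℂ) (i : Fin 8) :
    points (swapParam a) i 0 = points a (i + 4) 1 ∧
      points (swapParam a) i 1 = points a (i + 4) 0 := by
  fin_cases i <;> exact ⟨rfl, rfl⟩

theorem Cox.IsOn.swap {a : Fin 8 → ℂ} {c : Cox} (h : c.IsOn (points a)) :
    c.swap.IsOn (points (swapParam a)) where
  x_ne := h.y_ne
  y_ne := h.x_ne
  st_ne i := (h.st_ne (i + 4)).symm
  es i := by rw [(points_swapParam a i).1]; exact h.et (i + 4)
  et i := by rw [(points_swapParam a i).2]; exact h.es (i + 4)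

theorem CoxSec.swap {X : Set Ambient} {Dx Dy : Pic} {De : Fin 8 → Pic} {c : (Var → ℂ) → Cox}
    (h : CoxSec X Dx Dy De c) :
    CoxSec X Dy Dx (fun i => De (i + 4)) (fun v => (c v).swap) :=
  ⟨h.y, h.x, fun i => h.e (i + 4), fun i => h.t (i + 4), fun i => h.s (i + 4)⟩

/-! ### The elementary transformation along the fibres of the first projection -/

/-- The parameters of the target of the map
`(x, y) ↦ (x, κ y (x - a₇) (x - a₈) / ((x - a₅) (x - a₆)))`. -/
def rhoParam (κ : ℂ) (a : Fin 8 → ℂ) : Fin 8 → ℂ :=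
  ![κ * (a 6 * a 7) / (a 4 * a 5) * a 0, κ * (a 6 * a 7) / (a 4 * a 5) * a 1, κ * a 2, κ * a 3,
    a 6, a 7, a 4, a 5]

/-- Conditions on the parameters under which the map
`(x, y) ↦ (x, κ y (x - a₇) (x - a₈) / ((x - a₅) (x - a₆)))` lifts to an isomorphism: the last four
points lie on four different lines `x = const`, and all parameters are nonzero. -/
structure Generic (a : Fin 8 → ℂ) : Prop where
  ne_zero : ∀ i, a i ≠ 0
  h45 : a 4 ≠ a 5
  h67 : a 6 ≠ a 7
  h46 : a 4 ≠ a 6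
  h47 : a 4 ≠ a 7
  h56 : a 5 ≠ a 6
  h57 : a 5 ≠ a 7

/-- The value of the equation of the strict transform of the line `y = 0`, which is
`y 0 / (e 4 * e 5) = t 4 / e 5 = t 5 / e 4`; the two exceptional curves are disjoint. -/
def Cox.yZero (c : Cox) : ℂ := quot (c.t 4) (c.e 5) (c.t 5) (c.e 4)

/-- The value of the equation of the strict transform of the line `y = ∞`, with the sign for which
`y 1` is its product with `e 6` and `e 7`. -/
def Cox.yInf (c : Cox) : ℂ := quot (-c.t 6) (c.e 7) (-c.t 7) (c.e 6)

/-- The second pair of coordinates of the image under the elementary transformation, after the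
equations of the last four exceptional curves have been divided out. -/
def Cox.rhoY (κ : ℂ) (c : Cox) : Fin 2 → ℂ :=
  ![κ * c.yZero * c.s 6 * c.s 7, c.yInf * c.s 4 * c.s 5]

/-- A linear form that does not vanish on the line `x = 0` for `i < 2`, resp. `x = ∞` for
`2 ≤ i < 4`. -/
def ell (i : Fin 8) (x : Fin 2 → ℂ) : ℂ := if i < 2 then x 1 else x 0

/-- The coefficient of `ell i x ^ 2` in `(x - m) (x - n)`. -/
def lead (i : Fin 8) (m n : ℂ) : ℂ := if i < 2 then m * n else 1

/-- The cofactor of the equation of the line `x = const` through `P i` in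
`(x - m) (x - n) - lead i m n * ell i x ^ 2`. -/
def rest (i : Fin 8) (m n : ℂ) (x : Fin 2 → ℂ) : ℂ :=
  if i < 2 then x 0 - (m + n) * x 1 else (m + n) * x 0 - m * n * x 1

theorem quadratic_eq (a : Fin 8 → ℂ) {i : Fin 8} (hi : i < 4) (m n : ℂ) (x : Fin 2 → ℂ) :
    (x 0 - m * x 1) * (x 0 - n * x 1) =
      lead i m n * ell i x ^ 2 + lin (points a i 0) x * rest i m n x := by
  fin_cases i <;> simp [lead, ell, rest, lin, points] at hi ⊢ <;> ring

/-- For `i < 4` and `b = rhoParam κ a`, the product of the equation of the strict transform of the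
line `y = b i` of the target with the equations of the last four exceptional curves. -/
def Cox.rhoNum (κ : ℂ) (a : Fin 8 → ℂ) (c : Cox) (i : Fin 8) : ℂ :=
  κ * lead i (a 6) (a 7) * ell i c.x ^ 2 * c.t i + c.s i *
    (κ * c.y 0 * rest i (a 6) (a 7) c.x - rhoParam κ a i * c.y 1 * rest i (a 4) (a 5) c.x)

/-- For `i < 4` and `b = rhoParam κ a`, the equation of the strict transform of the line `y = b i`
of the target. The equation of the line can be divided by `e i`, and `rhoNum` by the product of the
last four `e j`; these two denominators have no common zero. -/
def Cox.rhoT (κ : ℂ) (a : Fin 8 → ℂ) (c : Cox) (i : Fin 8) : ℂ :=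
  quot (c.rhoY κ 0 - rhoParam κ a i * c.rhoY κ 1) (c.e i) (c.rhoNum κ a i)
    (c.e 4 * c.e 5 * c.e 6 * c.e 7)

/-- The map `(x, y) ↦ (x, κ y (x - a₇) (x - a₈) / ((x - a₅) (x - a₆)))` in Cox coordinates. It
exchanges the exceptional curves over the last four points with the strict transforms of the
lines `x = const` through these points. -/
def Cox.rho (κ : ℂ) (a : Fin 8 → ℂ) (c : Cox) : Cox where
  x := c.x
  y := c.rhoY κ
  e := ![c.e 0, c.e 1, c.e 2, c.e 3, c.s 6, c.s 7, c.s 4, c.s 5]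
  s := ![c.s 0, c.s 1, c.s 2, c.s 3, c.e 6, c.e 7, c.e 4, c.e 5]
  t := ![c.rhoT κ a 0, c.rhoT κ a 1, c.rhoT κ a 2, c.rhoT κ a 3, κ * c.yZero * c.s 7,
    κ * c.yZero * c.s 6, -(c.yInf * c.s 5), -(c.yInf * c.s 4)]

section

variable {κ : ℂ} {a : Fin 8 → ℂ} {c : Cox}

theorem Generic.rhoParam (ha : Generic a) (hκ : κ ≠ 0) : Generic (rhoParam κ a) := by
  have h := ha.ne_zero
  refine ⟨fun i => ?_, ha.h67, ha.h45, ha.h46.symm, ha.h56.symm, ha.h47.symm, ha.h57.symm⟩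
  fin_cases i <;> simp [CaseIIOne.rhoParam, h, hκ]

theorem rhoParam_rhoParam (ha : Generic a) (hκ : κ ≠ 0) :
    rhoParam κ⁻¹ (rhoParam κ a) = a := by
  have h := ha.ne_zero
  have h4 := h 4
  have h5 := h 5
  have h6 := h 6
  have h7 := h 7
  funext i
  fin_cases i <;> simp [CaseIIOne.rhoParam] <;> field_simp

/-- For `i < 4`, the point with `y = a i` of the line `x = 0` or `x = ∞` is mapped to the point with
`y = rhoParam κ a i`. -/
theorem rhoParam_mul_lead (ha : Generic a) {i : Fin 8} (hi : i < 4) :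
    rhoParam κ a i * lead i (a 4) (a 5) = κ * lead i (a 6) (a 7) * a i := by
  have h := ha.ne_zero
  have h4 := h 4
  have h5 := h 5
  fin_cases i <;> simp [CaseIIOne.rhoParam, lead] at hi ⊢ <;> first | done | field_simp

theorem eq_zero_of_two_roots {x : Fin 2 → ℂ} {m n : ℂ} (hmn : m ≠ n)
    (hm : x 0 - m * x 1 = 0) (hn : x 0 - n * x 1 = 0) : x = 0 := by
  have h1 : (m - n) * x 1 = 0 := by linear_combination hn - hm
  have h1 := (mul_eq_zero.1 h1).resolve_left (sub_ne_zero.2 hmn)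
  have h0 : x 0 = 0 := by rw [h1] at hm; simpa using hm
  ext i; fin_cases i <;> simp [h0, h1]

namespace Cox.IsOn

theorem es0 (h : c.IsOn (points a)) {i : Fin 8} (hi : i < 2) : c.e i * c.s i = c.x 0 := by
  have := h.es i
  fin_cases i <;> simp [points, lin] at this hi ⊢ <;> exact this

theorem es2 (h : c.IsOn (points a)) {i : Fin 8} (hi : 2 ≤ i) (hi' : i < 4) :
    c.e i * c.s i = -c.x 1 := by
  have := h.es i
  fin_cases i <;> simp [points, lin] at this hi hi' ⊢ <;> exact this

theorem es4 (h : c.IsOn (points a)) {i : Fin 8} (hi : 4 ≤ i) :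
    c.e i * c.s i = c.x 0 - a i * c.x 1 := by
  have := h.es i
  fin_cases i <;> simp [points, lin] at this hi ⊢ <;> rw [this] <;> ring

theorem et0 (h : c.IsOn (points a)) {i : Fin 8} (hi : i < 4) :
    c.e i * c.t i = c.y 0 - a i * c.y 1 := by
  have := h.et i
  fin_cases i <;> simp [points, lin] at this hi ⊢ <;> rw [this] <;> ring

theorem et4 (h : c.IsOn (points a)) : c.e 4 * c.t 4 = c.y 0 := by
  simpa [points, lin] using h.et 4

theorem et5 (h : c.IsOn (points a)) : c.e 5 * c.t 5 = c.y 0 := by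
  simpa [points, lin] using h.et 5

theorem et6 (h : c.IsOn (points a)) : c.e 6 * c.t 6 = -c.y 1 := by
  simpa [points, lin] using h.et 6

theorem et7 (h : c.IsOn (points a)) : c.e 7 * c.t 7 = -c.y 1 := by
  simpa [points, lin] using h.et 7

end Cox.IsOn
end

/-! ### The elementary transformation lifts to the blow-ups and is invertible -/

section
variable {κ : ℂ} {a : Fin 8 → ℂ} {c : Cox}

/-- `Cox.IsOn (points a)` written out for the eight points. -/
theorem isOn_of_eqs {x y : Fin 2 → ℂ} {e₀ e₁ e₂ e₃ e₄ e₅ e₆ e₇ s₀ s₁ s₂ s₃ s₄ s₅ s₆ s₇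
    t₀ t₁ t₂ t₃ t₄ t₅ t₆ t₇ : ℂ} (hx : x ≠ 0) (hy : y ≠ 0)
    (hst : (s₀ ≠ 0 ∨ t₀ ≠ 0) ∧ (s₁ ≠ 0 ∨ t₁ ≠ 0) ∧ (s₂ ≠ 0 ∨ t₂ ≠ 0) ∧ (s₃ ≠ 0 ∨ t₃ ≠ 0) ∧
      (s₄ ≠ 0 ∨ t₄ ≠ 0) ∧ (s₅ ≠ 0 ∨ t₅ ≠ 0) ∧ (s₆ ≠ 0 ∨ t₆ ≠ 0) ∧ (s₇ ≠ 0 ∨ t₇ ≠ 0))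
    (hs : e₀ * s₀ = x 0 ∧ e₁ * s₁ = x 0 ∧ e₂ * s₂ = -x 1 ∧ e₃ * s₃ = -x 1 ∧
      e₄ * s₄ = x 0 - a 4 * x 1 ∧ e₅ * s₅ = x 0 - a 5 * x 1 ∧ e₆ * s₆ = x 0 - a 6 * x 1 ∧
      e₇ * s₇ = x 0 - a 7 * x 1)
    (ht : e₀ * t₀ = y 0 - a 0 * y 1 ∧ e₁ * t₁ = y 0 - a 1 * y 1 ∧ e₂ * t₂ = y 0 - a 2 * y 1 ∧
      e₃ * t₃ = y 0 - a 3 * y 1 ∧ e₄ * t₄ = y 0 ∧ e₅ * t₅ = y 0 ∧ e₆ * t₆ = -y 1 ∧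
      e₇ * t₇ = -y 1) :
    Cox.IsOn (points a) ⟨x, y, ![e₀, e₁, e₂, e₃, e₄, e₅, e₆, e₇],
      ![s₀, s₁, s₂, s₃, s₄, s₅, s₆, s₇],
      ![t₀, t₁, t₂, t₃, t₄, t₅, t₆, t₇]⟩ := by
  obtain ⟨k0, k1, k2, k3, k4, k5, k6, k7⟩ := hst
  obtain ⟨h0, h1, h2, h3, h4, h5, h6, h7⟩ := hs
  obtain ⟨j0, j1, j2, j3, j4, j5, j6, j7⟩ := ht
  refine ⟨hx, hy, fun i => ?_, fun i => ?_, fun i => ?_⟩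
  · fin_cases i <;> simpa
  · fin_cases i <;> simpa [points, lin, mul_comm (x 1)]
  · fin_cases i <;> simpa [points, lin, mul_comm (y 1)]

namespace Cox.IsOn

/-- The exceptional curves over two of the last four points are disjoint if the points lie on
different lines `x = const`. -/
theorem e_ne_or (h : c.IsOn (points a)) {i j : Fin 8} (hi : 4 ≤ i) (hj : 4 ≤ j)
    (hij : a i ≠ a j) : c.e i ≠ 0 ∨ c.e j ≠ 0 := by
  by_contra! h0
  have h1 := h.es4 hi
  have h2 := h.es4 hj
  rw [h0.1, zero_mul] at h1
  rw [h0.2, zero_mul] at h2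
  exact h.x_ne (eq_zero_of_two_roots hij h1.symm h2.symm)

/-- Strict transforms of different lines `x = const` are disjoint. -/
theorem s_ne_or (h : c.IsOn (points a)) {i j : Fin 8} (hi : 4 ≤ i) (hj : 4 ≤ j)
    (hij : a i ≠ a j) : c.s i ≠ 0 ∨ c.s j ≠ 0 := by
  by_contra! h0
  have h1 := h.es4 hi
  have h2 := h.es4 hj
  rw [h0.1, mul_zero] at h1
  rw [h0.2, mul_zero] at h2
  exact h.x_ne (eq_zero_of_two_roots hij h1.symm h2.symm)

/-- The lines `x = 0` and `x = ∞` are disjoint from the lines `x = a j` with `4 ≤ j`. -/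
theorem es_ne_zero (h : c.IsOn (points a)) (ha : Generic a) {i j : Fin 8} (hi : i < 4)
    (h0 : c.e i = 0 ∨ c.s i = 0) (hj : 4 ≤ j) : c.e j ≠ 0 ∧ c.s j ≠ 0 := by
  rw [← mul_ne_zero_iff, h.es4 hj]
  intro h1
  have h2 : c.e i * c.s i = 0 := mul_eq_zero.2 h0
  apply h.x_ne
  by_cases hi2 : i < 2
  · rw [h.es0 hi2] at h2
    rw [h2, zero_sub, neg_eq_zero, mul_eq_zero] at h1
    have h3 := h1.resolve_left (ha.ne_zero j)
    ext k; fin_cases k <;> simp [h2, h3]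
  · rw [h.es2 (not_lt.1 hi2) hi, neg_eq_zero] at h2
    rw [h2, mul_zero, sub_zero] at h1
    ext k; fin_cases k <;> simp [h2, h1]

theorem ell_ne_zero (h : c.IsOn (points a)) {i : Fin 8} (hi : i < 4)
    (h0 : c.e i = 0 ∨ c.s i = 0) : ell i c.x ≠ 0 := by
  intro h1
  have h2 : c.e i * c.s i = 0 := mul_eq_zero.2 h0
  apply h.x_ne
  by_cases hi2 : i < 2
  · rw [h.es0 hi2] at h2
    rw [ell, if_pos hi2] at h1
    ext k; fin_cases k <;> simp [h2, h1]
  · rw [h.es2 (not_lt.1 hi2) hi, neg_eq_zero] at h2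
    rw [ell, if_neg hi2] at h1
    ext k; fin_cases k <;> simp [h2, h1]

theorem e_ne_or_prod (h : c.IsOn (points a)) (ha : Generic a) {i : Fin 8} (hi : i < 4) :
    c.e i ≠ 0 ∨ c.e 4 * c.e 5 * c.e 6 * c.e 7 ≠ 0 := by
  by_cases h0 : c.e i = 0
  · have := fun j hj => (h.es_ne_zero ha hi (.inl h0) (j := j) hj).1
    exact .inr (mul_ne_zero (mul_ne_zero (mul_ne_zero (this 4 (by decide)) (this 5 (by decide)))
      (this 6 (by decide))) (this 7 (by decide)))
  · exact .inl h0

theorem yZero_data (h : c.IsOn (points a)) (ha : Generic a) :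
    (c.e 5 ≠ 0 ∨ c.e 4 ≠ 0) ∧ c.t 4 * c.e 4 = c.t 5 * c.e 5 :=
  ⟨(h.e_ne_or (by decide) (by decide) ha.h45).symm, by
    rw [mul_comm, h.et4, mul_comm, h.et5]⟩

theorem yZero_mul_five (h : c.IsOn (points a)) (ha : Generic a) : c.yZero * c.e 5 = c.t 4 :=
  quot_mul_left (h.yZero_data ha).1 (h.yZero_data ha).2

theorem yZero_mul_four (h : c.IsOn (points a)) (ha : Generic a) : c.yZero * c.e 4 = c.t 5 :=
  quot_mul_right (h.yZero_data ha).1 (h.yZero_data ha).2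

theorem yZero_mul (h : c.IsOn (points a)) (ha : Generic a) :
    c.yZero * c.e 4 * c.e 5 = c.y 0 := by
  rw [h.yZero_mul_four ha, mul_comm, h.et5]

theorem yInf_data (h : c.IsOn (points a)) (ha : Generic a) :
    (c.e 7 ≠ 0 ∨ c.e 6 ≠ 0) ∧ -c.t 6 * c.e 6 = -c.t 7 * c.e 7 :=
  ⟨(h.e_ne_or (by decide) (by decide) ha.h67).symm, by
    have h6 := h.et6
    have h7 := h.et7
    linear_combination h7 - h6⟩

theorem yInf_mul_seven (h : c.IsOn (points a)) (ha : Generic a) : c.yInf * c.e 7 = -c.t 6 :=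
  quot_mul_left (h.yInf_data ha).1 (h.yInf_data ha).2

theorem yInf_mul_six (h : c.IsOn (points a)) (ha : Generic a) : c.yInf * c.e 6 = -c.t 7 :=
  quot_mul_right (h.yInf_data ha).1 (h.yInf_data ha).2

theorem yInf_mul (h : c.IsOn (points a)) (ha : Generic a) :
    c.yInf * c.e 6 * c.e 7 = c.y 1 := by
  rw [h.yInf_mul_six ha]
  linear_combination -h.et7

theorem rhoY_zero_mul (h : c.IsOn (points a)) (ha : Generic a) (κ : ℂ) :
    c.rhoY κ 0 * (c.e 4 * c.e 5 * c.e 6 * c.e 7) =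
      κ * c.y 0 * ((c.x 0 - a 6 * c.x 1) * (c.x 0 - a 7 * c.x 1)) := by
  rw [← h.es4 (i := 6) (by decide), ← h.es4 (i := 7) (by decide), ← h.yZero_mul ha]
  simp only [rhoY, Matrix.cons_val_zero]
  ring

theorem rhoY_one_mul (h : c.IsOn (points a)) (ha : Generic a) (κ : ℂ) :
    c.rhoY κ 1 * (c.e 4 * c.e 5 * c.e 6 * c.e 7) =
      c.y 1 * ((c.x 0 - a 4 * c.x 1) * (c.x 0 - a 5 * c.x 1)) := by
  rw [← h.es4 (i := 4) (by decide), ← h.es4 (i := 5) (by decide), ← h.yInf_mul ha]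
  simp only [rhoY, Matrix.cons_val_one, Matrix.cons_val_zero]
  ring

/-- The curve `κ y (x - a₇) (x - a₈) = b y' (x - a₅) (x - a₆)`, which is the preimage of the line
`y = b i` of the target, passes through the point `P i`. -/
theorem rhoT_compat (h : c.IsOn (points a)) (ha : Generic a) (κ : ℂ) {i : Fin 8} (hi : i < 4) :
    (c.rhoY κ 0 - rhoParam κ a i * c.rhoY κ 1) * (c.e 4 * c.e 5 * c.e 6 * c.e 7) =
      c.rhoNum κ a i * c.e i := by
  have h0 := h.rhoY_zero_mul ha κ
  have h1 := h.rhoY_one_mul ha κ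
  have hb := rhoParam_mul_lead (κ := κ) ha hi
  rw [quadratic_eq a hi, ← h.es i] at h0 h1
  rw [rhoNum]
  linear_combination h0 - rhoParam κ a i * h1 - κ * lead i (a 6) (a 7) * ell i c.x ^ 2 * h.et0 hi
    - c.y 1 * ell i c.x ^ 2 * hb

theorem e_mul_rhoT (h : c.IsOn (points a)) (ha : Generic a) (κ : ℂ) {i : Fin 8} (hi : i < 4) :
    c.e i * c.rhoT κ a i = c.rhoY κ 0 - rhoParam κ a i * c.rhoY κ 1 := by
  rw [mul_comm]
  exact quot_mul_left (h.e_ne_or_prod ha hi) (h.rhoT_compat ha κ hi)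

theorem rhoT_mul_prod (h : c.IsOn (points a)) (ha : Generic a) (κ : ℂ) {i : Fin 8} (hi : i < 4) :
    c.rhoT κ a i * (c.e 4 * c.e 5 * c.e 6 * c.e 7) = c.rhoNum κ a i :=
  quot_mul_right (h.e_ne_or_prod ha hi) (h.rhoT_compat ha κ hi)

/-- The strict transform of `y = 0` does not meet the line `y = ∞`. -/
theorem of_yZero_eq_zero (h : c.IsOn (points a)) (ha : Generic a) (h0 : c.yZero = 0) :
    c.yInf ≠ 0 ∧ c.e 6 ≠ 0 ∧ c.e 7 ≠ 0 ∧ c.s 4 ≠ 0 ∧ c.s 5 ≠ 0 := by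
  have hy := h.yZero_mul ha
  have h4 := h.yZero_mul_four ha
  have h5 := h.yZero_mul_five ha
  rw [h0] at hy h4 h5
  simp only [zero_mul] at hy h4 h5
  have hy1 : c.y 1 ≠ 0 := (ne_zero_or h.y_ne).resolve_left (not_not.2 hy.symm)
  rw [← h.yInf_mul ha, mul_ne_zero_iff, mul_ne_zero_iff] at hy1
  exact ⟨hy1.1.1, hy1.1.2, hy1.2, (h.st_ne 4).resolve_right (not_not.2 h5.symm),
    (h.st_ne 5).resolve_right (not_not.2 h4.symm)⟩

/-- The strict transform of `y = ∞` does not meet the line `y = 0`. -/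
theorem of_yInf_eq_zero (h : c.IsOn (points a)) (ha : Generic a) (h0 : c.yInf = 0) :
    c.yZero ≠ 0 ∧ c.e 4 ≠ 0 ∧ c.e 5 ≠ 0 ∧ c.s 6 ≠ 0 ∧ c.s 7 ≠ 0 := by
  have hy := h.yInf_mul ha
  have h4 := h.yInf_mul_six ha
  have h5 := h.yInf_mul_seven ha
  rw [h0] at hy h4 h5
  simp only [zero_mul] at hy h4 h5
  have hy1 : c.y 0 ≠ 0 := (ne_zero_or h.y_ne).resolve_right (not_not.2 hy.symm)
  rw [← h.yZero_mul ha, mul_ne_zero_iff, mul_ne_zero_iff] at hy1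
  exact ⟨hy1.1.1, hy1.1.2, hy1.2, (h.st_ne 6).resolve_right (not_not.2 (neg_eq_zero.1 h5.symm)),
    (h.st_ne 7).resolve_right (not_not.2 (neg_eq_zero.1 h4.symm))⟩

/-- The elementary transformation has no base points on the blow-up. -/
theorem rhoY_ne_zero (h : c.IsOn (points a)) (ha : Generic a) (hκ : κ ≠ 0) : c.rhoY κ ≠ 0 := by
  intro h0
  have h1 := congrFun h0 0
  have h2 := congrFun h0 1
  simp only [rhoY, Matrix.cons_val_zero, Matrix.cons_val_one, Pi.zero_apply, mul_eq_zero, hκ,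
    false_or] at h1 h2
  rcases h1 with (h1 | h1) | h1
  · have := h.of_yZero_eq_zero ha h1
    tauto
  · rcases h2 with (h2 | h2) | h2
    · have := h.of_yInf_eq_zero ha h2
      tauto
    · have := h.s_ne_or (i := 4) (j := 6) (by decide) (by decide) ha.h46
      tauto
    · have := h.s_ne_or (i := 5) (j := 6) (by decide) (by decide) ha.h56
      tauto
  · rcases h2 with (h2 | h2) | h2
    · have := h.of_yInf_eq_zero ha h2
      tauto
    · have := h.s_ne_or (i := 4) (j := 7) (by decide) (by decide) ha.h47
      tauto
    · have := h.s_ne_or (i := 5) (j := 7) (by decide) (by decide) ha.h57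
      tauto

/-- On the line `x = 0` or `x = ∞`, `rhoT κ a i` is `t i` up to a nonzero factor where `s i` is
zero. -/
theorem s_ne_or_rhoT (h : c.IsOn (points a)) (ha : Generic a) (hκ : κ ≠ 0) {i : Fin 8}
    (hi : i < 4) : c.s i ≠ 0 ∨ c.rhoT κ a i ≠ 0 := by
  by_contra! h0
  have h1 := h.rhoT_mul_prod ha κ hi
  rw [rhoNum, h0.1, h0.2, zero_mul, zero_mul, add_zero] at h1
  have h2 : lead i (a 6) (a 7) ≠ 0 := by
    unfold lead
    split_ifs
    exacts [mul_ne_zero (ha.ne_zero 6) (ha.ne_zero 7), one_ne_zero]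
  exact mul_ne_zero (mul_ne_zero (mul_ne_zero hκ h2)
    (pow_ne_zero 2 (h.ell_ne_zero hi (.inr h0.1))))
    ((h.st_ne i).resolve_left (not_not.2 h0.1)) h1.symm

/-- The exceptional curves over the points of `y = ∞` meet neither the strict transform of `y = 0`
nor the line `x = const` through the other point of `y = ∞`; likewise with
`y = 0` and `y = ∞` exchanged. -/
theorem e_ne_or_mul (h : c.IsOn (points a)) (ha : Generic a) :
    (c.e 6 ≠ 0 ∨ c.yZero * c.s 7 ≠ 0) ∧ (c.e 7 ≠ 0 ∨ c.yZero * c.s 6 ≠ 0) ∧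
    (c.e 4 ≠ 0 ∨ c.yInf * c.s 5 ≠ 0) ∧ (c.e 5 ≠ 0 ∨ c.yInf * c.s 4 ≠ 0) := by
  have key : ∀ i j : Fin 8, 4 ≤ i → 4 ≤ j → a i ≠ a j → c.e i = 0 → c.s j ≠ 0 := by
    intro i j hi hj hij hi0 hj0
    have h1 := h.es4 hi
    have h2 := h.es4 hj
    rw [hi0, zero_mul] at h1
    rw [hj0, mul_zero] at h2
    exact h.x_ne (eq_zero_of_two_roots hij h1.symm h2.symm)
  have hz := h.of_yZero_eq_zero ha
  have hi := h.of_yInf_eq_zero ha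
  have k1 := key 6 7 (by decide) (by decide) ha.h67
  have k2 := key 7 6 (by decide) (by decide) ha.h67.symm
  have k3 := key 4 5 (by decide) (by decide) ha.h45
  have k4 := key 5 4 (by decide) (by decide) ha.h45.symm
  simp only [mul_ne_zero_iff]
  tauto

/-- The elementary transformation maps points of the blow-up to points of the blow-up. -/
theorem rho (h : c.IsOn (points a)) (ha : Generic a) (hκ : κ ≠ 0) :
    (c.rho κ a).IsOn (points (rhoParam κ a)) := by
  have h0 := fun (i : Fin 8) (hi : i < 4) => h.s_ne_or_rhoT ha hκ hi
  have h1 := fun (i : Fin 8) (hi : i < 4) => h.e_mul_rhoT ha κ hi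
  have hn : ∀ p q : ℂ, p ≠ 0 ∨ q ≠ 0 → p ≠ 0 ∨ -q ≠ 0 := fun p q => Or.imp_right neg_ne_zero.2
  have hk : ∀ p q r : ℂ, p ≠ 0 ∨ q * r ≠ 0 → p ≠ 0 ∨ κ * q * r ≠ 0 := fun p q r =>
    Or.imp_right fun h => by rw [mul_assoc]; exact mul_ne_zero hκ h
  obtain ⟨k1, k2, k3, k4⟩ := h.e_ne_or_mul ha
  have hy0 : c.rhoY κ 0 = κ * c.yZero * c.s 6 * c.s 7 := rfl
  have hy1 : c.rhoY κ 1 = c.yInf * c.s 4 * c.s 5 := rfl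
  exact isOn_of_eqs h.x_ne (h.rhoY_ne_zero ha hκ)
    ⟨h0 0 (by decide), h0 1 (by decide), h0 2 (by decide), h0 3 (by decide),
      hk _ _ _ k1, hk _ _ _ k2, hn _ _ k3, hn _ _ k4⟩
    ⟨h.es0 (by decide), h.es0 (by decide), h.es2 (by decide) (by decide),
      h.es2 (by decide) (by decide), (mul_comm _ _).trans (h.es4 (by decide)),
      (mul_comm _ _).trans (h.es4 (by decide)), (mul_comm _ _).trans (h.es4 (by decide)),
      (mul_comm _ _).trans (h.es4 (by decide))⟩
    ⟨h1 0 (by decide), h1 1 (by decide), h1 2 (by decide), h1 3 (by decide),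
      by rw [hy0]; ring, by rw [hy0]; ring, by rw [hy1]; ring, by rw [hy1]; ring⟩

end Cox.IsOn

theorem Cox.yZero_rho (h : c.IsOn (points a)) (ha : Generic a) (hκ : κ ≠ 0) :
    (c.rho κ a).yZero = κ * c.yZero :=
  quot_eq ((h.rho ha hκ).yZero_data (ha.rhoParam hκ)).1 rfl rfl

theorem Cox.yInf_rho (h : c.IsOn (points a)) (ha : Generic a) (hκ : κ ≠ 0) :
    (c.rho κ a).yInf = c.yInf :=
  quot_eq ((h.rho ha hκ).yInf_data (ha.rhoParam hκ)).1 (neg_neg _).symm (neg_neg _).symm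

/-- The elementary transformation of the target inverts that of the source. -/
theorem Cox.rho_rho (h : c.IsOn (points a)) (ha : Generic a) (hκ : κ ≠ 0) :
    (c.rho κ a).rho κ⁻¹ (rhoParam κ a) = c := by
  have h' := h.rho ha hκ
  have ha' := ha.rhoParam hκ
  have hz := Cox.yZero_rho h ha hκ
  have hi := Cox.yInf_rho h ha hκ
  have hy0 : (c.rho κ a).rhoY κ⁻¹ 0 = c.y 0 := by
    have : (c.rho κ a).rhoY κ⁻¹ 0 = κ⁻¹ * (κ * c.yZero) * c.e 4 * c.e 5 := by
      rw [← hz]; rfl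
    rw [this, inv_mul_cancel_left₀ hκ, h.yZero_mul ha]
  have hy1 : (c.rho κ a).rhoY κ⁻¹ 1 = c.y 1 := by
    have : (c.rho κ a).rhoY κ⁻¹ 1 = c.yInf * c.e 6 * c.e 7 := by
      rw [← hi]; rfl
    rw [this, h.yInf_mul ha]
  have key : ∀ i : Fin 8, i < 4 → (c.rho κ a).e i = c.e i → (c.rho κ a).s i = c.s i →
      (c.rho κ a).t i = c.rhoT κ a i → (c.rho κ a).rhoT κ⁻¹ (rhoParam κ a) i = c.t i := by
    intro i hi he hs ht
    have hc := h'.rhoT_compat ha' κ⁻¹ hi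
    have hne := h'.e_ne_or_prod ha' hi
    rw [hy0, hy1, rhoParam_rhoParam ha hκ, ← h.et0 hi, he] at hc
    rw [rhoT, hy0, hy1, rhoParam_rhoParam ha hκ]
    refine quot_eq hne (by rw [← h.et0 hi, he, mul_comm]) ?_
    by_cases h0 : c.e i = 0
    · -- The exceptional curve over `P i`: compare both sides after multiplication by the
      -- product of the last four exceptional equations, which is not zero there.
      have hp := (h.e_ne_or_prod ha hi).resolve_left (not_not.2 h0)
      refine mul_right_cancel₀ hp ?_
      have hT := h.rhoT_mul_prod ha κ hi
      have hY0 := h.rhoY_zero_mul ha κ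
      have hY1 := h.rhoY_one_mul ha κ
      have hb := rhoParam_mul_lead (κ := κ) ha hi
      have hqN := quadratic_eq a hi (a 6) (a 7) c.x
      have hqD := quadratic_eq a hi (a 4) (a 5) c.x
      have hyy := h.et0 hi
      rw [← h.es i, h0, zero_mul, zero_mul, add_zero] at hqN hqD
      rw [h0, zero_mul] at hyy
      rw [hqN] at hY0
      rw [hqD] at hY1
      have e4 := h.es4 (i := 4) (by decide)
      have e5 := h.es4 (i := 5) (by decide)
      have e6 := h.es4 (i := 6) (by decide)
      have e7 := h.es4 (i := 7) (by decide)
      rw [← e6, ← e7] at hqN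
      rw [← e4, ← e5] at hqD
      rw [rhoNum] at hT
      rw [rhoNum, rhoParam_rhoParam ha hκ, hs, ht]
      have hE : (c.rho κ a).e 4 * (c.rho κ a).e 5 * (c.rho κ a).e 6 * (c.rho κ a).e 7 =
        c.s 6 * c.s 7 * c.s 4 * c.s 5 := rfl
      have hpar : rhoParam κ a 4 = a 6 ∧ rhoParam κ a 5 = a 7 ∧ rhoParam κ a 6 = a 4 ∧
        rhoParam κ a 7 = a 5 := ⟨rfl, rfl, rfl, rfl⟩
      have hx : (c.rho κ a).x = c.x := rfl
      have hy : (c.rho κ a).y = c.rhoY κ := rfl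
      rw [hE, hpar.1, hpar.2.1, hpar.2.2.1, hpar.2.2.2, hx, hy]
      have hu := inv_mul_cancel₀ hκ
      linear_combination c.t i * (c.e 6 * c.s 6 * (c.e 7 * c.s 7)) * hqD
        + c.t i * lead i (a 4) (a 5) * ell i c.x ^ 2 * hqN
        - κ⁻¹ * lead i (a 4) (a 5) * ell i c.x ^ 2 * hT
        - c.s i * κ⁻¹ * rest i (a 4) (a 5) c.x * hY0 + c.s i * a i * rest i (a 6) (a 7) c.x * hY1
        - (c.t i * lead i (a 6) (a 7) * lead i (a 4) (a 5) * ell i c.x ^ 4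
          + lead i (a 4) (a 5) * ell i c.x ^ 2 * c.s i * c.y 0 * rest i (a 6) (a 7) c.x
          + c.s i * c.y 0 * lead i (a 6) (a 7) * ell i c.x ^ 2 * rest i (a 4) (a 5) c.x
          - lead i (a 6) (a 7) * a i * ell i c.x ^ 2 * c.s i * c.y 1
            * rest i (a 4) (a 5) c.x) * hu
        + κ⁻¹ * ell i c.x ^ 2 * c.s i * c.y 1 * rest i (a 4) (a 5) c.x * hb
        + (lead i (a 4) (a 5) * ell i c.x ^ 2 * c.s i * rest i (a 6) (a 7) c.x
          + c.s i * lead i (a 6) (a 7) * ell i c.x ^ 2 * rest i (a 4) (a 5) c.x) * hyy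
    · rw [mul_comm] at hc
      exact mul_right_cancel₀ h0 (by rw [← hc]; ring)
  refine Cox.ext rfl ?_ ?_ ?_ ?_
  · funext j
    fin_cases j
    · exact hy0
    · exact hy1
  · funext i
    fin_cases i <;> rfl
  · funext i
    fin_cases i <;> rfl
  · have k0 := key 0 (by decide) rfl rfl rfl
    have k1 := key 1 (by decide) rfl rfl rfl
    have k2 := key 2 (by decide) rfl rfl rfl
    have k3 := key 3 (by decide) rfl rfl rfl
    have k4 : κ⁻¹ * (c.rho κ a).yZero * c.e 5 = c.t 4 := by
      rw [hz, inv_mul_cancel_left₀ hκ, h.yZero_mul_five ha]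
    have k5 : κ⁻¹ * (c.rho κ a).yZero * c.e 4 = c.t 5 := by
      rw [hz, inv_mul_cancel_left₀ hκ, h.yZero_mul_four ha]
    have k6 : -((c.rho κ a).yInf * c.e 7) = c.t 6 := by
      rw [hi, h.yInf_mul_seven ha, neg_neg]
    have k7 : -((c.rho κ a).yInf * c.e 6) = c.t 7 := by
      rw [hi, h.yInf_mul_six ha, neg_neg]
    funext i
    fin_cases i
    exacts [k0, k1, k2, k3, k4, k5, k6, k7]

end

section
variable {X : Set Ambient} {κ : ℂ} {a : Fin 8 → ℂ} {Dx Dy : Pic} {De : Fin 8 → Pic}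
  {c : (Var → ℂ) → Cox}

namespace CoxSec

theorem yZero (hc : CoxSec X Dx Dy De c) (ha : Generic a)
    (h : ∀ v, OnSet X v → (c v).IsOn (points a)) :
    Sec X (Dy - De 4 - De 5) (fun v => (c v).yZero) :=
  Sec.quot ((hc.t 4).cast (by abel)) (hc.e 5) ((hc.t 5).cast (by abel)) (hc.e 4)
    fun v hv => (h v hv).yZero_data ha

theorem yInf (hc : CoxSec X Dx Dy De c) (ha : Generic a)
    (h : ∀ v, OnSet X v → (c v).IsOn (points a)) :
    Sec X (Dy - De 6 - De 7) (fun v => (c v).yInf) :=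
  Sec.quot ((hc.t 6).neg.cast (by abel)) (hc.e 7) ((hc.t 7).neg.cast (by abel)) (hc.e 6)
    fun v hv => (h v hv).yInf_data ha

theorem ell (hc : CoxSec X Dx Dy De c) (i : Fin 8) :
    Sec X Dx (fun v => ell i (c v).x) := by
  unfold CaseIIOne.ell
  split_ifs
  exacts [hc.x 1, hc.x 0]

theorem rest (hc : CoxSec X Dx Dy De c) (i : Fin 8) (m n : ℂ) :
    Sec X Dx (fun v => rest i m n (c v).x) := by
  unfold CaseIIOne.rest
  split_ifs
  exacts [(hc.x 0).sub ((hc.x 1).const_mul _), ((hc.x 0).const_mul _).sub ((hc.x 1).const_mul _)]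

theorem rhoNum (hc : CoxSec X Dx Dy De c) (κ : ℂ) (a : Fin 8 → ℂ) (i : Fin 8) :
    Sec X (Dy + Dx + Dx - De i) (fun v => (c v).rhoNum κ a i) := by
  have hsq : Sec X (Dx + Dx) (fun v => CaseIIOne.ell i (c v).x ^ 2) := by
    simpa only [sq] using (hc.ell i).mul (hc.ell i)
  exact Sec.add (((hsq.const_mul (κ * lead i (a 6) (a 7))).mul (hc.t i)).cast (by abel))
    (((hc.s i).mul ((((hc.y 0).const_mul κ).mul (hc.rest i (a 6) (a 7))).sub
      (((hc.y 1).const_mul (rhoParam κ a i)).mul (hc.rest i (a 4) (a 5))))).cast (by abel))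

/-- The elementary transformation acts on classes by `H_x ↦ H_x`,
`H_y ↦ H_y + 2 H_x - E_5 - E_6 - E_7 - E_8` and `E_5, E_6, E_7, E_8 ↦ H_x - E_7, H_x - E_8,
H_x - E_5, H_x - E_6`. -/
theorem rho (hc : CoxSec X Dx Dy De c) (ha : Generic a)
    (h : ∀ v, OnSet X v → (c v).IsOn (points a)) :
    CoxSec X Dx (Dy + Dx + Dx - De 4 - De 5 - De 6 - De 7)
      ![De 0, De 1, De 2, De 3, Dx - De 6, Dx - De 7, Dx - De 4, Dx - De 5]
      (fun v => (c v).rho κ a) := by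
  have hz := hc.yZero ha h
  have hi := hc.yInf ha h
  have hy0 : Sec X (Dy + Dx + Dx - De 4 - De 5 - De 6 - De 7) (fun v => (c v).rhoY κ 0) :=
    (((hz.const_mul κ).mul (hc.s 6)).mul (hc.s 7)).cast (by abel)
  have hy1 : Sec X (Dy + Dx + Dx - De 4 - De 5 - De 6 - De 7) (fun v => (c v).rhoY κ 1) :=
    ((hi.mul (hc.s 4)).mul (hc.s 5)).cast (by abel)
  have ht : ∀ i : Fin 8, i < 4 → Sec X (Dy + Dx + Dx - De 4 - De 5 - De 6 - De 7 - De i)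
      (fun v => (c v).rhoT κ a i) := by
    intro i hi
    exact Sec.quot ((hy0.sub (hy1.const_mul (rhoParam κ a i))).cast (by abel)) (hc.e i)
      ((hc.rhoNum κ a i).cast (by abel))
      ((((hc.e 4).mul (hc.e 5)).mul (hc.e 6)).mul (hc.e 7))
      fun v hv => ⟨(h v hv).e_ne_or_prod ha hi, (h v hv).rhoT_compat ha κ hi⟩
  refine ⟨hc.x, fun j => ?_, fun i => ?_, fun i => ?_, fun i => ?_⟩
  · fin_cases j
    exacts [hy0, hy1]
  · fin_cases i
    exacts [hc.e 0, hc.e 1, hc.e 2, hc.e 3, hc.s 6, hc.s 7, hc.s 4, hc.s 5]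
  · have hs : ∀ i, Sec X (Dx - (Dx - De i)) (fun v => (c v).e i) :=
      fun i => (hc.e i).cast (by abel)
    fin_cases i
    exacts [hc.s 0, hc.s 1, hc.s 2, hc.s 3, hs 6, hs 7, hs 4, hs 5]
  · have t4 : Sec X (Dy + Dx + Dx - De 4 - De 5 - De 6 - De 7 - (Dx - De 6))
        (fun v => κ * (c v).yZero * (c v).s 7) :=
      ((hz.const_mul κ).mul (hc.s 7)).cast (by abel)
    have t5 : Sec X (Dy + Dx + Dx - De 4 - De 5 - De 6 - De 7 - (Dx - De 7))
        (fun v => κ * (c v).yZero * (c v).s 6) :=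
      ((hz.const_mul κ).mul (hc.s 6)).cast (by abel)
    have t6 : Sec X (Dy + Dx + Dx - De 4 - De 5 - De 6 - De 7 - (Dx - De 4))
        (fun v => -((c v).yInf * (c v).s 5)) :=
      (hi.mul (hc.s 5)).neg.cast (by abel)
    have t7 : Sec X (Dy + Dx + Dx - De 4 - De 5 - De 6 - De 7 - (Dx - De 5))
        (fun v => -((c v).yInf * (c v).s 4)) :=
      (hi.mul (hc.s 4)).neg.cast (by abel)
    fin_cases i
    exacts [ht 0 (by decide), ht 1 (by decide), ht 2 (by decide), ht 3 (by decide), t4, t5, t6, t7]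

end CoxSec
end

/-! ### The isomorphism of the surfaces -/

/-- The deautonomized mapping in Cox coordinates: it is the exchange of the factors, followed by
an elementary transformation. -/
def Cox.phi (a : Fin 8 → ℂ) (c : Cox) : Cox := c.swap.rho (-(a 0 * a 1)) (swapParam a)

/-- The inverse of the deautonomized mapping in Cox coordinates; `b` are the parameters of the
target. -/
def Cox.psi (a b : Fin 8 → ℂ) (c : Cox) : Cox := (c.rho (-(a 0 * a 1))⁻¹ b).swap

theorem nextParam_eq {a : Fin 8 → ℂ} (ha : IsParam a) :
    nextParam a = rhoParam (-(a 0 * a 1)) (swapParam a) := by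
  have h := ha.ne_zero
  have h0 := h 0
  have h1 := h 1
  have h2 := h 2
  have h3 := h 3
  have h4 := h 4
  have h5 := h 5
  have h6 := h 6
  have h7 := h 7
  have hl := ha.norm_left
  have hr := ha.norm_right
  funext i
  fin_cases i
  · simp [nextParam, rhoParam, swapParam, sqrtQ]
    field_simp
    linear_combination hl
  · simp [nextParam, rhoParam, swapParam, sqrtQ]
    field_simp
    linear_combination hl
  · simp [nextParam, rhoParam, swapParam, sqrtQ]
    field_simp
    linear_combination hr
  · simp [nextParam, rhoParam, swapParam, sqrtQ]
    field_simp
    linear_combination hr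
  all_goals simp [nextParam, rhoParam, swapParam]

theorem IsParam.generic_swapParam {a : Fin 8 → ℂ} (ha : IsParam a) (h02 : a 0 ≠ a 2)
    (h03 : a 0 ≠ a 3) (h12 : a 1 ≠ a 2) (h13 : a 1 ≠ a 3) : Generic (swapParam a) :=
  ⟨fun _ => ha.ne_zero _, ha.ne_one_two, ha.ne_three_four, h02, h03, h12, h13⟩

/-- The deautonomized mapping lifts to an isomorphism of the surfaces, which is given in Cox
coordinates by `Cox.phi`, and its push-forward is `phiPic`. -/
theorem exists_isomorphism {a b : Fin 8 → ℂ} (ha : IsParam a) (hb : b = nextParam a)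
    (h02 : a 0 ≠ a 2) (h03 : a 0 ≠ a 3) (h12 : a 1 ≠ a 2) (h13 : a 1 ≠ a 3) :
    ∃ Φ : surface a ≃ surface b, IsIsomorphism Φ ∧
      (∀ (z : surface a) (v : Var → ℂ), Represents v z →
        Represents ((std (points a) v).phi a).build (Φ z)) ∧
      IsPushforward Φ phiPic := by
  have hg := ha.generic_swapParam h02 h03 h12 h13
  have hκ : -(a 0 * a 1) ≠ 0 := neg_ne_zero.2 (mul_ne_zero (ha.ne_zero 0) (ha.ne_zero 1))
  rw [nextParam_eq ha] at hb
  set κ := -(a 0 * a 1) with hκa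
  have hgb : Generic b := hb ▸ hg.rhoParam hκ
  have hba : rhoParam κ⁻¹ b = swapParam a := by rw [hb, rhoParam_rhoParam hg hκ]
  have hab : rhoParam κ (swapParam a) = b := hb.symm
  have on1 : ∀ v, OnSet (surface a) v → ((std (points a) v).phi a).IsOn (points b) := by
    intro v hv
    rw [hb]
    exact (std_isOn hv).swap.rho hg hκ
  have on2' : ∀ v, OnSet (surface b) v →
      ((std (points b) v).rho κ⁻¹ b).IsOn (points (swapParam a)) := by
    intro v hv
    rw [← hba]
    exact (std_isOn hv).rho hgb (inv_ne_zero hκ)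
  have on2 : ∀ v, OnSet (surface b) v → ((std (points b) v).psi a b).IsOn (points a) := by
    intro v hv
    rw [← swapParam_swapParam a]
    exact (on2' v hv).swap
  have inv1 : ∀ v, OnSet (surface a) v →
      (std (points b) ((std (points a) v).phi a).build).psi a b = std (points a) v := by
    intro v hv
    rw [std_build (on1 v hv), Cox.psi, Cox.phi, ← hκa, ← hab,
      Cox.rho_rho (std_isOn hv).swap hg hκ, Cox.swap_swap]
  have inv2 : ∀ v, OnSet (surface b) v →
      (std (points a) ((std (points b) v).psi a b).build).phi a = std (points b) v := by
    intro v hv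
    have := Cox.rho_rho (std_isOn hv) hgb (inv_ne_zero hκ)
    rw [inv_inv, hba] at this
    rw [std_build (on2 v hv), Cox.psi, Cox.phi, ← hκa, Cox.swap_swap, this]
  have cs1 : CoxSec (surface a) _ _ _ (fun v => (std (points a) v).phi a) :=
    (std_coxSec (points a)).swap.rho hg fun v hv => (std_isOn hv).swap
  have cs2 : CoxSec (surface b) _ _ _ (fun v => (std (points b) v).psi a b) :=
    ((std_coxSec (points b)).rho hgb fun v hv => std_isOn hv).swap
  obtain ⟨f, hf, rf, -⟩ := cs1.exists_map on1
  obtain ⟨g, hg, rg, gx, gy, ge⟩ := cs2.exists_map on2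
  have gf : ∀ z, g (f z) = z := by
    intro z
    obtain ⟨v, hv⟩ := exists_represents z.1
    have h1 := hg _ _ (hf z v hv)
    rw [inv1 v ⟨z, z.2, hv⟩, build_std ⟨z, z.2, hv⟩] at h1
    exact Subtype.ext (h1.eq hv)
  have fg : ∀ z, f (g z) = z := by
    intro z
    obtain ⟨v, hv⟩ := exists_represents z.1
    have h1 := hf _ _ (hg z v hv)
    rw [inv2 v ⟨z, z.2, hv⟩, build_std ⟨z, z.2, hv⟩] at h1
    exact Subtype.ext (h1.eq hv)
  have hx : phiPic Hx = Hy + Hx + Hx - E 4 - E 5 - E 6 - E 7 := by decide +kernel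
  have hy : phiPic Hy = Hx := by decide +kernel
  have he : ∀ i : Fin 8, phiPic (Hx + Hy - E i) = Hy + Hx + Hx - E 4 - E 5 - E 6 - E 7 + Hx
      - ![E 0, E 1, E 2, E 3, Hx - E 6, Hx - E 7, Hx - E 4, Hx - E 5] (i + 4) := by
    decide +kernel
  refine ⟨⟨f, g, gf, fg⟩, ⟨rf, rg⟩, hf, ?_, ?_, fun i => ?_⟩
  · rw [hx]; exact gx
  · rw [hy]; exact gy
  · rw [he]; exact ge i

/-- On the affine part of the surface, the isomorphism is the deautonomized mapping. -/
theorem over_phi {a : Fin 8 → ℂ} (hg : Generic (swapParam a)) {z z' : Ambient} {v : Var → ℂ}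
    (hz : z ∈ surface a) (hv : Represents v z)
    (hv' : Represents ((std (points a) v).phi a).build z') {x y : ℂ} (h : Over z x y)
    (hne : (y - a 0) * (y - a 1) ≠ 0) : Over z' y (nextY a x y) := by
  have hon := (std_isOn ⟨z, hz, hv⟩).swap
  set c := std (points a) v with hc
  obtain ⟨r, hr, hx⟩ := h.1.exists_smul (hv.1 0)
  obtain ⟨u, hu, hy⟩ := h.2.exists_smul (hv.1 1)
  have hx0 : c.swap.y 0 = r * x := (congrFun hx 0).trans (by simp)
  have hx1 : c.swap.y 1 = r := (congrFun hx 1).trans (by simp)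
  have hy0 : c.swap.x 0 = u * y := (congrFun hy 0).trans (by simp)
  have hy1 : c.swap.x 1 = u := (congrFun hy 1).trans (by simp)
  have e0 := hon.rhoY_zero_mul hg (-(a 0 * a 1))
  have e1 := hon.rhoY_one_mul hg (-(a 0 * a 1))
  have p4 : swapParam a 4 = a 0 := rfl
  have p5 : swapParam a 5 = a 1 := rfl
  have p6 : swapParam a 6 = a 2 := rfl
  have p7 : swapParam a 7 = a 3 := rfl
  rw [hx0, hy0, hy1, p6, p7] at e0
  rw [hx1, hy0, hy1, p4, p5] at e1
  set p := c.swap.e 4 * c.swap.e 5 * c.swap.e 6 * c.swap.e 7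
  have hne' : r * ((u * y - a 0 * u) * (u * y - a 1 * u)) ≠ 0 := by
    have : r * ((u * y - a 0 * u) * (u * y - a 1 * u)) = r * u * u * ((y - a 0) * (y - a 1)) := by
      ring
    rw [this]
    exact mul_ne_zero (mul_ne_zero (mul_ne_zero hr hu) hu) hne
  rw [← e1] at hne'
  have hY := left_ne_zero_of_mul hne'
  have hP := right_ne_zero_of_mul hne'
  constructor
  · have h1 := hv'.1 0
    have : baseCoords (c.phi a).build 0 = u • ![y, 1] := hy
    rw [this] at h1
    exact h1.of_smul
  · have h1 := hv'.1 1
    have : baseCoords (c.phi a).build 1 =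
        (c.swap.rhoY (-(a 0 * a 1)) 1) • ![nextY a x y, 1] := by
      change c.swap.rhoY (-(a 0 * a 1)) = _
      funext j
      fin_cases j
      · simp only [Fin.zero_eta, Pi.smul_apply, Matrix.cons_val_zero, smul_eq_mul]
        refine mul_right_cancel₀ hP ?_
        have hn0 := left_ne_zero_of_mul hne
        have hn1 := right_ne_zero_of_mul hne
        rw [e0, mul_right_comm _ (nextY a x y) p, e1, nextY]
        field_simp
      · simp
    rw [this] at h1
    exact h1.of_smul

/-! ### The autonomous parameters -/

theorem autoParam_isParam {b : ℂ} (hb : b ≠ 0) (hb4 : b ^ 4 ≠ 1) : IsParam (autoParam b) := by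
  have h2 : b ^ 2 ≠ 1 := fun h => hb4 (by linear_combination (b ^ 2 + 1) * h)
  have hne : b ≠ 1 / b := fun h => h2 (by field_simp at h; exact h)
  have hne' : -b ≠ -1 / b := fun h => hne (by linear_combination -h)
  refine ⟨fun i => ?_, ?_, ?_, hne', hne, hne, hne'⟩
  · fin_cases i <;> simp [autoParam, hb]
  · simp [autoParam]; field_simp
  · simp [autoParam]; field_simp

theorem autoParam_ne {b : ℂ} (hb : b ≠ 0) (hb4 : b ^ 4 ≠ 1) :
    autoParam b 0 ≠ autoParam b 2 ∧ autoParam b 0 ≠ autoParam b 3 ∧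
      autoParam b 1 ≠ autoParam b 2 ∧ autoParam b 1 ≠ autoParam b 3 := by
  have h2 : b ^ 2 ≠ -1 := fun h => hb4 (by linear_combination (b ^ 2 - 1) * h)
  have h3 : (2 : ℂ) ≠ 0 := two_ne_zero
  refine ⟨fun h => ?_, fun h => ?_, fun h => ?_, fun h => ?_⟩ <;>
    simp only [autoParam, Matrix.cons_val] at h
  · exact mul_ne_zero h3 hb (by linear_combination -h)
  · field_simp at h
    exact h2 (by linear_combination -h)
  · field_simp at h
    exact h2 (by linear_combination -h)
  · field_simp at h
    exact h3 (by linear_combination -h)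

theorem swapParam_autoParam (b : ℂ) : swapParam (autoParam b) = autoParam (-b) := by
  funext i
  fin_cases i <;> simp [swapParam, autoParam, neg_div]

theorem autoParam_swap_generic {b : ℂ} (hb : b ≠ 0) (hb4 : b ^ 4 ≠ 1) :
    Generic (swapParam (autoParam b)) := by
  obtain ⟨h1, h2, h3, h4⟩ := autoParam_ne hb hb4
  exact (autoParam_isParam hb hb4).generic_swapParam h1 h2 h3 h4

theorem autoParam_generic {b : ℂ} (hb : b ≠ 0) (hb4 : b ^ 4 ≠ 1) : Generic (autoParam b) := by
  have := autoParam_swap_generic (neg_ne_zero.2 hb) (by rwa [Even.neg_pow (by decide)])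
  rwa [swapParam_autoParam, neg_neg] at this

theorem autoParam_kappa {b : ℂ} (hb : b ≠ 0) : -(autoParam b 0 * autoParam b 1) = -1 := by
  simp [autoParam]
  field_simp

theorem autoParam_mul {b : ℂ} (hb : b ≠ 0) : autoParam b 0 * autoParam b 1 = 1 := by
  rw [← neg_inj, autoParam_kappa hb]

theorem sub_autoParam_mul (b y : ℂ) :
    (y - autoParam b 0) * (y - autoParam b 1) = (y + b) * (y + 1 / b) := by
  simp only [autoParam, Matrix.cons_val]
  ring

theorem nextY_autoParam {b : ℂ} (hb : b ≠ 0) (x y : ℂ) : nextY (autoParam b) x y =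
    -x * ((y - b) * (y - 1 / b)) / ((y + b) * (y + 1 / b)) := by
  rw [nextY, autoParam_mul hb, sub_autoParam_mul]
  simp only [autoParam, Matrix.cons_val]
  ring

theorem qParam_autoParam {b : ℂ} (hb : b ≠ 0) : qParam (autoParam b) = 1 := by
  simp only [qParam, autoParam, Matrix.cons_val]
  field_simp

theorem nextParam_autoParam {b : ℂ} (hb : b ≠ 0) (hb4 : b ^ 4 ≠ 1) :
    nextParam (autoParam b) = autoParam b := by
  rw [nextParam_eq (autoParam_isParam hb hb4), autoParam_kappa hb]
  funext i
  fin_cases i <;> simp [swapParam, autoParam, rhoParam] <;> field_simp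

/-! ### The anticanonical pencil -/

/-- The form `(x² + 1) (y² + 1) + m (y - x) (x y + 1)` in homogeneous coordinates. -/
def pencilForm (m : ℂ) (x y : Fin 2 → ℂ) : ℂ :=
  (x 0 ^ 2 + x 1 ^ 2) * (y 0 ^ 2 + y 1 ^ 2) +
    m * (y 0 * x 1 - x 0 * y 1) * (x 0 * y 0 + x 1 * y 1)

/-- The quotient of `pencilForm` by the equations of the last four exceptional curves, on the
surface with parameters `autoParam b` for `m = b + 1 / b`. -/
def Cox.pencilQuot (m : ℂ) (c : Cox) : ℂ :=
  c.yZero * c.y 0 * (c.s 6 * c.s 7) + m * (c.yZero * c.yInf) * (c.x 1 ^ 2 - c.x 0 ^ 2) +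
    c.yInf * c.y 1 * (c.s 4 * c.s 5)

/-- The quotient of `pencilForm` by the equations of all exceptional curves. One may divide first
by those of the last four or, since `pencilForm` is symmetric up to the sign of `m`, by those of the
first four; the remaining denominators have no common zero. -/
def Cox.pencilZ (m : ℂ) (c : Cox) : ℂ :=
  quot (c.pencilQuot m) (c.e 0 * c.e 1 * c.e 2 * c.e 3) (c.swap.pencilQuot (-m))
    (c.e 4 * c.e 5 * c.e 6 * c.e 7)

/-- The quotient of the form `x y` by the equations of all exceptional curves, which is the
equation of the strict transform of the four lines `x = 0, ∞` and `y = 0, ∞`. -/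
def Cox.pencilW (c : Cox) : ℂ := c.yZero * c.yInf * (c.swap.yZero * c.swap.yInf)

section
variable {b : ℂ} {c : Cox}

theorem Cox.IsOn.pencilQuot_mul (hb : b ≠ 0) (hb4 : b ^ 4 ≠ 1)
    (h : c.IsOn (points (autoParam b))) :
    c.pencilQuot (b + 1 / b) * (c.e 4 * c.e 5 * c.e 6 * c.e 7) =
      pencilForm (b + 1 / b) c.x c.y := by
  have hg := autoParam_generic hb hb4
  have e4 := h.es4 (i := 4) (by decide)
  have e5 := h.es4 (i := 5) (by decide)
  have e6 := h.es4 (i := 6) (by decide)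
  have e7 := h.es4 (i := 7) (by decide)
  have hz := h.yZero_mul hg
  have hi := h.yInf_mul hg
  simp only [autoParam, Matrix.cons_val] at e4 e5 e6 e7
  have hbb : b * (1 / b) = 1 := by field_simp
  have hbn : -1 / b = -(1 / b) := by ring
  rw [hbn] at e7
  rw [pencilForm, Cox.pencilQuot]
  generalize 1 / b = d at *
  calc _ = (c.yZero * c.e 4 * c.e 5) * c.y 0 * ((c.e 6 * c.s 6) * (c.e 7 * c.s 7))
        + (b + d) * ((c.yZero * c.e 4 * c.e 5) * (c.yInf * c.e 6 * c.e 7)) *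
          (c.x 1 ^ 2 - c.x 0 ^ 2)
        + (c.yInf * c.e 6 * c.e 7) * c.y 1 * ((c.e 4 * c.s 4) * (c.e 5 * c.s 5)) := by ring
    _ = _ := by
      rw [hz, hi, e4, e5, e6, e7]
      linear_combination (c.y 0 ^ 2 + c.y 1 ^ 2) * c.x 1 ^ 2 * hbb

/-- The exchange of the factors changes the sign of `m`. -/
theorem pencilForm_swap (m : ℂ) (x y : Fin 2 → ℂ) : pencilForm (-m) y x = pencilForm m x y := by
  simp only [pencilForm]; ring

theorem Cox.IsOn.swap_pencilQuot_mul (hb : b ≠ 0) (hb4 : b ^ 4 ≠ 1)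
    (h : c.IsOn (points (autoParam b))) :
    c.swap.pencilQuot (-(b + 1 / b)) * (c.e 0 * c.e 1 * c.e 2 * c.e 3) =
      pencilForm (b + 1 / b) c.x c.y := by
  have h' := h.swap
  rw [swapParam_autoParam] at h'
  have := h'.pencilQuot_mul (neg_ne_zero.2 hb) (by rwa [Even.neg_pow (by decide)])
  have e : -b + 1 / -b = -(b + 1 / b) := by rw [div_neg]; ring
  rw [e] at this
  exact this.trans (pencilForm_swap _ _ _)

theorem Cox.IsOn.pencilZ_data (hb : b ≠ 0) (hb4 : b ^ 4 ≠ 1)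
    (h : c.IsOn (points (autoParam b))) :
    (c.e 0 * c.e 1 * c.e 2 * c.e 3 ≠ 0 ∨ c.e 4 * c.e 5 * c.e 6 * c.e 7 ≠ 0) ∧
    c.pencilQuot (b + 1 / b) * (c.e 4 * c.e 5 * c.e 6 * c.e 7) =
      c.swap.pencilQuot (-(b + 1 / b)) * (c.e 0 * c.e 1 * c.e 2 * c.e 3) := by
  refine ⟨?_, by rw [h.pencilQuot_mul hb hb4, h.swap_pencilQuot_mul hb hb4]⟩
  have hp := fun i hi => h.e_ne_or_prod (autoParam_generic hb hb4) (i := i) hi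
  have h0 := hp 0 (by decide)
  have h1 := hp 1 (by decide)
  have h2 := hp 2 (by decide)
  have h3 := hp 3 (by decide)
  simp only [mul_ne_zero_iff] at *
  tauto

theorem Cox.IsOn.pencilZ_mul_left (hb : b ≠ 0) (hb4 : b ^ 4 ≠ 1)
    (h : c.IsOn (points (autoParam b))) :
    c.pencilZ (b + 1 / b) * (c.e 0 * c.e 1 * c.e 2 * c.e 3) = c.pencilQuot (b + 1 / b) :=
  quot_mul_left (h.pencilZ_data hb hb4).1 (h.pencilZ_data hb hb4).2

theorem Cox.IsOn.pencilZ_mul_right (hb : b ≠ 0) (hb4 : b ^ 4 ≠ 1)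
    (h : c.IsOn (points (autoParam b))) :
    c.pencilZ (b + 1 / b) * (c.e 4 * c.e 5 * c.e 6 * c.e 7) =
      c.swap.pencilQuot (-(b + 1 / b)) :=
  quot_mul_right (h.pencilZ_data hb hb4).1 (h.pencilZ_data hb hb4).2

theorem Cox.IsOn.pencilZ_mul (hb : b ≠ 0) (hb4 : b ^ 4 ≠ 1)
    (h : c.IsOn (points (autoParam b))) :
    c.pencilZ (b + 1 / b) * (c.e 0 * c.e 1 * c.e 2 * c.e 3 * (c.e 4 * c.e 5 * c.e 6 * c.e 7)) =
      pencilForm (b + 1 / b) c.x c.y := by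
  rw [← mul_assoc, h.pencilZ_mul_left hb hb4, h.pencilQuot_mul hb hb4]

theorem Cox.IsOn.pencilW_mul (hb : b ≠ 0) (hb4 : b ^ 4 ≠ 1)
    (h : c.IsOn (points (autoParam b))) :
    c.pencilW * (c.e 0 * c.e 1 * c.e 2 * c.e 3 * (c.e 4 * c.e 5 * c.e 6 * c.e 7)) =
      c.x 0 * c.x 1 * c.y 0 * c.y 1 := by
  have hg := autoParam_generic hb hb4
  have hg' := autoParam_swap_generic hb hb4
  have z : c.swap.yZero * c.e 0 * c.e 1 = c.x 0 := h.swap.yZero_mul hg'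
  have i : c.swap.yInf * c.e 2 * c.e 3 = c.x 1 := h.swap.yInf_mul hg'
  rw [← z, ← i, ← h.yZero_mul hg, ← h.yInf_mul hg, Cox.pencilW]
  ring

/-- On the strict transforms of the lines `y = 0` and `y = ∞`, only one of the three terms of the
quotient is left, and it is a product of nonzero factors. -/
theorem Cox.IsOn.pencilQuot_ne_zero {a : Fin 8 → ℂ} (hg : Generic a) (h : c.IsOn (points a))
    (m : ℂ) (h0 : c.yZero * c.yInf = 0) : c.pencilQuot m ≠ 0 := by
  rw [Cox.pencilQuot, h0, mul_zero, zero_mul, add_zero]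
  rcases mul_eq_zero.1 h0 with h1 | h1
  · obtain ⟨k1, k2, k3, k4, k5⟩ := h.of_yZero_eq_zero hg h1
    have hi := h.yInf_mul hg
    rw [h1, zero_mul, zero_mul, zero_add, ← hi]
    simp [k1, k2, k3, k4, k5]
  · obtain ⟨k1, k2, k3, k4, k5⟩ := h.of_yInf_eq_zero hg h1
    have hi := h.yZero_mul hg
    rw [h1, zero_mul, zero_mul, add_zero, ← hi]
    simp [k1, k2, k3, k4, k5]

/-- The anticanonical pencil has no base points on the surface. -/
theorem Cox.IsOn.pencil_ne_zero (hb : b ≠ 0) (hb4 : b ^ 4 ≠ 1)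
    (h : c.IsOn (points (autoParam b))) : ![c.pencilZ (b + 1 / b), c.pencilW] ≠ 0 := by
  intro h0
  have hZ : c.pencilZ (b + 1 / b) = 0 := congrFun h0 0
  have hW : c.pencilW = 0 := congrFun h0 1
  have h1 := h.pencilZ_mul_left hb hb4
  have h2 := h.pencilZ_mul_right hb hb4
  rw [hZ, zero_mul] at h1 h2
  rcases mul_eq_zero.1 hW with h3 | h3
  · exact h.pencilQuot_ne_zero (autoParam_generic hb hb4) _ h3 h1.symm
  · exact h.swap.pencilQuot_ne_zero (autoParam_swap_generic hb hb4) _ h3 h2.symm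

/-- The mapping changes the sign of the form `x y`, relative to the exceptional curves. -/
theorem Cox.IsOn.pencilW_phi (hb : b ≠ 0) (hb4 : b ^ 4 ≠ 1)
    (h : c.IsOn (points (autoParam b))) :
    (c.phi (autoParam b)).pencilW = -c.pencilW := by
  have hg := autoParam_swap_generic hb hb4
  have hz := Cox.yZero_rho (κ := -1) h.swap hg (by simp)
  have hi := Cox.yInf_rho (κ := -1) h.swap hg (by simp)
  have hz' : (c.swap.rho (-1) (swapParam (autoParam b))).swap.yZero = c.yZero := rfl
  have hi' : (c.swap.rho (-1) (swapParam (autoParam b))).swap.yInf = c.yInf := rfl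
  rw [Cox.phi, autoParam_kappa hb, Cox.pencilW, hz, hi, hz', hi', Cox.pencilW]
  ring

/-- On the lines `x = 0` and `x = ∞`, the elementary transformation takes the quotient of
`pencilForm` by the first four exceptional equations to that of its target, up to the factor by
which it multiplies homogeneous coordinates. Off these lines this follows from the corresponding
fact for the other quotient; on them it has to be checked on the formula for the transformed lines
`y = const`. -/
theorem Cox.IsOn.pencilQuot_swap_rho (hb : b ≠ 0) (hb4 : b ^ 4 ≠ 1)
    (h : c.IsOn (points (autoParam b))) (h0 : c.x 0 * c.x 1 = 0) :
    (c.rho (-1) (autoParam b)).swap.pencilQuot (b + 1 / b) *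
      (c.e 4 * c.e 5 * c.e 6 * c.e 7) ^ 2 =
    c.swap.pencilQuot (-(b + 1 / b)) * (c.s 6 * c.s 7 * c.s 4 * c.s 5) *
      (c.e 4 * c.e 5 * c.e 6 * c.e 7) := by
  have hg := autoParam_generic hb hb4
  have hg' := autoParam_swap_generic hb hb4
  have e4 := h.es4 (i := 4) (by decide)
  have e5 := h.es4 (i := 5) (by decide)
  have e6 := h.es4 (i := 6) (by decide)
  have e7 := h.es4 (i := 7) (by decide)
  have T0 := h.rhoT_mul_prod hg (-1) (i := 0) (by decide)
  have T1 := h.rhoT_mul_prod hg (-1) (i := 1) (by decide)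
  have T2 := h.rhoT_mul_prod hg (-1) (i := 2) (by decide)
  have T3 := h.rhoT_mul_prod hg (-1) (i := 3) (by decide)
  have t0 := h.et0 (i := 0) (by decide)
  have t1 := h.et0 (i := 1) (by decide)
  have t2 := h.et0 (i := 2) (by decide)
  have t3 := h.et0 (i := 3) (by decide)
  have Y0 := h.rhoY_zero_mul hg (-1)
  have Y1 := h.rhoY_one_mul hg (-1)
  have s0 : c.swap.yZero * c.e 1 = c.s 0 := h.swap.yZero_mul_five hg'
  have s1 : c.swap.yZero * c.e 0 = c.s 1 := h.swap.yZero_mul_four hg'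
  have s2 : c.swap.yInf * c.e 3 = -c.s 2 := h.swap.yInf_mul_seven hg'
  have s3 : c.swap.yInf * c.e 2 = -c.s 3 := h.swap.yInf_mul_six hg'
  have x0 : c.swap.yZero * c.e 0 * c.e 1 = c.x 0 := h.swap.yZero_mul hg'
  have x1 : c.swap.yInf * c.e 2 * c.e 3 = c.x 1 := h.swap.yInf_mul hg'
  obtain ⟨d, hd, hM, hA⟩ : ∃ d, b * d = 1 ∧ b + 1 / b = b + d ∧
      autoParam b = ![-b, -d, b, d, b, d, -b, -d] := by
    refine ⟨1 / b, by field_simp, rfl, ?_⟩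
    rw [autoParam, neg_div]
  have hL : (c.rho (-1) (autoParam b)).swap.pencilQuot (b + 1 / b) =
      c.swap.yZero * c.x 0 * (c.rhoT (-1) (autoParam b) 2 * c.rhoT (-1) (autoParam b) 3) +
      (b + 1 / b) * (c.swap.yZero * c.swap.yInf) * (c.rhoY (-1) 1 ^ 2 - c.rhoY (-1) 0 ^ 2) +
      c.swap.yInf * c.x 1 * (c.rhoT (-1) (autoParam b) 0 * c.rhoT (-1) (autoParam b) 1) := rfl
  have hR : c.swap.pencilQuot (-(b + 1 / b)) =
      c.swap.yZero * c.x 0 * (c.t 2 * c.t 3) +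
      -(b + 1 / b) * (c.swap.yZero * c.swap.yInf) * (c.y 1 ^ 2 - c.y 0 ^ 2) +
      c.swap.yInf * c.x 1 * (c.t 0 * c.t 1) := rfl
  have hS : c.s 6 * c.s 7 * c.s 4 * c.s 5 * (c.e 4 * c.e 5 * c.e 6 * c.e 7) =
      (c.x 0 - autoParam b 4 * c.x 1) * (c.x 0 - autoParam b 5 * c.x 1) *
      ((c.x 0 - autoParam b 6 * c.x 1) * (c.x 0 - autoParam b 7 * c.x 1)) := by
    rw [← e4, ← e5, ← e6, ← e7]; ring
  have hS' : c.s 6 * c.s 7 * c.s 4 * c.s 5 * (c.e 4 * c.e 5 * c.e 6 * c.e 7) =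
      (c.x 0 - b * c.x 1) * (c.x 0 - d * c.x 1) *
        ((c.x 0 - -b * c.x 1) * (c.x 0 - -d * c.x 1)) := by
    rw [hS]; simp only [hA, Matrix.cons_val]
  have N0 : rhoNum (-1) (autoParam b) c 0 = -(c.x 1 ^ 2 * c.t 0) +
      c.s 0 * (-c.y 0 * (c.x 0 + (b + d) * c.x 1) - b * c.y 1 * (c.x 0 - (b + d) * c.x 1)) := by
    have r : rhoParam (-1) (autoParam b) 0 = b := by simp [rhoParam, hA, hd]
    rw [rhoNum, r]
    simp only [ell, lead, rest, if_pos (show (0 : Fin 8) < 2 by decide), hA, Matrix.cons_val]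
    linear_combination -(c.x 1 ^ 2 * c.t 0) * hd
  have N1 : rhoNum (-1) (autoParam b) c 1 = -(c.x 1 ^ 2 * c.t 1) +
      c.s 1 * (-c.y 0 * (c.x 0 + (b + d) * c.x 1) - d * c.y 1 * (c.x 0 - (b + d) * c.x 1)) := by
    have r : rhoParam (-1) (autoParam b) 1 = d := by simp [rhoParam, hA, hd]
    rw [rhoNum, r]
    simp only [ell, lead, rest, if_pos (show (1 : Fin 8) < 2 by decide), hA, Matrix.cons_val]
    linear_combination -(c.x 1 ^ 2 * c.t 1) * hd
  have N2 : rhoNum (-1) (autoParam b) c 2 = -(c.x 0 ^ 2 * c.t 2) +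
      c.s 2 * (c.y 0 * ((b + d) * c.x 0 + c.x 1) + b * c.y 1 * ((b + d) * c.x 0 - c.x 1)) := by
    have r : rhoParam (-1) (autoParam b) 2 = -b := by simp [rhoParam, hA, hd]
    rw [rhoNum, r]
    simp only [ell, lead, rest, if_neg (show ¬ (2 : Fin 8) < 2 by decide), hA, Matrix.cons_val]
    linear_combination c.s 2 * c.x 1 * (c.y 0 - b * c.y 1) * hd
  have N3 : rhoNum (-1) (autoParam b) c 3 = -(c.x 0 ^ 2 * c.t 3) +
      c.s 3 * (c.y 0 * ((b + d) * c.x 0 + c.x 1) + d * c.y 1 * ((b + d) * c.x 0 - c.x 1)) := by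
    have r : rhoParam (-1) (autoParam b) 3 = -d := by simp [rhoParam, hA, hd]
    rw [rhoNum, r]
    simp only [ell, lead, rest, if_neg (show ¬ (3 : Fin 8) < 2 by decide), hA, Matrix.cons_val]
    linear_combination c.s 3 * c.x 1 * (c.y 0 - d * c.y 1) * hd
  rw [N0] at T0
  rw [N1] at T1
  rw [N2] at T2
  rw [N3] at T3
  rw [hL, hR, mul_assoc (_ + _) (c.s 6 * c.s 7 * c.s 4 * c.s 5), hS', hM]
  simp only [hA, Matrix.cons_val] at t0 t1 t2 t3 Y0 Y1
  generalize c.e 4 * c.e 5 * c.e 6 * c.e 7 = p at *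
  generalize c.swap.yZero = X0 at *
  generalize c.swap.yInf = X1 at *
  trans X0 * c.x 0 * ((c.rhoT (-1) (autoParam b) 2 * p)
      * (c.rhoT (-1) (autoParam b) 3 * p))
    + (b + d) * (X0 * X1) * ((c.rhoY (-1) 1 * p) ^ 2 - (c.rhoY (-1) 0 * p) ^ 2)
    + X1 * c.x 1 * ((c.rhoT (-1) (autoParam b) 0 * p)
      * (c.rhoT (-1) (autoParam b) 1 * p))
  · ring
  rw [T0, T1, T2, T3, Y0, Y1]
  have s2' : c.s 2 = -(X1 * c.e 3) := by rw [s2, neg_neg]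
  have s3' : c.s 3 = -(X1 * c.e 2) := by rw [s3, neg_neg]
  rw [← s0, ← s1, s2', s3']
  -- What is left is a polynomial identity modulo the relations `x0`, `x1`, `hd` and `t0`, …, `t3`.
  rcases mul_eq_zero.1 h0 with h0 | h0
  · rw [h0] at x0 ⊢
    linear_combination (-X1 * c.x 1 ^ 5 * c.t 0 * c.t 1 * (b * d + 1)
        + 2 * (b + d) * X0 * X1 * c.x 1 ^ 4 *
          (-c.y 0 ^ 2 * (b * d + 1) + c.y 1 ^ 2 * (b * d))) * hd
      + X0 * X1 * (b + d) * c.x 1 ^ 4 * (c.y 0 - d * c.y 1) * t0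
      + X0 * X1 * (b + d) * c.x 1 ^ 4 * (c.y 0 - b * c.y 1) * t1
      + X0 * X1 * (b + d) ^ 2 * c.x 1 ^ 3 * (c.y 0 - b * c.y 1) * (c.y 0 - d * c.y 1) * x0
  · rw [h0] at x1 ⊢
    linear_combination -2 * (b + d) * X0 * X1 * c.x 0 ^ 4 * c.y 1 ^ 2 * hd
      + X0 * X1 * (b + d) * c.x 0 ^ 4 * (c.y 0 + d * c.y 1) * t2
      + X0 * X1 * (b + d) * c.x 0 ^ 4 * (c.y 0 + b * c.y 1) * t3
      + X0 * X1 * (b + d) ^ 2 * c.x 0 ^ 3 * (c.y 0 + b * c.y 1) * (c.y 0 + d * c.y 1) * x1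

/-- The mapping preserves the quotient of `pencilForm` by the exceptional curves. -/
theorem Cox.IsOn.pencilZ_phi (hb : b ≠ 0) (hb4 : b ^ 4 ≠ 1)
    (h : c.IsOn (points (autoParam b))) :
    (c.phi (autoParam b)).pencilZ (b + 1 / b) = c.pencilZ (b + 1 / b) := by
  have hg := autoParam_swap_generic hb hb4
  have hκ : (-1 : ℂ) ≠ 0 := by simp
  have hz := Cox.yZero_rho h.swap hg hκ
  have hi := Cox.yInf_rho h.swap hg hκ
  have h1 := h.pencilZ_mul_left hb hb4
  have h2 := h.pencilZ_mul_right hb hb4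
  have hon : (c.phi (autoParam b)).IsOn (points (autoParam b)) := by
    have := h.swap.rho hg hκ
    rw [← autoParam_kappa hb, ← nextParam_eq (autoParam_isParam hb hb4),
      nextParam_autoParam hb hb4] at this
    exact this
  have hd := hon.pencilZ_data hb hb4
  have hQ : (c.phi (autoParam b)).pencilQuot (b + 1 / b) =
      c.swap.pencilQuot (-(b + 1 / b)) := by
    have hk : (c.phi (autoParam b)) = c.swap.rho (-1) (swapParam (autoParam b)) := by
      rw [Cox.phi, autoParam_kappa hb]
    have : (c.swap.rho (-1) (swapParam (autoParam b))).pencilQuot (b + 1 / b) =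
        (c.swap.rho (-1) (swapParam (autoParam b))).yZero *
          (-1 * c.swap.yZero * c.swap.s 6 * c.swap.s 7) * (c.swap.e 4 * c.swap.e 5) +
        (b + 1 / b) * ((c.swap.rho (-1) (swapParam (autoParam b))).yZero *
          (c.swap.rho (-1) (swapParam (autoParam b))).yInf) *
          (c.swap.x 1 ^ 2 - c.swap.x 0 ^ 2) +
        (c.swap.rho (-1) (swapParam (autoParam b))).yInf *
          (c.swap.yInf * c.swap.s 4 * c.swap.s 5) * (c.swap.e 6 * c.swap.e 7) := rfl
    rw [hk, this, hz, hi, Cox.pencilQuot, ← h.swap.yZero_mul hg, ← h.swap.yInf_mul hg]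
    ring
  have hE1 : (c.phi (autoParam b)).e 0 * (c.phi (autoParam b)).e 1 * (c.phi (autoParam b)).e 2 *
      (c.phi (autoParam b)).e 3 = c.e 4 * c.e 5 * c.e 6 * c.e 7 := rfl
  have hE2 : (c.phi (autoParam b)).e 4 * (c.phi (autoParam b)).e 5 * (c.phi (autoParam b)).e 6 *
      (c.phi (autoParam b)).e 7 = c.swap.s 6 * c.swap.s 7 * c.swap.s 4 * c.swap.s 5 := rfl
  rw [hQ, hE1, hE2] at hd
  rw [Cox.pencilZ, hQ, hE1, hE2]
  refine quot_eq hd.1 h2 ?_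
  by_cases h0 : c.e 4 * c.e 5 * c.e 6 * c.e 7 = 0
  · -- A point of an exceptional curve over `y = 0` or `y = ∞`.
    have hp := (h.pencilZ_data hb hb4).1.resolve_right (not_not.2 h0)
    have hy : c.swap.x 0 * c.swap.x 1 = 0 := by
      change c.y 0 * c.y 1 = 0
      have g := autoParam_generic hb hb4
      rw [← h.yZero_mul g, ← h.yInf_mul g]
      linear_combination (c.yZero * c.yInf) * h0
    have hs := h.swap
    rw [swapParam_autoParam] at hs
    have key := hs.pencilQuot_swap_rho (neg_ne_zero.2 hb)
      (by rwa [Even.neg_pow (by decide)]) hy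
    have e : -b + 1 / -b = -(b + 1 / b) := by rw [div_neg]; ring
    have hk : c.swap.rho (-1) (autoParam (-b)) = c.phi (autoParam b) := by
      rw [Cox.phi, autoParam_kappa hb, swapParam_autoParam]
    have hE : c.swap.e 4 * c.swap.e 5 * c.swap.e 6 * c.swap.e 7 =
      c.e 0 * c.e 1 * c.e 2 * c.e 3 := rfl
    rw [e, neg_neg, Cox.swap_swap, hk, hE] at key
    refine mul_right_cancel₀ (pow_ne_zero 2 hp) ?_
    rw [key, ← h1]
    ring
  · refine mul_right_cancel₀ h0 ?_
    rw [← hd.2, ← h2]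
    ring

variable {X : Set Ambient} {a : Fin 8 → ℂ} {Dx Dy : Pic} {De : Fin 8 → Pic}
  {f : (Var → ℂ) → Cox}

theorem CoxSec.pencilQuot (hc : CoxSec X Dx Dy De f) (ha : Generic a)
    (h : ∀ v, OnSet X v → (f v).IsOn (points a)) (m : ℂ) :
    Sec X (Dx + Dx + Dy + Dy - De 4 - De 5 - De 6 - De 7) (fun v => (f v).pencilQuot m) := by
  have hz := hc.yZero ha h
  have hi := hc.yInf ha h
  have hsq : ∀ j, Sec X (Dx + Dx) (fun v => (f v).x j ^ 2) := fun j => by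
    simpa only [sq] using (hc.x j).mul (hc.x j)
  exact ((((hz.mul (hc.y 0)).mul ((hc.s 6).mul (hc.s 7))).cast (by abel)).add
    ((((hz.mul hi).const_mul m).mul ((hsq 1).sub (hsq 0))).cast (by abel))).add
    (((hi.mul (hc.y 1)).mul ((hc.s 4).mul (hc.s 5))).cast (by abel))

/-- The two forms of the pencil, divided by the equations of the exceptional curves, are sections
of one line bundle. -/
theorem CoxSec.pencil (hb : b ≠ 0) (hb4 : b ^ 4 ≠ 1) (hc : CoxSec X Dx Dy De f)
    (h : ∀ v, OnSet X v → (f v).IsOn (points (autoParam b))) (j : Fin 2) :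
    Sec X (Dx + Dx + Dy + Dy - (De 0 + De 1 + De 2 + De 3) - (De 4 + De 5 + De 6 + De 7))
      (fun v => ![(f v).pencilZ (b + 1 / b), (f v).pencilW] j) := by
  have hg := autoParam_generic hb hb4
  have hg' := autoParam_swap_generic hb hb4
  have h' := fun v hv => (h v hv).swap
  fin_cases j
  · exact Sec.quot ((hc.pencilQuot hg h _).cast (by abel))
      ((((hc.e 0).mul (hc.e 1)).mul (hc.e 2)).mul (hc.e 3))
      ((hc.swap.pencilQuot hg' h' _).cast
        (by simp only [show (4 + 4 : Fin 8) = 0 from rfl, show (5 + 4 : Fin 8) = 1 from rfl,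
              show (6 + 4 : Fin 8) = 2 from rfl, show (7 + 4 : Fin 8) = 3 from rfl]; abel))
      ((((hc.e 4).mul (hc.e 5)).mul (hc.e 6)).mul (hc.e 7))
      fun v hv => (h v hv).pencilZ_data hb hb4
  · exact (((hc.yZero hg h).mul (hc.yInf hg h)).mul
      ((hc.swap.yZero hg' h').mul (hc.swap.yInf hg' h'))).cast
        (by simp only [show (4 + 4 : Fin 8) = 0 from rfl, show (5 + 4 : Fin 8) = 1 from rfl,
              show (6 + 4 : Fin 8) = 2 from rfl, show (7 + 4 : Fin 8) = 3 from rfl]; abel)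

end

theorem valueAt_formOne (p : Fin 2 → Fin 2 → ℂ) :
    valueAt p formOne = p 0 0 * p 0 1 * p 1 0 * p 1 1 := by
  simp [valueAt, formOne]

theorem valueAt_formTwo (a : ℂ) (p : Fin 2 → Fin 2 → ℂ) :
    valueAt p (formTwo a) = pencilForm (a + 1 / a) (p 0) (p 1) := by
  simp [valueAt, formTwo, pencilForm]

/-- The parameter of the anticanonical pencil is a morphism to the projective line; the mapping
changes its sign. -/
theorem exists_pencil_map {b : ℂ} (hb : b ≠ 0) (hb4 : b ^ 4 ≠ 1)
    {Φ : surface (autoParam b) → surface (autoParam b)}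
    (hΦ : ∀ (z : surface (autoParam b)) (v : Var → ℂ), Represents v z →
      Represents ((std (points (autoParam b)) v).phi (autoParam b)).build (Φ z)) :
    ∃ K : surface (autoParam b) → Line, IsRegular K ∧
      (∀ (z : surface (autoParam b)) (p : Fin 2 → Fin 2 → ℂ),
        (∀ i, HasCoords (z.1.1 i) (p i)) →
        ![valueAt p (formTwo b), valueAt p formOne] ≠ 0 →
        HasCoords (K z) ![valueAt p (formTwo b), valueAt p formOne]) ∧
      ∀ (z : surface (autoParam b)) (k₀ k₁ : ℂ),
        HasCoords (K z) ![k₀, k₁] → HasCoords (K (Φ z)) ![-k₀, k₁] := by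
  set P := points (autoParam b) with hP
  have hon : ∀ v, OnSet (surface (autoParam b)) v → (std P v).IsOn P := fun v hv => std_isOn hv
  have hs := fun j => (std_coxSec P).pencil hb hb4 hon j
  have eta : ∀ v, (fun j => ![(std P v).pencilZ (b + 1 / b), (std P v).pencilW] j) =
      ![(std P v).pencilZ (b + 1 / b), (std P v).pencilW] := fun v => rfl
  obtain ⟨K, hK⟩ := exists_map_of_sec hs fun v hv => (hon v hv).pencil_ne_zero hb hb4
  refine ⟨K, isRegular_of_sec hs hK, fun z p hp hne => ?_, fun z k₀ k₁ hk => ?_⟩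
  · obtain ⟨v, hv⟩ := exists_represents z.1
    obtain ⟨r, hr, h0⟩ := (hv.1 0).exists_smul (hp 0)
    obtain ⟨u, hu, h1⟩ := (hv.1 1).exists_smul (hp 1)
    have ho := hon v ⟨z, z.2, hv⟩
    have hZ := ho.pencilZ_mul hb hb4
    have hW := ho.pencilW_mul hb hb4
    have hKv := hK z v hv
    have hx : baseCoords v 0 = (std P v).x := rfl
    have hy : baseCoords v 1 = (std P v).y := rfl
    rw [eta] at hKv
    rw [valueAt_formTwo, valueAt_formOne, h0, h1, hx, hy] at hne ⊢
    generalize std P v = c at *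
    generalize c.e 0 * c.e 1 * c.e 2 * c.e 3 * (c.e 4 * c.e 5 * c.e 6 * c.e 7) = e at *
    have key : ![pencilForm (b + 1 / b) (r • c.x) (u • c.y),
        (r • c.x) 0 * (r • c.x) 1 * (u • c.y) 0 * (u • c.y) 1] =
        (r ^ 2 * u ^ 2 * e) • ![c.pencilZ (b + 1 / b), c.pencilW] := by
      funext j
      fin_cases j
      · simp [pencilForm] at hZ ⊢
        linear_combination -r ^ 2 * u ^ 2 * hZ
      · simp
        linear_combination -r ^ 2 * u ^ 2 * hW
    rw [key] at hne ⊢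
    exact hKv.smul fun h => hne (by rw [h, zero_smul])
  · obtain ⟨v, hv⟩ := exists_represents z.1
    have ho := hon v ⟨z, z.2, hv⟩
    have hon' : ((std P v).phi (autoParam b)).IsOn P := by
      have := ho.swap.rho (autoParam_swap_generic hb hb4) (κ := -1) (by simp)
      rw [← autoParam_kappa hb, ← nextParam_eq (autoParam_isParam hb hb4),
        nextParam_autoParam hb hb4] at this
      exact this
    have h1 := hK _ _ (hΦ z v hv)
    rw [eta, std_build hon', ho.pencilZ_phi hb hb4, ho.pencilW_phi hb hb4] at h1
    have h2 := hK z v hv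
    rw [eta] at h2
    obtain ⟨r, hr, h3⟩ := h2.exists_smul hk
    have e0 : k₀ = r * (std P v).pencilZ (b + 1 / b) := congrFun h3 0
    have e1 : k₁ = r * (std P v).pencilW := congrFun h3 1
    have : ![-k₀, k₁] = (-r) • ![(std P v).pencilZ (b + 1 / b), -(std P v).pencilW] := by
      rw [e0, e1]
      funext j
      fin_cases j <;> simp
    rw [this]
    exact h1.smul (neg_ne_zero.2 hr)

/-! ### Forms of bidegree `(2, 2)` -/

/-- The exponent of the monomial `x₀ⁱ x₁²⁻ⁱ y₀ʲ y₁²⁻ʲ`. -/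
def biExp (k : Fin 3 × Fin 3) : Fin 2 × Fin 2 →₀ ℕ :=
  Finsupp.equivFunOnFinite.symm fun c =>
    ![![(k.1 : ℕ), 2 - k.1], ![(k.2 : ℕ), 2 - k.2]] c.1 c.2

theorem biExp_injective : Function.Injective biExp := by
  intro k l h
  have h1 := DFunLike.congr_fun h (0, 0)
  have h2 := DFunLike.congr_fun h (1, 0)
  exact Prod.ext (Fin.ext h1) (Fin.ext h2)

theorem exists_biExp {F : BiPoly}
    (hF : IsWeightedHomogeneous (fun c : Fin 2 × Fin 2 => (Pi.single c.1 1 : Fin 2 → ℕ)) F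
      (fun _ => 2)) {d : Fin 2 × Fin 2 →₀ ℕ} (hd : coeff d F ≠ 0) : ∃ k, biExp k = d := by
  have h := hF hd
  rw [Finsupp.weight_apply, Finsupp.sum_fintype _ _ (by simp)] at h
  have h0 : d (0, 0) + d (0, 1) = 2 := by
    simpa [Fintype.sum_prod_type] using congrFun h 0
  have h1 : d (1, 0) + d (1, 1) = 2 := by
    simpa [Fintype.sum_prod_type] using congrFun h 1
  refine ⟨(⟨d (0, 0), by omega⟩, ⟨d (1, 0), by omega⟩), Finsupp.ext ?_⟩
  rintro ⟨i, j⟩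
  fin_cases i <;> fin_cases j <;> simp [biExp] <;> omega

theorem valueAt_eq_sum {F : BiPoly}
    (hF : IsWeightedHomogeneous (fun c : Fin 2 × Fin 2 => (Pi.single c.1 1 : Fin 2 → ℕ)) F
      (fun _ => 2)) (p : Fin 2 → Fin 2 → ℂ) :
    valueAt p F = ∑ k : Fin 3 × Fin 3, coeff (biExp k) F *
      (p 0 0 ^ (k.1 : ℕ) * p 0 1 ^ (2 - k.1 : ℕ) *
        (p 1 0 ^ (k.2 : ℕ) * p 1 1 ^ (2 - k.2 : ℕ))) := by
  classical
  have h : F.support ⊆ Finset.univ.image biExp := by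
    intro d hd
    obtain ⟨k, hk⟩ := exists_biExp hF (mem_support_iff.1 hd)
    exact Finset.mem_image.2 ⟨k, Finset.mem_univ _, hk⟩
  rw [valueAt, eval_eq', Finset.sum_subset h, Finset.sum_image biExp_injective.injOn]
  · refine Finset.sum_congr rfl fun k _ => ?_
    congr 1
    simp [Fintype.prod_prod_type, biExp]
  · intro d _ hd
    rw [notMem_support_iff.1 hd, zero_mul]

/-- A quadratic polynomial with the two roots `m` and `n` is a multiple of `(x - m) (x - n)`. -/
theorem eq_of_two_roots {m n A B C : ℂ} (hmn : m ≠ n) (hm : A + m * B + m ^ 2 * C = 0)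
    (hn : A + n * B + n ^ 2 * C = 0) : B = -(m + n) * C ∧ A = m * n * C := by
  have h1 : B = -(m + n) * C := by
    refine mul_left_cancel₀ (sub_ne_zero.2 hmn) ?_
    linear_combination hm - hn
  refine ⟨h1, ?_⟩
  linear_combination hm - m * h1

theorem mem_anticanonicalForms {P : Fin 8 → Fin 2 → Fin 2 → ℂ} {F : BiPoly} :
    F ∈ anticanonicalForms P ↔
      IsWeightedHomogeneous (fun c : Fin 2 × Fin 2 => (Pi.single c.1 1 : Fin 2 → ℕ)) F
        (fun _ => 2) ∧ ∀ i, valueAt (P i) F = 0 := by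
  simp [anticanonicalForms, mem_weightedHomogeneousSubmodule, valueAt, aeval_eq_eval]

theorem formOne_homogeneous :
    IsWeightedHomogeneous (fun c : Fin 2 × Fin 2 => (Pi.single c.1 1 : Fin 2 → ℕ)) formOne
      (fun _ => 2) := by
  have h := fun c => isWeightedHomogeneous_X ℂ
    (fun c : Fin 2 × Fin 2 => (Pi.single c.1 1 : Fin 2 → ℕ)) c
  have := (((h (0, 0)).mul (h (0, 1))).mul (h (1, 0))).mul (h (1, 1))
  have hd : (Pi.single 0 1 + Pi.single 0 1 + Pi.single 1 1 + Pi.single 1 1 : Fin 2 → ℕ) =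
      fun _ => 2 := by decide
  rw [← hd]
  exact this

theorem formTwo_homogeneous (a : ℂ) :
    IsWeightedHomogeneous (fun c : Fin 2 × Fin 2 => (Pi.single c.1 1 : Fin 2 → ℕ)) (formTwo a)
      (fun _ => 2) := by
  let w : Fin 2 × Fin 2 → Fin 2 → ℕ := fun c => Pi.single c.1 1
  have h := isWeightedHomogeneous_X ℂ w
  have hc := isWeightedHomogeneous_C w (a + 1 / a)
  have e : ∀ {F : BiPoly} {m n : Fin 2 → ℕ}, IsWeightedHomogeneous w F m → m = n →
    IsWeightedHomogeneous w F n := fun hF hm => hm ▸ hF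
  have hadd : ∀ {F G : BiPoly} {m : Fin 2 → ℕ}, IsWeightedHomogeneous w F m →
    IsWeightedHomogeneous w G m → IsWeightedHomogeneous w (F + G) m :=
    fun hF hG => (weightedHomogeneousSubmodule ℂ w _).add_mem hF hG
  have hsub : ∀ {F G : BiPoly} {m : Fin 2 → ℕ}, IsWeightedHomogeneous w F m →
    IsWeightedHomogeneous w G m → IsWeightedHomogeneous w (F - G) m :=
    fun hF hG => (weightedHomogeneousSubmodule ℂ w _).sub_mem hF hG
  have h1 := (hadd ((h (0, 0)).pow 2) ((h (0, 1)).pow 2)).mul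
    (hadd ((h (1, 0)).pow 2) ((h (1, 1)).pow 2))
  have h2 := hsub ((h (1, 0)).mul (h (0, 1)))
    (e ((h (0, 0)).mul (h (1, 1))) (n := w (1, 0) + w (0, 1)) (by funext i; fin_cases i <;> rfl))
  have h3 := hadd ((h (0, 0)).mul (h (1, 0)))
    (e ((h (0, 1)).mul (h (1, 1))) (n := w (0, 0) + w (1, 0)) (by funext i; fin_cases i <;> rfl))
  exact hadd (e h1 (by funext i; fin_cases i <;> rfl)) (e ((hc.mul h2).mul h3)
    (by funext i; fin_cases i <;> rfl))

section
variable {a : ℂ}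

theorem valueAt_points_formOne (a : Fin 8 → ℂ) (i : Fin 8) :
    valueAt (points a i) formOne = 0 := by
  rw [valueAt_formOne]
  fin_cases i <;> simp [points]

/-- The points lie on the curve if their parameters are roots of the restrictions of the form to
the four lines `x = 0, ∞` and `y = 0, ∞`. -/
theorem pencilForm_points {m : ℂ} {a : Fin 8 → ℂ} (h0 : a 0 ^ 2 + m * a 0 + 1 = 0)
    (h1 : a 1 ^ 2 + m * a 1 + 1 = 0) (h2 : a 2 ^ 2 - m * a 2 + 1 = 0)
    (h3 : a 3 ^ 2 - m * a 3 + 1 = 0) (h4 : a 4 ^ 2 - m * a 4 + 1 = 0)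
    (h5 : a 5 ^ 2 - m * a 5 + 1 = 0) (h6 : a 6 ^ 2 + m * a 6 + 1 = 0)
    (h7 : a 7 ^ 2 + m * a 7 + 1 = 0) (i : Fin 8) :
    pencilForm m (points a i 0) (points a i 1) = 0 := by
  rw [pencilForm]
  fin_cases i <;> simp [points]
  · linear_combination h0
  · linear_combination h1
  · linear_combination h2
  · linear_combination h3
  · linear_combination h4
  · linear_combination h5
  · linear_combination h6
  · linear_combination h7

theorem formTwo_mem (ha : a ≠ 0) :
    formTwo a ∈ anticanonicalForms (points (autoParam a)) := by
  refine mem_anticanonicalForms.2 ⟨formTwo_homogeneous a, fun i => ?_⟩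
  rw [valueAt_formTwo]
  obtain ⟨d, hd, hd', hA⟩ : ∃ d, a * d = 1 ∧ 1 / a = d ∧
      autoParam a = ![-a, -d, a, d, a, d, -a, -d] :=
    ⟨1 / a, by field_simp, rfl, by rw [autoParam, neg_div]⟩
  rw [hd']
  refine pencilForm_points ?_ ?_ ?_ ?_ ?_ ?_ ?_ ?_ i <;> simp only [hA, Matrix.cons_val] <;>
    linear_combination -hd

/-- The restriction of a form of bidegree `(2, 2)` to each of the lines `x = 0, ∞` and `y = 0, ∞`
is determined up to a factor by the two points on it. -/
theorem coeff_relations {a : Fin 8 → ℂ} (hp : IsParam a) {F : BiPoly}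
    (hF : F ∈ anticanonicalForms (points a)) :
    (coeff (biExp (0, 1)) F = -(a 0 + a 1) * coeff (biExp (0, 2)) F ∧
      coeff (biExp (0, 0)) F = a 0 * a 1 * coeff (biExp (0, 2)) F) ∧
    (coeff (biExp (2, 1)) F = -(a 2 + a 3) * coeff (biExp (2, 2)) F ∧
      coeff (biExp (2, 0)) F = a 2 * a 3 * coeff (biExp (2, 2)) F) ∧
    (coeff (biExp (1, 0)) F = -(a 4 + a 5) * coeff (biExp (2, 0)) F ∧
      coeff (biExp (0, 0)) F = a 4 * a 5 * coeff (biExp (2, 0)) F) ∧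
    (coeff (biExp (1, 2)) F = -(a 6 + a 7) * coeff (biExp (2, 2)) F ∧
      coeff (biExp (0, 2)) F = a 6 * a 7 * coeff (biExp (2, 2)) F) := by
  obtain ⟨hF, h0⟩ := mem_anticanonicalForms.1 hF
  have e := valueAt_eq_sum hF
  simp only [Fintype.sum_prod_type, Fin.sum_univ_three] at e
  simp only [e] at h0
  have k0 := h0 0
  have k1 := h0 1
  have k2 := h0 2
  have k3 := h0 3
  have k4 := h0 4
  have k5 := h0 5
  have k6 := h0 6
  have k7 := h0 7
  simp [points] at k0 k1 k2 k3 k4 k5 k6 k7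
  exact ⟨eq_of_two_roots hp.ne_one_two (by linear_combination k0) (by linear_combination k1),
    eq_of_two_roots hp.ne_three_four (by linear_combination k2) (by linear_combination k3),
    eq_of_two_roots hp.ne_five_six (by linear_combination k4) (by linear_combination k5),
    eq_of_two_roots hp.ne_seven_eight (by linear_combination k6) (by linear_combination k7)⟩

/-- The eight conditions determine the restrictions of a form of bidegree `(2, 2)` to the four
lines `x = 0, ∞` and `y = 0, ∞` up to a common factor, and only the coefficient of `x y` remains
free. -/
theorem anticanonicalForms_eq (ha : a ≠ 0) (ha4 : a ^ 4 ≠ 1) :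
    anticanonicalForms (points (autoParam a)) = Submodule.span ℂ {formOne, formTwo a} := by
  apply le_antisymm
  · intro F hF
    obtain ⟨⟨u1, u2⟩, ⟨u3, u4⟩, ⟨u5, u6⟩, u7, u8⟩ :=
      coeff_relations (autoParam_isParam ha ha4) hF
    have e := valueAt_eq_sum (mem_anticanonicalForms.1 hF).1
    simp only [Fintype.sum_prod_type, Fin.sum_univ_three] at e
    clear hF
    generalize coeff (biExp (0, 0)) F = c00 at *
    generalize coeff (biExp (0, 1)) F = c01 at *
    generalize coeff (biExp (0, 2)) F = c02 at *
    generalize coeff (biExp (1, 0)) F = c10 at *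
    generalize coeff (biExp (1, 1)) F = c11 at *
    generalize coeff (biExp (1, 2)) F = c12 at *
    generalize coeff (biExp (2, 0)) F = c20 at *
    generalize coeff (biExp (2, 1)) F = c21 at *
    generalize coeff (biExp (2, 2)) F = c22 at *
    obtain ⟨d, hd, hd', hA⟩ : ∃ d, a * d = 1 ∧ 1 / a = d ∧
        autoParam a = ![-a, -d, a, d, a, d, -a, -d] :=
      ⟨1 / a, by field_simp, rfl, by rw [autoParam, neg_div]⟩
    simp only [hA, Matrix.cons_val] at u1 u2 u3 u4 u5 u6 u7 u8
    have w8 : c02 = c22 := by linear_combination u8 + c22 * hd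
    have w4 : c20 = c22 := by linear_combination u4 + c22 * hd
    have w2 : c00 = c22 := by linear_combination u2 + c02 * hd + w8
    rw [Submodule.mem_span_pair]
    refine ⟨c11, c22, MvPolynomial.funext fun x => ?_⟩
    have hx := e (fun i j => x (i, j))
    have h1 := valueAt_formOne (fun i j => x (i, j))
    have h2 := valueAt_formTwo a (fun i j => x (i, j))
    simp only [valueAt] at hx h1 h2
    rw [map_add, smul_eval, smul_eval, h1, h2, hx, pencilForm, hd', u1, u3, u5, u7, w8, w4, w2]
    simp
    ring
  · rw [Submodule.span_le]
    rintro F (rfl | rfl)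
    exacts [mem_anticanonicalForms.2 ⟨formOne_homogeneous, valueAt_points_formOne _⟩,
      formTwo_mem ha]

theorem finrank_anticanonicalForms (ha : a ≠ 0) (ha4 : a ^ 4 ≠ 1) :
    Module.finrank ℂ (anticanonicalForms (points (autoParam a))) = 2 := by
  have h : LinearIndependent ℂ ![formOne, formTwo a] := by
    rw [LinearIndependent.pair_iff]
    intro s t hst
    have e : ∀ p, s * valueAt p formOne + t * valueAt p (formTwo a) = 0 := by
      intro p
      have := congrArg (valueAt p) hst
      simpa [valueAt, smul_eval] using this
    have ht : t = 0 := by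
      simpa [valueAt_formOne, valueAt_formTwo, pencilForm] using e ![![1, 0], ![1, 0]]
    have hs := e ![![1, 1], ![1, 1]]
    rw [ht, valueAt_formOne] at hs
    exact ⟨by simpa using hs, ht⟩
  rw [anticanonicalForms_eq ha ha4]
  have := finrank_span_eq_card h
  rwa [Matrix.range_cons, Matrix.range_cons, Matrix.range_empty, Set.union_empty,
    Set.singleton_union] at this

/-! ### Singular members of the pencil -/

/-- The values of a member of the pencil and of its partial derivatives. -/
theorem pderiv_pencil (k m : ℂ) (p : Fin 2 → Fin 2 → ℂ) (F : BiPoly)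
    (hF : F = C k * formOne - ((X (0, 0) ^ 2 + X (0, 1) ^ 2) * (X (1, 0) ^ 2 + X (1, 1) ^ 2) +
      C m * (X (1, 0) * X (0, 1) - X (0, 0) * X (1, 1)) *
        (X (0, 0) * X (1, 0) + X (0, 1) * X (1, 1)))) :
    valueAt p F = k * (p 0 0 * p 0 1 * p 1 0 * p 1 1) - pencilForm m (p 0) (p 1) ∧
    valueAt p (pderiv (0, 0) F) = k * (p 0 1 * p 1 0 * p 1 1) -
      (2 * p 0 0 * (p 1 0 ^ 2 + p 1 1 ^ 2) + m * (-p 1 1 * (p 0 0 * p 1 0 + p 0 1 * p 1 1) +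
        (p 1 0 * p 0 1 - p 0 0 * p 1 1) * p 1 0)) ∧
    valueAt p (pderiv (0, 1) F) = k * (p 0 0 * p 1 0 * p 1 1) -
      (2 * p 0 1 * (p 1 0 ^ 2 + p 1 1 ^ 2) + m * (p 1 0 * (p 0 0 * p 1 0 + p 0 1 * p 1 1) +
        (p 1 0 * p 0 1 - p 0 0 * p 1 1) * p 1 1)) ∧
    valueAt p (pderiv (1, 0) F) = k * (p 0 0 * p 0 1 * p 1 1) -
      (2 * p 1 0 * (p 0 0 ^ 2 + p 0 1 ^ 2) + m * (p 0 1 * (p 0 0 * p 1 0 + p 0 1 * p 1 1) +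
        (p 1 0 * p 0 1 - p 0 0 * p 1 1) * p 0 0)) ∧
    valueAt p (pderiv (1, 1) F) = k * (p 0 0 * p 0 1 * p 1 0) -
      (2 * p 1 1 * (p 0 0 ^ 2 + p 0 1 ^ 2) + m * (-p 0 0 * (p 0 0 * p 1 0 + p 0 1 * p 1 1) +
        (p 1 0 * p 0 1 - p 0 0 * p 1 1) * p 0 1)) := by
  subst hF
  refine ⟨?_, ?_, ?_, ?_, ?_⟩ <;>
    simp [valueAt, formOne, pencilForm, pderiv_X, Derivation.leibniz,
      Derivation.leibniz_pow] <;> ring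

/-- The condition on `m` is the nonvanishing of the determinant. -/
theorem eq_zero_of_sym {m u v : ℂ} (hm : 4 - m ^ 2 ≠ 0) (h1 : 2 * u + m * v = 0)
    (h2 : 2 * v + m * u = 0) : u = 0 ∧ v = 0 := by
  constructor
  · refine (mul_eq_zero.1 ?_).resolve_left hm
    linear_combination 2 * h1 - m * h2
  · refine (mul_eq_zero.1 ?_).resolve_left hm
    linear_combination 2 * h2 - m * h1

/-- The critical values of `((x² + 1) (y² + 1) + m (y - x) (x y + 1)) / (x y)` on the torus. -/
theorem critical_value {k m x y : ℂ} (hm : 4 - m ^ 2 ≠ 0) (hx : x ≠ 0) (hy : y ≠ 0)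
    (h : k * (x * y) = (x ^ 2 + 1) * (y ^ 2 + 1) + m * (y - x) * (x * y + 1))
    (h1 : k * y = 2 * x * (y ^ 2 + 1) + m * (-(x * y + 1) + (y - x) * y))
    (h2 : k * x = 2 * y * (x ^ 2 + 1) + m * ((x * y + 1) + (y - x) * x)) :
    k = 0 ∨ k = 4 * m * Complex.I ∨ k = -(4 * m * Complex.I) ∨ k = 4 - m ^ 2 ∨
      k = -(4 - m ^ 2) := by
  have hA : (x ^ 2 - 1) * (y ^ 2 + 1) = m * y * (x ^ 2 + 1) := by
    linear_combination h - x * h1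
  have hB : (y ^ 2 - 1) * (x ^ 2 + 1) = -m * x * (y ^ 2 + 1) := by
    linear_combination h - y * h2
  have hxy := mul_ne_zero hx hy
  by_cases hP : x ^ 2 + 1 = 0
  · have hQ : y ^ 2 + 1 = 0 := by
      linear_combination -(1 / 2) * hA + (1 / 2) * (y ^ 2 + 1 - m * y) * hP
    have hs : (y - x) * (y + x) = 0 := by linear_combination hQ - hP
    rcases mul_eq_zero.1 hs with hs | hs
    · left
      refine (mul_eq_zero.1 ?_).resolve_right hxy
      linear_combination h + (y ^ 2 + 1) * hP + m * (x * y + 1) * hs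
    · have hk : k = -4 * m * x := by
        have hyx : y = -x := by linear_combination hs
        subst hyx
        linear_combination h + (x ^ 2 + 1 + k + 2 * m * x) * hP
      have hi : (x - Complex.I) * (x + Complex.I) = 0 := by
        linear_combination hP - Complex.I_sq
      rcases mul_eq_zero.1 hi with hi | hi
      · right; right; left
        linear_combination hk - 4 * m * hi
      · right; left
        linear_combination hk - 4 * m * hi
  · have hQ : y ^ 2 + 1 ≠ 0 := by
      intro hQ
      refine hP ?_
      linear_combination -(1 / 2) * hB + (1 / 2) * (x ^ 2 + 1 + m * x) * hQ
    have key : (4 - m ^ 2) * ((y * (x ^ 2 + 1) - x * (y ^ 2 + 1)) *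
        (y * (x ^ 2 + 1) + x * (y ^ 2 + 1))) = 0 := by
      linear_combination ((x ^ 2 - 1) * (y ^ 2 + 1) + m * y * (x ^ 2 + 1)) * hA
        - ((y ^ 2 - 1) * (x ^ 2 + 1) - m * x * (y ^ 2 + 1)) * hB
    -- It remains to treat `y (x² + 1) = ε x (y² + 1)` for both signs `ε`.
    have fin : ∀ ε : ℂ, ε ^ 2 = 1 → y * (x ^ 2 + 1) = ε * (x * (y ^ 2 + 1)) →
        k = ε * (4 - m ^ 2) := by
      intro ε hε hyx
      have h3 : x ^ 2 - 1 = m * ε * x := by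
        refine mul_right_cancel₀ hQ ?_
        linear_combination hA + m * hyx
      have h4 : y ^ 2 - 1 = -m * ε * y := by
        refine mul_right_cancel₀ hP ?_
        linear_combination hB + m * ε * hyx + m * x * (y ^ 2 + 1) * hε
      have h5 : (x ^ 2 + 1) ^ 2 = (m ^ 2 + 4) * x ^ 2 := by
        linear_combination (x ^ 2 - 1 + m * ε * x) * h3 + m ^ 2 * x ^ 2 * hε
      have h6 : (x ^ 2 + 1) * (y ^ 2 + 1) = ε * (m ^ 2 + 4) * (x * y) := by
        refine mul_left_cancel₀ hx ?_
        linear_combination ε * y * h5 - ε * (x ^ 2 + 1) * hyx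
          - x * (x ^ 2 + 1) * (y ^ 2 + 1) * hε
      refine mul_right_cancel₀ hxy ?_
      linear_combination h + h6 + m * x * h4 - m * y * h3
    rcases mul_eq_zero.1 ((mul_eq_zero.1 key).resolve_left hm) with hs | hs
    · have := fin 1 (by ring) (by linear_combination hs)
      right; right; right; left
      linear_combination this
    · have := fin (-1) (by ring) (by linear_combination hs)
      right; right; right; right
      linear_combination this

/-- A singular point of a member of the pencil does not lie on the four lines `x = 0, ∞`,
`y = 0, ∞`, on which all members but one restrict to the eight simple points; so it is a critical
point of the parameter on the torus. -/
theorem finite_singular (ha : a ≠ 0) (ha4 : a ^ 4 ≠ 1) :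
    {k : ℂ | ¬ IsSmoothCurve (C k * formOne - formTwo a)}.Finite := by
  have hm : 4 - (a + 1 / a) ^ 2 ≠ 0 := by
    intro h
    refine ha4 ?_
    field_simp at h
    have : (a ^ 2 - 1) ^ 2 = 0 := by linear_combination -h
    have := pow_eq_zero_iff (two_ne_zero) |>.1 this
    linear_combination (a ^ 2 + 1) * this
  refine Set.Finite.subset (Set.toFinite {0, 4 * (a + 1 / a) * Complex.I,
    -(4 * (a + 1 / a) * Complex.I), 4 - (a + 1 / a) ^ 2, -(4 - (a + 1 / a) ^ 2)}) ?_
  intro k hk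
  simp only [Set.mem_ofPred_eq, IsSmoothCurve] at hk
  push Not at hk
  obtain ⟨p, hp0, hp1, hv, hd⟩ := hk
  obtain ⟨e, e00, e01, e10, e11⟩ := pderiv_pencil k (a + 1 / a) p (C k * formOne - formTwo a) rfl
  have e := e.symm.trans hv
  have e00 := e00.symm.trans (hd (0, 0))
  have e01 := e01.symm.trans (hd (0, 1))
  have e10 := e10.symm.trans (hd (1, 0))
  have e11 := e11.symm.trans (hd (1, 1))
  have hm' : 4 - (-(a + 1 / a)) ^ 2 ≠ 0 := by rwa [neg_sq]
  have zero : ∀ {x : Fin 2 → ℂ}, x 0 = 0 ∧ x 1 = 0 → x = 0 := fun h => by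
    ext i; fin_cases i
    exacts [h.1, h.2]
  generalize a + 1 / a = m at *
  rw [pencilForm] at e
  have hx0 : p 0 0 ≠ 0 := by
    intro h
    have h1 := (ne_zero_or hp0).resolve_left (not_not.2 h)
    rw [h] at e10 e11
    refine hp1 (zero (eq_zero_of_sym hm ?_ ?_))
    · refine mul_left_cancel₀ (pow_ne_zero 2 h1) ?_
      linear_combination -e10
    · refine mul_left_cancel₀ (pow_ne_zero 2 h1) ?_
      linear_combination -e11
  have hx1 : p 0 1 ≠ 0 := by
    intro h
    rw [h] at e10 e11
    refine hp1 (zero (eq_zero_of_sym hm' ?_ ?_))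
    · refine mul_left_cancel₀ (pow_ne_zero 2 hx0) ?_
      linear_combination -e10
    · refine mul_left_cancel₀ (pow_ne_zero 2 hx0) ?_
      linear_combination -e11
  have hy0 : p 1 0 ≠ 0 := by
    intro h
    have h1 := (ne_zero_or hp1).resolve_left (not_not.2 h)
    rw [h] at e00 e01
    refine hp0 (zero (eq_zero_of_sym hm' ?_ ?_))
    · refine mul_left_cancel₀ (pow_ne_zero 2 h1) ?_
      linear_combination -e00
    · refine mul_left_cancel₀ (pow_ne_zero 2 h1) ?_
      linear_combination -e01
  have hy1 : p 1 1 ≠ 0 := by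
    intro h
    rw [h] at e00 e01
    refine hp0 (zero (eq_zero_of_sym hm ?_ ?_))
    · refine mul_left_cancel₀ (pow_ne_zero 2 hy0) ?_
      linear_combination -e00
    · refine mul_left_cancel₀ (pow_ne_zero 2 hy0) ?_
      linear_combination -e01
  obtain ⟨x, hx⟩ : ∃ x, p 0 0 = x * p 0 1 := ⟨p 0 0 / p 0 1, by field_simp⟩
  obtain ⟨y, hy⟩ : ∃ y, p 1 0 = y * p 1 1 := ⟨p 1 0 / p 1 1, by field_simp⟩
  rw [hx] at hx0
  rw [hy] at hy0
  rw [hx, hy] at e e00 e10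
  refine critical_value hm (left_ne_zero_of_mul hx0) (left_ne_zero_of_mul hy0) ?_ ?_ ?_
  · refine mul_left_cancel₀ (mul_ne_zero (pow_ne_zero 2 hx1) (pow_ne_zero 2 hy1)) ?_
    linear_combination e
  · refine mul_left_cancel₀ (mul_ne_zero hx1 (pow_ne_zero 2 hy1)) ?_
    linear_combination e00
  · refine mul_left_cancel₀ (mul_ne_zero (pow_ne_zero 2 hx1) hy1) ?_
    linear_combination e10

end

/-! ### The action on the parameters -/

section
variable {a : Fin 8 → ℂ}

theorem IsParam.sqrtQ_sq (ha : IsParam a) : sqrtQ a ^ 2 = qParam a := by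
  have h := ha.ne_zero
  have hl := ha.norm_left
  have hr := ha.norm_right
  have h2 := h 2
  have h3 := h 3
  have h4 := h 4
  have h5 := h 5
  rw [sqrtQ, qParam]
  field_simp
  linear_combination a 0 * a 1 * (hl - hr)

/-- For normalized parameters, the mapping acts on the parameters without denominators. -/
theorem IsParam.nextParam_eq_mul (ha : IsParam a) :
    nextParam a = ![-(a 2 * a 3 * a 4), -(a 2 * a 3 * a 5), -(a 0 * a 1 * a 6),
      -(a 0 * a 1 * a 7), a 2, a 3, a 0, a 1] := by
  have h := ha.ne_zero
  have hl := ha.norm_left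
  have hr := ha.norm_right
  have h0 := h 0
  have h1 := h 1
  have h4 := h 4
  have h5 := h 5
  have h6 := h 6
  have h7 := h 7
  funext i
  fin_cases i
  · simp [nextParam, sqrtQ]
    field_simp
    linear_combination hl
  · simp [nextParam, sqrtQ]
    field_simp
    linear_combination hl
  · simp [nextParam, sqrtQ]
    field_simp
    linear_combination hr
  · simp [nextParam, sqrtQ]
    field_simp
    linear_combination hr
  all_goals rfl

theorem IsParam.nextParam (ha : IsParam a) : IsParam (nextParam a) := by
  have h := ha.ne_zero
  have hl := ha.norm_left
  have hr := ha.norm_right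
  rw [ha.nextParam_eq_mul]
  refine ⟨fun i => ?_, ?_, ?_, ?_, ?_, ha.ne_three_four, ha.ne_one_two⟩
  · fin_cases i <;> simp [h]
  · simp only [Matrix.cons_val]
    linear_combination (a 0 * a 1 * a 2 * a 3 + 1) * a 4 * a 5 * a 6 * a 7 * hl + hr
  · simp only [Matrix.cons_val]
    linear_combination hl
  · simpa [h] using ha.ne_five_six
  · simpa [h] using ha.ne_seven_eight

theorem IsParam.qParam_nextParam (ha : IsParam a) :
    qParam (CaseIIOne.nextParam a) = (qParam a)⁻¹ := by
  have h := ha.ne_zero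
  have h0 := h 0
  have h1 := h 1
  have h2 := h 2
  have h3 := h 3
  have h4 := h 4
  have h5 := h 5
  have h6 := h 6
  have h7 := h 7
  rw [ha.nextParam_eq_mul, qParam, qParam]
  simp only [Matrix.cons_val]
  field_simp

/-- The parameter `q` of normalized parameters as a monomial. -/
theorem IsParam.qParam_eq (ha : IsParam a) :
    qParam a = (a 0 * a 1 * a 6 * a 7) ^ 2 ∧ (qParam a)⁻¹ = (a 2 * a 3 * a 4 * a 5) ^ 2 := by
  have h := ha.ne_zero
  have hl := ha.norm_left
  have hr := ha.norm_right
  have h0 := h 0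
  have h1 := h 1
  have h2 := h 2
  have h3 := h 3
  have h4 := h 4
  have h5 := h 5
  have h6 := h 6
  have h7 := h 7
  have e : (a 0 * a 1 * a 6 * a 7) * (a 2 * a 3 * a 4 * a 5) = 1 := by
    linear_combination a 4 * a 5 * a 6 * a 7 * hl + hr
  constructor
  · rw [qParam]
    field_simp
    linear_combination -e
  · rw [qParam, inv_div]
    field_simp
    linear_combination -e

theorem IsParam.iterate_four (ha : IsParam a) :
    CaseIIOne.nextParam^[4] a = ![qParam a * a 0, qParam a * a 1, a 2 / qParam a, a 3 / qParam a,
      qParam a * a 4, qParam a * a 5, a 6 / qParam a, a 7 / qParam a] := by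
  have hl := ha.norm_left
  have hr := ha.norm_right
  have h2 := ha.nextParam
  have h3 := h2.nextParam
  have h4 := h3.nextParam
  obtain ⟨q1, q2⟩ := ha.qParam_eq
  have e : CaseIIOne.nextParam^[4] a = CaseIIOne.nextParam (CaseIIOne.nextParam
    (CaseIIOne.nextParam (CaseIIOne.nextParam a))) := rfl
  simp only [div_eq_mul_inv]
  rw [e, h4.nextParam_eq_mul, h3.nextParam_eq_mul, h2.nextParam_eq_mul, ha.nextParam_eq_mul,
    q2, q1]
  simp only [Matrix.cons_val]
  have e3 : a 3 = (a 0 * a 1 * a 2)⁻¹ := eq_inv_of_mul_eq_one_right hl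
  have e7 : a 7 = (a 4 * a 5 * a 6)⁻¹ := eq_inv_of_mul_eq_one_right hr
  have n := ha.ne_zero
  have n0 := n 0
  have n1 := n 1
  have n2 := n 2
  have n4 := n 4
  have n5 := n 5
  have n6 := n 6
  rw [e3, e7]
  -- Compare the eight entries one by one.
  congr 1 <;> [skip; congr 1 <;> [skip; congr 1 <;> [skip; congr 1 <;> [skip; congr 1 <;> [skip;
    congr 1 <;> [skip; congr 1 <;> [skip; congr 1]]]]]]]
  all_goals field_simp
end

/-! ### The lattice -/

theorem antiK_eq : antiK = ∑ i, sides i := by decide +kernel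

theorem inter_apply (A B : Pic) : inter A B = A ⬝ᵥ Matrix.mulVec gram B := by
  rw [inter, Matrix.toBilin'_apply']

theorem inter_sides (i j : Fin 4) : inter (sides i) (sides j) = -cartanA i j := by
  rw [inter_apply]
  revert i j
  decide +kernel

theorem phiPic_sides (i : Fin 4) : phiPic (sides i) = sides (![1, 0, 3, 2] i) := by
  revert i
  decide +kernel

theorem inter_root (i j : Fin 6) : inter (root i) (root j) = -cartanD i j := by
  rw [inter_apply]
  revert i j
  decide +kernel

/-- The map to the Picard lattice in coordinates. -/
theorem toPic_apply (v : RootLattice) : toPic v =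
    ![v 3, v 2, v 0 - v 2, -v 0, v 1 - v 2, -v 1, v 4 - v 3, -v 4, v 5 - v 3, -v 5] := by
  have : toPic v = ∑ i, v i • root i := Fintype.linearCombination_apply ..
  rw [this]
  funext k
  fin_cases k <;> simp [Fin.sum_univ_six, root, Hx, Hy, E, Fin.ext_iff] <;> ring

theorem toPic_simple (i : Fin 6) : toPic (simple i) = root i := by
  simp [toPic, simple, Fintype.linearCombination_apply_single]

theorem toPic_delta : toPic delta = antiK := by
  rw [toPic_apply]
  decide +kernel

theorem toPic_injective : Function.Injective toPic := by
  intro v w h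
  rw [toPic_apply, toPic_apply] at h
  have h0 := congrFun h 3
  have h1 := congrFun h 5
  have h2 := congrFun h 1
  have h3 := congrFun h 0
  have h4 := congrFun h 7
  have h5 := congrFun h 9
  simp at h0 h1 h2 h3 h4 h5
  funext i
  fin_cases i <;> assumption

/-- The intersection numbers with `D_0, ..., D_3` in coordinates. -/
theorem inter_side (A : Pic) :
    inter A (sides 0) = A 1 + A 2 + A 3 ∧ inter A (sides 1) = A 0 + A 6 + A 7 ∧
    inter A (sides 2) = A 1 + A 4 + A 5 ∧ inter A (sides 3) = A 0 + A 8 + A 9 := by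
  have h : ∀ i, Matrix.mulVec gram (sides i) = ![![0, 1, 1, 1, 0, 0, 0, 0, 0, 0],
    ![1, 0, 0, 0, 0, 0, 1, 1, 0, 0], ![0, 1, 0, 0, 1, 1, 0, 0, 0, 0],
    ![1, 0, 0, 0, 0, 0, 0, 0, 1, 1]] i := by decide +kernel
  simp only [inter_apply, h]
  simp [dotProduct, Fin.sum_univ_succ]
  refine ⟨?_, ?_, ?_, ?_⟩ <;> ring

theorem mem_range_toPic (A : Pic) :
    A ∈ LinearMap.range toPic ↔ ∀ i, inter A (sides i) = 0 := by
  obtain ⟨h0, h1, h2, h3⟩ := inter_side A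
  constructor
  · rintro ⟨v, rfl⟩ i
    rw [toPic_apply] at *
    fin_cases i
    · exact h0.trans (by simp)
    · exact h1.trans (by simp)
    · exact h2.trans (by simp)
    · exact h3.trans (by simp)
  · intro h
    rw [h 0] at h0
    rw [h 1] at h1
    rw [h 2] at h2
    rw [h 3] at h3
    refine ⟨![-A 3, -A 5, A 1, A 0, -A 7, -A 9], ?_⟩
    rw [toPic_apply]
    funext k
    fin_cases k <;> simp <;> omega

/-! ### The extended affine Weyl group -/

/-- The action of the mapping on the root lattice. -/
def weylElement : RootLattice ≃ₗ[ℤ] RootLattice :=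
  sigma * sigmaTot * sigma * w 2 * w 1 * w 0 * w 2 * w 1 * w 0

theorem coroot_simple_apply (i j : Fin 6) : coroot i (simple j) = cartanD i j := by
  have : coroot i (simple j) = -(inter (root i) (toPic (simple j))) := rfl
  rw [this, toPic_simple, inter_root, neg_neg]

theorem eq_sum_smul_simple (v : RootLattice) : v = ∑ i, v i • simple i := by
  funext k
  simp [simple, Finset.sum_apply, Pi.single_apply]

theorem w_apply (i : Fin 6) (v : RootLattice) :
    w i v = v - (∑ j, v j * cartanD i j) • simple i := by
  have h : coroot i v = ∑ j, v j * cartanD i j := by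
    conv_lhs => rw [eq_sum_smul_simple v, map_sum]
    exact Finset.sum_congr rfl fun j _ => by rw [map_smul, coroot_simple_apply, smul_eq_mul]
  rw [w, Module.reflection_apply, h]

theorem w_zero_apply (v : RootLattice) : w 0 v = ![v 2 - v 0, v 1, v 2, v 3, v 4, v 5] := by
  rw [w_apply]
  funext k
  fin_cases k <;> simp [Fin.sum_univ_six, cartanD, simple]
  ring

theorem w_one_apply (v : RootLattice) : w 1 v = ![v 0, v 2 - v 1, v 2, v 3, v 4, v 5] := by
  rw [w_apply]
  funext k
  fin_cases k <;> simp [Fin.sum_univ_six, cartanD, simple]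
  ring

theorem w_two_apply (v : RootLattice) :
    w 2 v = ![v 0, v 1, v 0 + v 1 + v 3 - v 2, v 3, v 4, v 5] := by
  rw [w_apply]
  funext k
  fin_cases k <;> simp [Fin.sum_univ_six, cartanD, simple]
  ring

theorem permRoots_apply (p : Equiv.Perm (Fin 6)) (v : RootLattice) :
    permRoots p v = fun i => v (p.symm i) := rfl

theorem sigma_apply (v : RootLattice) : sigma v = ![v 1, v 0, v 2, v 3, v 4, v 5] := by
  rw [sigma, permRoots_apply]
  funext k
  fin_cases k <;> rfl

theorem sigmaTot_apply (v : RootLattice) : sigmaTot v = ![v 5, v 4, v 3, v 2, v 1, v 0] := by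
  rw [sigmaTot, permRoots_apply]
  funext k
  fin_cases k <;> rfl

theorem weylElement_apply (v : RootLattice) : weylElement v =
    ![v 4, v 5, v 3, 2 * v 3 - v 2, v 3 - v 1, v 3 - v 0] := by
  simp only [weylElement, LinearEquiv.mul_apply, sigma_apply, sigmaTot_apply, w_zero_apply,
    w_one_apply, w_two_apply, Matrix.cons_val]
  funext k
  fin_cases k <;> simp only [Fin.zero_eta, Fin.mk_one, Fin.reduceFinMk, Matrix.cons_val] <;> ring

theorem weylElement_pow_apply (v : RootLattice) :
    (weylElement ^ 4) v = v + (2 * v 3 - 2 * v 2) • delta := by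
  have : (weylElement ^ 4) v = weylElement (weylElement (weylElement (weylElement v))) := by
    rw [pow_succ, pow_succ, pow_succ, pow_one]
    simp only [LinearEquiv.mul_apply]
  rw [this]
  simp only [weylElement_apply, Matrix.cons_val]
  funext k
  fin_cases k <;> simp [delta] <;> ring

theorem weylElement_pow_simple {i : Fin 6} (h2 : i ≠ 2) (h3 : i ≠ 3) :
    (weylElement ^ 4) (simple i) = simple i := by
  rw [weylElement_pow_apply]
  simp [simple, h2.symm, h3.symm]

theorem weylElement_mem : weylElement ∈ extendedWeylGroup := by
  have hw : ∀ i, w i ∈ extendedWeylGroup := fun i =>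
    Subgroup.subset_closure (.inl ⟨i, rfl⟩)
  have hs : sigma ∈ extendedWeylGroup :=
    Subgroup.subset_closure (Set.mem_union_right _ (Set.mem_insert _ _))
  have ht : sigmaTot ∈ extendedWeylGroup :=
    Subgroup.subset_closure (Set.mem_union_right _ (Set.mem_insert_of_mem _ (Set.mem_singleton _)))
  exact mul_mem (mul_mem (mul_mem (mul_mem (mul_mem (mul_mem (mul_mem (mul_mem hs ht) hs) (hw 2))
    (hw 1)) (hw 0)) (hw 2)) (hw 1)) (hw 0)

theorem phiPic_apply (A : Pic) : phiPic A =
    ![2 * A 0 + A 1 + A 2 + A 3 + A 4 + A 5, A 0, A 6, A 7, A 8, A 9, -A 0 - A 4, -A 0 - A 5,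
      -A 0 - A 2, -A 0 - A 3] := by
  funext k
  fin_cases k <;> simp [phiPic, Matrix.vecMul, dotProduct, Fin.sum_univ_succ] <;>
    ring

theorem toPic_weylElement (v : RootLattice) : toPic (weylElement v) = phiPic (toPic v) := by
  rw [weylElement_apply, toPic_apply, toPic_apply, phiPic_apply]
  funext k
  fin_cases k <;> simp <;> ring

theorem isTranslation_weylElement_pow : IsTranslation (weylElement ^ 4) := by
  refine ⟨2 • LinearMap.proj 3 - 2 • LinearMap.proj 2, ?_, ?_, fun v => ?_⟩
  · intro h
    have := LinearMap.congr_fun h (simple 3)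
    simp [simple] at this
  · simp [delta]
  · rw [weylElement_pow_apply]
    simp

end CaseIIOne

end

theorem mainTheorem5 :
    -- the autonomous mapping
    (∀ a : ℂ, a ≠ 0 → a ^ 4 ≠ 1 →
      -- the mapping `(x_{n-1}, x_n) ↦ (x_n, x_{n+1})` lifts to an automorphism of the surface
      ∃ Φ : CaseIIOne.surface (CaseIIOne.autoParam a) ≃ CaseIIOne.surface (CaseIIOne.autoParam a),
        CaseIIOne.IsIsomorphism Φ ∧
        (∀ (z : CaseIIOne.surface (CaseIIOne.autoParam a)) (x y : ℂ),
          CaseIIOne.Over z x y → (y + a) * (y + 1 / a) ≠ 0 →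
          CaseIIOne.Over (Φ z) y (-x * ((y - a) * (y - 1 / a)) / ((y + a) * (y + 1 / a)))) ∧
        CaseIIOne.IsPushforward Φ CaseIIOne.phiPic ∧
        -- the anticanonical system is the pencil spanned by the two forms of bidegree (2, 2)
        CaseIIOne.anticanonicalForms (CaseIIOne.points (CaseIIOne.autoParam a)) =
          Submodule.span ℂ {CaseIIOne.formOne, CaseIIOne.formTwo a} ∧
        Module.finrank ℂ
          (CaseIIOne.anticanonicalForms (CaseIIOne.points (CaseIIOne.autoParam a))) = 2 ∧
        -- whose members are elliptic curves up to finitely many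
        {k : ℂ | ¬ CaseIIOne.IsSmoothCurve
          (MvPolynomial.C k * CaseIIOne.formOne - CaseIIOne.formTwo a)}.Finite ∧
        -- it is a fibration of the surface, and the automorphism maps the fibre `k` to `-k`
        ∃ K : CaseIIOne.surface (CaseIIOne.autoParam a) → CaseIIOne.Line,
          CaseIIOne.IsRegular K ∧
          (∀ (z : CaseIIOne.surface (CaseIIOne.autoParam a)) (p : Fin 2 → Fin 2 → ℂ),
            (∀ b, CaseIIOne.HasCoords (z.1.1 b) (p b)) →
            ![CaseIIOne.valueAt p (CaseIIOne.formTwo a),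
              CaseIIOne.valueAt p CaseIIOne.formOne] ≠ 0 →
            CaseIIOne.HasCoords (K z) ![CaseIIOne.valueAt p (CaseIIOne.formTwo a),
              CaseIIOne.valueAt p CaseIIOne.formOne]) ∧
          ∀ (z : CaseIIOne.surface (CaseIIOne.autoParam a)) (k₀ k₁ : ℂ),
            CaseIIOne.HasCoords (K z) ![k₀, k₁] → CaseIIOne.HasCoords (K (Φ z)) ![-k₀, k₁]) ∧
    -- the deautonomized mapping specializes to the autonomous one, with q = 1
    (∀ a : ℂ, a ≠ 0 → a ^ 4 ≠ 1 →
      CaseIIOne.IsParam (CaseIIOne.autoParam a) ∧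
      CaseIIOne.nextParam (CaseIIOne.autoParam a) = CaseIIOne.autoParam a ∧
      CaseIIOne.qParam (CaseIIOne.autoParam a) = 1 ∧
      ∀ x y : ℂ, CaseIIOne.nextY (CaseIIOne.autoParam a) x y =
        -x * ((y - a) * (y - 1 / a)) / ((y + a) * (y + 1 / a))) ∧
    -- the deautonomized mapping lifts to isomorphisms between the surfaces of the family
    (∀ a : Fin 8 → ℂ, CaseIIOne.IsParam a →
      a 0 ≠ a 2 → a 0 ≠ a 3 → a 1 ≠ a 2 → a 1 ≠ a 3 →
      ∃ Φ : CaseIIOne.surface a ≃ CaseIIOne.surface (CaseIIOne.nextParam a),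
        CaseIIOne.IsIsomorphism Φ ∧
        (∀ (z : CaseIIOne.surface a) (x y : ℂ),
          CaseIIOne.Over z x y → (y - a 0) * (y - a 1) ≠ 0 →
          CaseIIOne.Over (Φ z) y (CaseIIOne.nextY a x y)) ∧
        CaseIIOne.IsPushforward Φ CaseIIOne.phiPic) ∧
    -- the action on the parameters; the fourth iterate is a q-shift
    (∀ a : Fin 8 → ℂ, CaseIIOne.IsParam a →
      CaseIIOne.IsParam (CaseIIOne.nextParam a) ∧
      CaseIIOne.sqrtQ a ^ 2 = CaseIIOne.qParam a ∧
      CaseIIOne.qParam (CaseIIOne.nextParam a) = (CaseIIOne.qParam a)⁻¹ ∧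
      CaseIIOne.nextParam^[4] a =
        ![CaseIIOne.qParam a * a 0, CaseIIOne.qParam a * a 1,
          a 2 / CaseIIOne.qParam a, a 3 / CaseIIOne.qParam a,
          CaseIIOne.qParam a * a 4, CaseIIOne.qParam a * a 5,
          a 6 / CaseIIOne.qParam a, a 7 / CaseIIOne.qParam a]) ∧
    -- the surface type: the anticanonical decomposition of type A_3^{(1)} is preserved
    (CaseIIOne.antiK = ∑ i, CaseIIOne.sides i ∧
      (∀ i j, CaseIIOne.inter (CaseIIOne.sides i) (CaseIIOne.sides j) =
        -CaseIIOne.cartanA i j) ∧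
      (∀ i, CaseIIOne.phiPic (CaseIIOne.sides i) = CaseIIOne.sides (![1, 0, 3, 2] i))) ∧
    -- the symmetry type: the simple roots form a basis, of type D_5^{(1)}, of the orthogonal
    -- complement of the components
    (Function.Injective CaseIIOne.toPic ∧
      (∀ A : CaseIIOne.Pic, A ∈ LinearMap.range CaseIIOne.toPic ↔
        ∀ i, CaseIIOne.inter A (CaseIIOne.sides i) = 0) ∧
      (∀ i j, CaseIIOne.inter (CaseIIOne.root i) (CaseIIOne.root j) = -CaseIIOne.cartanD i j) ∧
      CaseIIOne.toPic CaseIIOne.delta = CaseIIOne.antiK) ∧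
    -- the mapping lies in the extended affine Weyl group and its fourth power is a translation
    (∃ g : CaseIIOne.RootLattice ≃ₗ[ℤ] CaseIIOne.RootLattice,
      (∀ v, CaseIIOne.toPic (g v) = CaseIIOne.phiPic (CaseIIOne.toPic v)) ∧
      g ∈ CaseIIOne.extendedWeylGroup ∧
      g = CaseIIOne.sigma * CaseIIOne.sigmaTot * CaseIIOne.sigma *
        CaseIIOne.w 2 * CaseIIOne.w 1 * CaseIIOne.w 0 *
        CaseIIOne.w 2 * CaseIIOne.w 1 * CaseIIOne.w 0 ∧
      g (CaseIIOne.simple 0) = -CaseIIOne.simple 5 ∧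
      g (CaseIIOne.simple 1) = -CaseIIOne.simple 4 ∧
      g (CaseIIOne.simple 2) = -CaseIIOne.simple 3 ∧
      g (CaseIIOne.simple 3) = CaseIIOne.simple 2 + 2 • CaseIIOne.simple 3 +
        CaseIIOne.simple 4 + CaseIIOne.simple 5 ∧
      g (CaseIIOne.simple 4) = CaseIIOne.simple 0 ∧
      g (CaseIIOne.simple 5) = CaseIIOne.simple 1 ∧
      CaseIIOne.IsTranslation (g ^ 4) ∧
      g ^ 4 ∈ CaseIIOne.extendedWeylGroup ∧
      (g ^ 4) (CaseIIOne.simple 2) = CaseIIOne.simple 2 - 2 • CaseIIOne.delta ∧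
      (g ^ 4) (CaseIIOne.simple 3) = CaseIIOne.simple 3 + 2 • CaseIIOne.delta ∧
      ∀ i, i ≠ 2 → i ≠ 3 → (g ^ 4) (CaseIIOne.simple i) = CaseIIOne.simple i) := by
  refine ⟨fun a ha ha4 => ?_, fun a ha ha4 => ?_, fun a ha h02 h03 h12 h13 => ?_, fun a ha => ?_,
    ⟨CaseIIOne.antiK_eq, CaseIIOne.inter_sides, CaseIIOne.phiPic_sides⟩,
    ⟨CaseIIOne.toPic_injective, CaseIIOne.mem_range_toPic, CaseIIOne.inter_root,
      CaseIIOne.toPic_delta⟩,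
    ⟨CaseIIOne.weylElement, CaseIIOne.toPic_weylElement, CaseIIOne.weylElement_mem, rfl,
      ?_, ?_, ?_, ?_, ?_, ?_, CaseIIOne.isTranslation_weylElement_pow,
      pow_mem CaseIIOne.weylElement_mem 4, ?_, ?_,
      fun i h2 h3 => CaseIIOne.weylElement_pow_simple h2 h3⟩⟩
  · obtain ⟨h02, h03, h12, h13⟩ := CaseIIOne.autoParam_ne ha ha4
    obtain ⟨Φ, hΦ, hrep, hpush⟩ := CaseIIOne.exists_isomorphism
      (CaseIIOne.autoParam_isParam ha ha4) (CaseIIOne.nextParam_autoParam ha ha4).symm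
      h02 h03 h12 h13
    refine ⟨Φ, hΦ, fun z x y h hne => ?_, hpush, CaseIIOne.anticanonicalForms_eq ha ha4,
      CaseIIOne.finrank_anticanonicalForms ha ha4, CaseIIOne.finite_singular ha ha4,
      CaseIIOne.exists_pencil_map ha ha4 hrep⟩
    obtain ⟨v, hv⟩ := CaseIIOne.exists_represents z.1
    rw [← CaseIIOne.nextY_autoParam ha]
    exact CaseIIOne.over_phi (CaseIIOne.autoParam_swap_generic ha ha4) z.2 hv (hrep z v hv) h
      (by rwa [CaseIIOne.sub_autoParam_mul])
  · exact ⟨CaseIIOne.autoParam_isParam ha ha4, CaseIIOne.nextParam_autoParam ha ha4,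
      CaseIIOne.qParam_autoParam ha, CaseIIOne.nextY_autoParam ha⟩
  · obtain ⟨Φ, hΦ, hrep, hpush⟩ := CaseIIOne.exists_isomorphism ha rfl h02 h03 h12 h13
    refine ⟨Φ, hΦ, fun z x y h hne => ?_, hpush⟩
    obtain ⟨v, hv⟩ := CaseIIOne.exists_represents z.1
    exact CaseIIOne.over_phi (ha.generic_swapParam h02 h03 h12 h13) z.2 hv (hrep z v hv) h hne
  · exact ⟨ha.nextParam, ha.sqrtQ_sq, ha.qParam_nextParam, ha.iterate_four⟩
  · rw [CaseIIOne.weylElement_apply]; decide +kernel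
  · rw [CaseIIOne.weylElement_apply]; decide +kernel
  · rw [CaseIIOne.weylElement_apply]; decide +kernel
  · rw [CaseIIOne.weylElement_apply]; decide +kernel
  · rw [CaseIIOne.weylElement_apply]; decide +kernel
  · rw [CaseIIOne.weylElement_apply]; decide +kernel
  · rw [CaseIIOne.weylElement_pow_apply]; decide +kernel
  · rw [CaseIIOne.weylElement_pow_apply]; decide +kernel
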